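/- **Setting.** Let $M$ be an oriented smooth Riemannian manifold without boundary (Hausdorff, $\sigma$-compact, not necessarily compact or connected) of dimension $n\ge 1$, with Riemannian volume form $\mu$. Let $\Gamma_0\subset M$ be a closed embedded smooth hypersurface that divides $M$ into open regions $D^+_{\Gamma_0}$ and $D^-_{\Gamma_0}$, one on each side of $\Gamma_0$ near each of its points. All fields and $1$-forms below have compact support (no condition if $M$ is compact). $G_V$ is the group of time-one maps of smooth compactly supported flows of time-dependent vector fields, and $V(M)$ is the set of images $\Gamma=\phi(\Gamma_0)$, $\phi\in G_V$, together with their sides $D^\pm_\Gamma=\phi(D^\pm_{\Gamma_0})$. A smooth curve in $V(M)$ is $\Gamma_t=\phi_t(\Gamma_{t=0})$ for such a flow $\phi_t$; its tangent vector $\partial_t\Gamma_t\in\Omega^{n-1}(\Gamma_t)$ is the restriction of $i_{w_t}\mu$ to $\Gamma_t$, where $w_t$ is the velocity field of $\phi_t$. Each $\Gamma$ is oriented as the boundary of $D^+_\Gamma$. A vector field, function or $1$-form discontinuous along $\Gamma$ is a pair $\xi=\chi^+_\Gamma\xi^++\chi^-_\Gamma\xi^-$ with $\xi^\pm$ smooth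 on $D^\pm_\Gamma$ up to $\Gamma$. Operations with superscript $R$ (Lie bracket, time derivative) are applied to $\xi^+$ and $\xi^-$ separately, and $\mathrm{jump}(f)=f^+|_\Gamma-f^-|_\Gamma$. Let $DVect(M,\Gamma)$ be the space of discontinuous vector fields $u$ such that $u^+-u^-$ is tangent to $\Gamma$ along $\Gamma$; no divergence-free condition is imposed. The anchor $\#u\in\Omega^{n-1}(\Gamma)=T_\Gamma V(M)$ is the restriction of $i_u\mu$ to $\Gamma$. Let $DVect(M,\Gamma)^*$ be the space of $\tilde m=m\otimes\mu$ with $m$ a discontinuous $1$-form, with pairing $\langle\tilde m,u\rangle=\int_M(i_um)\,\mu$, and let $DVect(M)^*=\bigcup_{\Gamma\in V(M)}DVect(M,\Gamma)^*$. A cotangent vector $\tilde n$ of $V(M)$ at $\Gamma$ is given by a smooth function $n$ on $\Gamma$, with $\langle\tilde n,\xi\rangle=\int_\Gamma n\,\xi$. A family of discontinuous fields over a smooth curve $\Gamma_t$ is smooth if its two sides are smooth in $(t,x)$ up to $\Gamma_t$; a section over $V(M)$ is smooth if it takes smooth curves to smooth curves. A function $F:DVect(M)^*\to\mathbb R$ is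 differentiable with differential $dF=(d^FF,d^BF)$, where $d^FF(\tilde m)\in DVect(M,\Gamma)$ and $d^BF(\tilde m)\in T^*_\Gamma V(M)$, if $d^FF$ takes smooth curves to smooth curves and, for every smooth curve $\tilde m_t$ over $\Gamma_t$, $$\frac{d}{dt}F(\tilde m_t)=\langle d^FF(\tilde m_t),\partial^R_t\tilde m_t\rangle+\langle d^BF(\tilde m_t),\partial_t\Gamma_t\rangle .$$ The Poisson bracket of such $F_1,F_2$ at $\tilde m\in DVect(M,\Gamma)^*$ is $$\{F_1,F_2\}(\tilde m)=\langle\tilde m,[U_1,U_2](\Gamma)\rangle+\#U_1(\Gamma)\cdot\big(F_2(A)-\langle A,U_2\rangle\big)-\#U_2(\Gamma)\cdot\big(F_1(A)-\langle A,U_1\rangle\big),$$ where $A$ is any smooth section of $DVect(M)^*$ with $A(\Gamma)=\tilde m$, $U_i=d^FF_i\circ A$, and $[U_1,U_2](\Gamma)=[U_1(\Gamma),U_2(\Gamma)]^R+\mathcal L_{\#U_1(\Gamma)}U_2-\mathcal L_{\#U_2(\Gamma)}U_1$ is the algebroid bracket. All derivatives in the direction $\#U_i(\Gamma)$ are taken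 along one smooth curve $\Gamma_i(t)$ in $V(M)$ with $\Gamma_i(0)=\Gamma$ and tangent vector $\#U_i(\Gamma)$ at $t=0$ (for $\mathcal L$, the regularized derivative). **Theorem (Poisson bracket on the dual algebroid).** Let $F_1,F_2:DVect(M)^*\to\mathbb R$ be differentiable, let $\tilde m=m\otimes\mu\in DVect(M,\Gamma)^*$ and $dF_i(\tilde m)=(v_i,\tilde n_i)$. Then an extension $A$ and curves $\Gamma_1(t)$, $\Gamma_2(t)$ as above exist, and for all choices of them the derivatives in the definition of the bracket exist and $$\{F_1,F_2\}(\tilde m)=\int_M m([v_1,v_2]^R)\,\mu+\int_\Gamma\big(n_2-\mathrm{jump}(i_{v_2}m)\big)\,i_{v_1}\mu-\int_\Gamma\big(n_1-\mathrm{jump}(i_{v_1}m)\big)\,i_{v_2}\mu .$$ -/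

import Mathlib

open Set MeasureTheory
open scoped Manifold ContDiff Topology Bundle

namespace DiscontinuousFlow

noncomputable section

/-- The model space `ℝⁿ` with `n = d + 1`. -/
abbrev Model (d : ℕ) : Type := EuclideanSpace ℝ (Fin (d + 1))

section Fields

variable (d : ℕ) (M : Type*) [TopologicalSpace M] [ChartedSpace (Model d) M]

/-- Vector fields on `M`, without any regularity. -/
abbrev VField : Type _ := ∀ x : M, TangentSpace (𝓡 (d + 1)) x

/-- `1`-forms on `M`, without any regularity. -/
abbrev OneForm : Type _ := ∀ x : M, TangentSpace (𝓡 (d + 1)) x →L[ℝ] ℝ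

/-- Exterior forms of degree `k` on `M`, without any regularity. -/
abbrev KForm (k : ℕ) : Type _ := ∀ x : M, (TangentSpace (𝓡 (d + 1)) x) [⋀^Fin k]→ₗ[ℝ] ℝ

variable {d M}

variable [IsManifold (𝓡 (d + 1)) ∞ M]

/-- The family of vector fields `V t` is smooth, jointly in the time `t` and the point. -/
def SmoothVFamily (V : ℝ → VField d M) : Prop :=
  ContMDiff (𝓘(ℝ, ℝ).prod (𝓡 (d + 1))) (𝓡 (d + 1)).tangent ∞
    (fun p : ℝ × M => (⟨p.2, V p.1 p.2⟩ : TangentBundle (𝓡 (d + 1)) M))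

/-- The family of `1`-forms `m t` is smooth, jointly in the time `t` and the point. -/
def SmoothFormFamily (m : ℝ → OneForm d M) : Prop :=
  ContMDiff (𝓘(ℝ, ℝ).prod (𝓡 (d + 1))) ((𝓡 (d + 1)).prod 𝓘(ℝ, Model d →L[ℝ] ℝ)) ∞
    (fun p : ℝ × M => Bundle.TotalSpace.mk' (Model d →L[ℝ] ℝ)
      (E := fun x : M => TangentSpace (𝓡 (d + 1)) x →L[ℝ] Bundle.Trivial M ℝ x)
      p.2 (m p.1 p.2))

/-- Over every bounded time interval, the fields `V t` vanish outside one compact set.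
(Nothing is demanded if `M` is compact.) -/
def LocUnifCompactSupport {T : M → Type*} [∀ x, Zero (T x)] (V : ℝ → ∀ x, T x) : Prop :=
  ∀ R : ℝ, ∃ K : Set M, IsCompact K ∧ ∀ t, |t| ≤ R → ∀ x ∉ K, V t x = 0

/-- The coefficient `μ(∂₀, …, ∂_d)` of an `n`-form in the chart `e`, at the point with
coordinates `y`. -/
def chartCoeff (μ : KForm d M (d + 1)) (e : OpenPartialHomeomorph M (Model d)) (y : Model d) : ℝ :=
  μ (e.symm y) fun i =>
    mfderiv (𝓡 (d + 1)) (𝓡 (d + 1)) e.symm y (EuclideanSpace.single i (1 : ℝ) : Model d)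

/-- `μ` is a smooth form of top degree. -/
def IsSmoothTopForm (μ : KForm d M (d + 1)) : Prop :=
  ∀ e ∈ IsManifold.maximalAtlas (𝓡 (d + 1)) ∞ M, ContDiffOn ℝ ∞ (chartCoeff μ e) e.target

/-- `μ` is a Riemannian volume form: smooth, with value `±1` on all orthonormal frames. (Its sign
is the orientation of `M`.) -/
def IsRiemannianVolumeForm [Bundle.RiemannianBundle (fun x : M => TangentSpace (𝓡 (d + 1)) x)]
    (μ : KForm d M (d + 1)) : Prop :=
  IsSmoothTopForm μ ∧
    ∀ (x : M) (b : Fin (d + 1) → TangentSpace (𝓡 (d + 1)) x), Orthonormal ℝ b → |μ x b| = 1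

/-- Contraction `i_v μ`. -/
def contract (v : VField d M) (μ : KForm d M (d + 1)) : KForm d M d :=
  fun x => (μ x).curryLeft (v x)

end Fields

section Integration

variable {d : ℕ} {M : Type*} [TopologicalSpace M] [ChartedSpace (Model d) M]
  [IsManifold (𝓡 (d + 1)) ∞ M] [T2Space M] [SigmaCompactSpace M]

variable (d M) in
/-- A smooth partition of unity subordinate to the charts of `M`. -/
def chartPartition : SmoothPartitionOfUnity M (𝓡 (d + 1)) M univ :=
  (SmoothPartitionOfUnity.exists_isSubordinate_chartAt_source (𝓡 (d + 1)) M).choose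

/-- The measure on the manifold `M`, oriented by the volume form `μ`, such that the integral of a
function `f` against it is `∫_M f μ`: in charts it is `|μ(∂₀, …, ∂_d)|` times Lebesgue measure, and
the charts are put together by a partition of unity. -/
def volumeMeasure [MeasurableSpace M] (μ : KForm d M (d + 1)) : Measure M :=
  Measure.sum fun i : M =>
    Measure.map (chartAt (Model d) i).symm
      (((volume : Measure (Model d)).restrict (chartAt (Model d) i).target).withDensity fun y =>
        ENNReal.ofReal (chartPartition d M i ((chartAt (Model d) i).symm y) *
          |chartCoeff μ (chartAt (Model d) i) y|))

end Integration

section Hypersurfaces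

variable (d : ℕ) (M : Type*) [TopologicalSpace M] [ChartedSpace (Model d) M]

/-- A hypersurface `Γ` (`carrier`) that divides `M` into the two open regions `D⁺` (`plus`) and
`D⁻` (`minus`): near every point of `Γ` there is a chart of the smooth structure in which `D⁺`, `Γ`
and `D⁻` are given by `y₀ < 0`, `y₀ = 0` and `y₀ > 0`. In particular `Γ = ∂D⁺ = ∂D⁻` as sets. -/
structure Hypersurface where
  plus : Set M
  carrier : Set M
  minus : Set M
  isOpen_plus : IsOpen plus
  isOpen_minus : IsOpen minus
  disjoint_plus_minus : Disjoint plus minus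
  carrier_eq : carrier = (plus ∪ minus)ᶜ
  exists_slice : ∀ p ∈ carrier, ∃ e ∈ IsManifold.maximalAtlas (𝓡 (d + 1)) ∞ M, p ∈ e.source ∧
    ∀ x ∈ e.source, (x ∈ plus ↔ e x 0 < 0) ∧ (x ∈ carrier ↔ e x 0 = 0) ∧ (x ∈ minus ↔ 0 < e x 0)

variable {d M}

namespace Hypersurface

variable (S : Hypersurface d M)

/-- `D⁺` together with its boundary. -/
def closedPlus : Set M := S.plus ∪ S.carrier

/-- `D⁻` together with its boundary. -/
def closedMinus : Set M := S.minus ∪ S.carrier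

/-- The tangent vector `w` of `M` at a point `x` of `Γ` is tangent to `Γ`: it annihilates the smooth
functions (near `x`) that vanish on `Γ`. -/
def IsTangent (x : M) (w : TangentSpace (𝓡 (d + 1)) x) : Prop :=
  ∀ h : M → ℝ, ContMDiffAt (𝓡 (d + 1)) 𝓘(ℝ, ℝ) ∞ h x → (∀ᶠ y in 𝓝[S.carrier] x, h y = 0) →
    mfderiv (𝓡 (d + 1)) 𝓘(ℝ, ℝ) h x w = 0

/-- Equality, as `(n-1)`-forms on `Γ`, of the restrictions of two forms of degree `n - 1 = d`. -/
def FormEqOn (α β : KForm d M d) : Prop :=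
  ∀ x ∈ S.carrier, ∀ z : Fin d → TangentSpace (𝓡 (d + 1)) x, (∀ i, S.IsTangent x (z i)) →
    α x z = β x z

lemma isClosed_carrier : IsClosed S.carrier := by
  rw [S.carrier_eq]
  exact (S.isOpen_plus.union S.isOpen_minus).isClosed_compl

/-- A slice chart around a point of `Γ`. -/
def slice (p : S.carrier) : OpenPartialHomeomorph M (Model d) :=
  (S.exists_slice p p.2).choose

lemma mem_slice_source (p : S.carrier) : (p : M) ∈ (S.slice p).source :=
  (S.exists_slice p p.2).choose_spec.2.1

variable [IsManifold (𝓡 (d + 1)) ∞ M] [T2Space M] [SigmaCompactSpace M]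

lemma exists_partition :
    ∃ f : SmoothPartitionOfUnity S.carrier (𝓡 (d + 1)) M S.carrier,
      f.IsSubordinate fun p => (S.slice p).source :=
  SmoothPartitionOfUnity.exists_isSubordinate (𝓡 (d + 1)) S.isClosed_carrier _
    (fun p => (S.slice p).open_source)
    (fun x hx => mem_iUnion_of_mem ⟨x, hx⟩ (S.mem_slice_source ⟨x, hx⟩))

/-- A partition of unity on `Γ` subordinate to slice charts. -/
def partition : SmoothPartitionOfUnity S.carrier (𝓡 (d + 1)) M S.carrier :=
  S.exists_partition.choose

end Hypersurface

/-- The point `(0, y)` of `ℝ × ℝ^d`. -/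
def face {d : ℕ} (y : EuclideanSpace ℝ (Fin d)) : Model d :=
  WithLp.toLp 2 (Fin.cons (0 : ℝ) fun i => y i)

variable [IsManifold (𝓡 (d + 1)) ∞ M] [T2Space M] [SigmaCompactSpace M]

/-- The integral `∫_Γ α` of a form `α` of degree `n - 1 = d` over `Γ`, oriented as the boundary of
`D⁺` (outward normal first, with respect to the orientation of `M` given by the volume form `μ`).
In a slice chart `∂₀` points out of `D⁺`, so that `(∂₁, …, ∂_d)` is a positive frame of `Γ` where
`μ(∂₀, ∂₁, …, ∂_d) > 0`. -/
def surfaceIntegral (μ : KForm d M (d + 1)) (S : Hypersurface d M) (α : KForm d M d) : ℝ :=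
  ∑ᶠ p : S.carrier, ∫ y in {y : EuclideanSpace ℝ (Fin d) | face y ∈ (S.slice p).target},
    S.partition p ((S.slice p).symm (face y)) *
      (Real.sign (chartCoeff μ (S.slice p) (face y)) *
        α ((S.slice p).symm (face y)) fun i =>
          mfderiv (𝓡 (d + 1)) (𝓡 (d + 1)) (S.slice p).symm (face y)
            (EuclideanSpace.single i.succ (1 : ℝ) : Model d))

end Hypersurfaces

section Discontinuous

/-- A field `χ⁺ ξ⁺ + χ⁻ ξ⁻`, discontinuous along a hypersurface, as the pair of `ξ⁺` and `ξ⁻`. -/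
structure TwoSided (X : Type*) where
  plus : X
  minus : X

variable {d : ℕ} {M : Type*} [TopologicalSpace M] [ChartedSpace (Model d) M]
  [IsManifold (𝓡 (d + 1)) ∞ M]

/-- Sums and differences of discontinuous vector fields are taken on each side. -/
instance : Add (TwoSided (VField d M)) :=
  ⟨fun u v => ⟨fun x => u.plus x + v.plus x, fun x => u.minus x + v.minus x⟩⟩

instance : Sub (TwoSided (VField d M)) :=
  ⟨fun u v => ⟨fun x => u.plus x - v.plus x, fun x => u.minus x - v.minus x⟩⟩

/-- `u` is the restriction of `V` to the closed set `D`, extended by zero. -/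
def IsRestriction {T : M → Type*} [∀ x, Zero (T x)] (D : Set M) (V u : ∀ x, T x) : Prop :=
  (∀ x ∈ D, u x = V x) ∧ ∀ x ∉ D, u x = 0

/-- A family `u t = χ⁺ u⁺_t + χ⁻ u⁻_t` of vector fields, discontinuous across `S t`, is smooth: `u^±`
are smooth in `(t, x)`, up to the boundary, for `x` on the respective side of `S t`, i.e. they are
restrictions of smooth families defined on all of `M`. -/
def SmoothDVFamily (S : ℝ → Hypersurface d M) (u : ℝ → TwoSided (VField d M)) : Prop :=
  ∃ V W : ℝ → VField d M, SmoothVFamily V ∧ SmoothVFamily W ∧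
    LocUnifCompactSupport V ∧ LocUnifCompactSupport W ∧
    ∀ t, IsRestriction (S t).closedPlus (V t) (u t).plus ∧
      IsRestriction (S t).closedMinus (W t) (u t).minus

/-- Smooth families of `1`-forms, discontinuous across `S t`. -/
def SmoothDFormFamily (S : ℝ → Hypersurface d M) (m : ℝ → TwoSided (OneForm d M)) : Prop :=
  ∃ V W : ℝ → OneForm d M, SmoothFormFamily V ∧ SmoothFormFamily W ∧
    LocUnifCompactSupport V ∧ LocUnifCompactSupport W ∧
    ∀ t, IsRestriction (S t).closedPlus (V t) (m t).plus ∧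
      IsRestriction (S t).closedMinus (W t) (m t).minus

/-- The space `DVect'(M, Γ)` of vector fields discontinuous along `Γ`. -/
def IsDVect' (S : Hypersurface d M) (u : TwoSided (VField d M)) : Prop :=
  SmoothDVFamily (fun _ => S) (fun _ => u)

/-- The space `DVect(M, Γ)`: the jump of the field along `Γ` is tangent to `Γ`. -/
def DVect (S : Hypersurface d M) : Type _ :=
  {u : TwoSided (VField d M) // IsDVect' S u ∧
    ∀ x ∈ S.carrier, S.IsTangent x (u.plus x - u.minus x)}

/-- The space `DΩ¹(M, Γ)` of `1`-forms discontinuous along `Γ`. With a fixed volume form `μ`, the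
`1`-form `m` stands for the element `m ⊗ μ` of `DVect(M, Γ)^*`. -/
def DOmega (S : Hypersurface d M) : Type _ :=
  {m : TwoSided (OneForm d M) // SmoothDFormFamily (fun _ => S) (fun _ => m)}

/-- Smooth functions on `Γ` (extended by zero to `M`). The function `n` stands for the covector
`ξ ↦ ∫_Γ n ξ` on the space of `(n-1)`-forms on `Γ`. -/
def SurfaceFun (S : Hypersurface d M) : Type _ :=
  {n : M → ℝ // ∃ N : M → ℝ, ContMDiff (𝓡 (d + 1)) 𝓘(ℝ, ℝ) ∞ N ∧ IsRestriction S.carrier N n}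

/-- The function `i_u m` on each side. -/
def formApply (u : TwoSided (VField d M)) (m : TwoSided (OneForm d M)) : TwoSided (M → ℝ) :=
  ⟨fun x => m.plus x (u.plus x), fun x => m.minus x (u.minus x)⟩

/-- `jump f = f⁺ - f⁻` (meaningful on `Γ`). -/
def jump (f : TwoSided (M → ℝ)) (x : M) : ℝ := f.plus x - f.minus x

/-- The regularized Lie bracket, taken separately on the two open regions. -/
def regBracket (u v : TwoSided (VField d M)) : TwoSided (VField d M) :=
  ⟨VectorField.mlieBracket (𝓡 (d + 1)) u.plus v.plus,
    VectorField.mlieBracket (𝓡 (d + 1)) u.minus v.minus⟩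

/-- The regularized time derivative `d^R/dt` at `t₀` of a family of vector fields `u t` that are
discontinuous across `S t` is `u' ∈ DVect'(M, S t₀)`. (On `S t₀` itself the two sides of `u'` are
given by continuity.) -/
def HasRegDerivV (S : ℝ → Hypersurface d M) (u : ℝ → TwoSided (VField d M))
    (u' : TwoSided (VField d M)) (t₀ : ℝ) : Prop :=
  IsDVect' (S t₀) u' ∧
    (∀ x ∈ (S t₀).plus, HasDerivAt (fun t => (u t).plus x) (u'.plus x) t₀) ∧
    ∀ x ∈ (S t₀).minus, HasDerivAt (fun t => (u t).minus x) (u'.minus x) t₀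

/-- The regularized time derivative of a family of discontinuous `1`-forms. -/
def HasRegDerivForm (S : ℝ → Hypersurface d M) (m : ℝ → TwoSided (OneForm d M))
    (m' : TwoSided (OneForm d M)) (t₀ : ℝ) : Prop :=
  SmoothDFormFamily (fun _ => S t₀) (fun _ => m') ∧
    (∀ x ∈ (S t₀).plus, HasDerivAt (fun t => (m t).plus x) (m'.plus x) t₀) ∧
    ∀ x ∈ (S t₀).minus, HasDerivAt (fun t => (m t).minus x) (m'.minus x) t₀

/-- `∫_M f μ` for a function `f` discontinuous along `Γ`. -/
def integralM [T2Space M] [SigmaCompactSpace M] [MeasurableSpace M]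
    (μ : KForm d M (d + 1)) (S : Hypersurface d M) (f : TwoSided (M → ℝ)) : ℝ :=
  (∫ x in S.plus, f.plus x ∂(volumeMeasure μ)) + ∫ x in S.minus, f.minus x ∂(volumeMeasure μ)

/-- The pairing `⟨m ⊗ μ, u⟩ = ∫_M (i_u m) μ`. -/
def pairing [T2Space M] [SigmaCompactSpace M] [MeasurableSpace M]
    (μ : KForm d M (d + 1)) (S : Hypersurface d M) (m : TwoSided (OneForm d M))
    (u : TwoSided (VField d M)) : ℝ :=
  integralM μ S (formApply u m)

/-- The anchor map `# : DVect(M, Γ) → T_Γ V(M) = Ω^{n-1}(Γ)`, `u ↦ i_u μ` restricted to `Γ`. (The two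
sides `u^±` give the same form on `Γ`.) -/
def anchor (μ : KForm d M (d + 1)) {S : Hypersurface d M} (u : DVect S) : KForm d M d :=
  contract u.1.plus μ

end Discontinuous

section BaseSpace

variable (d : ℕ) (M : Type*) [TopologicalSpace M] [ChartedSpace (Model d) M]

/-- A smooth, compactly supported flow `φ_t`, with inverse maps `ψ_t`, of a time-dependent vector
field, with `φ_0 = id`. Its values `φ_1` form the group `G_V`. -/
structure SmoothFlow where
  φ : ℝ → M → M
  ψ : ℝ → M → M
  contMDiff_φ : ContMDiff (𝓘(ℝ, ℝ).prod (𝓡 (d + 1))) (𝓡 (d + 1)) ∞ fun p : ℝ × M => φ p.1 p.2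
  contMDiff_ψ : ContMDiff (𝓘(ℝ, ℝ).prod (𝓡 (d + 1))) (𝓡 (d + 1)) ∞ fun p : ℝ × M => ψ p.1 p.2
  left_inv : ∀ t x, ψ t (φ t x) = x
  right_inv : ∀ t x, φ t (ψ t x) = x
  zero : ∀ x, φ 0 x = x
  compact_support : ∀ R : ℝ, ∃ K : Set M, IsCompact K ∧ ∀ t, |t| ≤ R → ∀ x ∉ K, φ t x = x

variable {d M}

/-- `v` is the velocity field of the flow at time `t`: `∂_t φ_t(x) = v(φ_t(x))`. -/
def SmoothFlow.HasVelocity (Φ : SmoothFlow d M) (t : ℝ) (v : VField d M) : Prop :=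
  ∀ x, HasMFDerivAt 𝓘(ℝ, ℝ) (𝓡 (d + 1)) (fun s => Φ.φ s x) t
    ((1 : ℝ →L[ℝ] ℝ).smulRight (v (Φ.φ t x)) : ℝ →L[ℝ] TangentSpace (𝓡 (d + 1)) (Φ.φ t x))

/-- `f` maps `S` to `S'`, with sides. -/
def MapsHypersurface (f : M → M) (S S' : Hypersurface d M) : Prop :=
  f '' S.plus = S'.plus ∧ f '' S.carrier = S'.carrier ∧ f '' S.minus = S'.minus

/-- The base space `V(M) = {φ(Γ₀) : φ ∈ G_V}`. -/
def BaseSpace (S₀ : Hypersurface d M) : Type _ :=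
  {S : Hypersurface d M // ∃ Φ : SmoothFlow d M, MapsHypersurface (Φ.φ 1) S₀ S}

/-- The curve `Γ_t` in `V(M)` is given by `Γ_t = φ_t(Γ_0)` for the flow `Φ`. The curves for which
there is such a flow are the smooth ones, and the tangent vector `∂_t Γ_t` is the restriction of
`i_v μ` to `Γ_t`, where `v` is the velocity of the flow at time `t`. -/
def Traces {S₀ : Hypersurface d M} (Φ : SmoothFlow d M) (γ : ℝ → BaseSpace S₀) : Prop :=
  ∀ t, MapsHypersurface (Φ.φ t) (γ 0).1 (γ t).1

variable [IsManifold (𝓡 (d + 1)) ∞ M]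

/-- The dual algebroid `DVect(M)^*`, as the set of pairs of a point `Γ` of `V(M)` and an element of
`DVect(M, Γ)^*`. -/
def DualAlgebroid (S₀ : Hypersurface d M) : Type _ := Σ S : BaseSpace S₀, DOmega S.1

/-- The cotangent space `DVect(M, Γ) ⊕ T^*_Γ V(M)` of `DVect(M)^*` at a point. -/
abbrev Cotangent {S₀ : Hypersurface d M} (p : DualAlgebroid S₀) : Type _ :=
  DVect p.1.1 × SurfaceFun p.1.1

/-- The fibre component `d^F F(m)` of a differential. -/
def fibrePart {S₀ : Hypersurface d M} (dF : ∀ p : DualAlgebroid S₀, Cotangent p)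
    (p : DualAlgebroid S₀) : TwoSided (VField d M) := (dF p).1.1

/-- A smooth section `A` of the dual algebroid: it takes smooth curves to smooth curves. -/
def SmoothSection {S₀ : Hypersurface d M} (A : ∀ S : BaseSpace S₀, DOmega S.1) : Prop :=
  ∀ (Φ : SmoothFlow d M) (γ : ℝ → BaseSpace S₀), Traces Φ γ →
    SmoothDFormFamily (fun t => (γ t).1) (fun t => (A (γ t)).1)

variable [T2Space M] [SigmaCompactSpace M] [MeasurableSpace M]

/-- `F` is differentiable with differential `dF`, a section of the cotangent bundle whose fibre
component is smooth (it takes smooth curves to smooth curves): along every smooth curve `m_t` over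
`Γ_t`, one has `d/dt F(m_t) = ⟨d^F F(m_t), ∂_t^R m_t⟩ + ⟨d^B F(m_t), ∂_t Γ_t⟩`. -/
def IsDifferential (μ : KForm d M (d + 1)) {S₀ : Hypersurface d M} (F : DualAlgebroid S₀ → ℝ)
    (dF : ∀ p : DualAlgebroid S₀, Cotangent p) : Prop :=
  ∀ (Φ : SmoothFlow d M) (γ : ℝ → BaseSpace S₀), Traces Φ γ →
    ∀ m : ∀ t, DOmega (γ t).1, SmoothDFormFamily (fun t => (γ t).1) (fun t => (m t).1) →
      SmoothDVFamily (fun t => (γ t).1) (fun t => fibrePart dF ⟨γ t, m t⟩) ∧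
      ∀ (t : ℝ) (m' : TwoSided (OneForm d M)) (v : VField d M),
        HasRegDerivForm (fun s => (γ s).1) (fun s => (m s).1) m' t → Φ.HasVelocity t v →
          HasDerivAt (fun s => F ⟨γ s, m s⟩)
            (pairing μ (γ t).1 m' (fibrePart dF ⟨γ t, m t⟩) +
              surfaceIntegral μ (γ t).1 (fun x => (dF ⟨γ t, m t⟩).2.1 x • contract v μ x)) t

/-- `γ` is a smooth curve in `V(M)`, traced out by the flow `Φ`, with `γ 0 = Γ` and with tangent
vector `# u` at `Γ`. -/
def IsCurveAlong (μ : KForm d M (d + 1)) {S₀ : Hypersurface d M} {Γ : BaseSpace S₀}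
    (u : DVect Γ.1) (Φ : SmoothFlow d M) (γ : ℝ → BaseSpace S₀) : Prop :=
  Traces Φ γ ∧ γ 0 = Γ ∧
    ∃ v : VField d M, Φ.HasVelocity 0 v ∧ Γ.1.FormEqOn (contract v μ) (anchor μ u)

/-- The Poisson bracket `{F₁, F₂}(m)` on the dual of a Lie algebroid has the value `c`, i.e. for every
extension of `m` to a smooth section `A` of the dual algebroid, and with the sections
`U_i = d^F F_i ∘ A` of the algebroid, one has
`c = ⟨m, [U₁, U₂]⟩ + #U₁ · (F₂(A) - ⟨A, U₂⟩) - #U₂ · (F₁(A) - ⟨A, U₁⟩)`,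
with the algebroid bracket `[U₁, U₂] = [U₁(Γ), U₂(Γ)]^R + 𝓛_{#U₁} U₂ - 𝓛_{#U₂} U₁`. The derivatives in
the direction `#U_i` are taken along any smooth curve in `V(M)` that starts at `Γ` with the tangent
vector `#U_i`; they are required to exist, as are such an extension and such curves. -/
def HasPoissonBracket (μ : KForm d M (d + 1)) {S₀ : Hypersurface d M}
    (F₁ F₂ : DualAlgebroid S₀ → ℝ) (dF₁ dF₂ : ∀ p : DualAlgebroid S₀, Cotangent p)
    (p : DualAlgebroid S₀) (c : ℝ) : Prop :=
  (∃ A : ∀ S : BaseSpace S₀, DOmega S.1, SmoothSection A ∧ A p.1 = p.2) ∧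
  (∃ (Φ₁ : SmoothFlow d M) (γ₁ : ℝ → BaseSpace S₀), IsCurveAlong μ (dF₁ p).1 Φ₁ γ₁) ∧
  (∃ (Φ₂ : SmoothFlow d M) (γ₂ : ℝ → BaseSpace S₀), IsCurveAlong μ (dF₂ p).1 Φ₂ γ₂) ∧
  ∀ A : ∀ S : BaseSpace S₀, DOmega S.1, SmoothSection A → A p.1 = p.2 →
  ∀ (Φ₁ : SmoothFlow d M) (γ₁ : ℝ → BaseSpace S₀), IsCurveAlong μ (dF₁ p).1 Φ₁ γ₁ →
  ∀ (Φ₂ : SmoothFlow d M) (γ₂ : ℝ → BaseSpace S₀), IsCurveAlong μ (dF₂ p).1 Φ₂ γ₂ →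
    let U₁ : BaseSpace S₀ → TwoSided (VField d M) := fun S => fibrePart dF₁ ⟨S, A S⟩
    let U₂ : BaseSpace S₀ → TwoSided (VField d M) := fun S => fibrePart dF₂ ⟨S, A S⟩
    ∃ (L₁U₂ L₂U₁ : TwoSided (VField d M)) (a₁ a₂ : ℝ),
      HasRegDerivV (fun t => (γ₁ t).1) (fun t => U₂ (γ₁ t)) L₁U₂ 0 ∧
      HasRegDerivV (fun t => (γ₂ t).1) (fun t => U₁ (γ₂ t)) L₂U₁ 0 ∧
      HasDerivAt (fun t => F₂ ⟨γ₁ t, A (γ₁ t)⟩ -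
        pairing μ (γ₁ t).1 (A (γ₁ t)).1 (U₂ (γ₁ t))) a₁ 0 ∧
      HasDerivAt (fun t => F₁ ⟨γ₂ t, A (γ₂ t)⟩ -
        pairing μ (γ₂ t).1 (A (γ₂ t)).1 (U₁ (γ₂ t))) a₂ 0 ∧
      c = pairing μ p.1.1 p.2.1 (regBracket (U₁ p.1) (U₂ p.1) + L₁U₂ - L₂U₁) + a₁ - a₂

end BaseSpace

end

end DiscontinuousFlow

/-! Fix an extension `A` and a curve leaving `Γ` with tangent vector `#v₁`. Differentiability of
`F₂` gives `d/dt F₂(A) = ⟨∂ᴿA, v₂⟩ + ∫_Γ n₂ i_{v₁}μ`. The transport theorem for the two moving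
regions gives `d/dt ⟨A, U₂⟩ = ⟨∂ᴿA, v₂⟩ + ⟨m, 𝓛U₂⟩ + ∫_Γ jump(i_{v₂}m) i_{v₁}μ`, with a jump because
`Γ` bounds `D⁺` and `D⁻` with opposite orientations. In the difference the derivative of `A`
cancels, as in a Legendre transform (`exists_hasDerivAt_legendre`), and the remaining `-⟨m, 𝓛U₂⟩`
cancels the Lie derivative in the algebroid bracket. The same happens with the indices exchanged.
What is left depends neither on `A` nor on the curves (`hasPoissonBracket_of_exists_curve`).

The analytic core is the transport theorem (`exists_hasDerivAt_pairing`). In a slice chart it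
concerns a region that is the half-space `y₀ < 0` at time zero (`hasDerivAt_setIntegral_moving`).
Blowing up the normal coordinate by `y₀ = t r` turns the difference quotient into an integral with a
dominated limit, and integrating the limit over `r` produces the signed displacement `b`. Partitions
of unity make this global (`hasDerivAt_setIntegral_plus`), nullity of `Γ` transfers it to `D⁻`, and
differentiation under the integral handles integrands that depend on time.

The bracket also demands that extensions and curves exist. A section is obtained by restricting two
fixed global forms to the sides of every hypersurface (`exists_smoothSection`). A curve only needs a
flow with prescribed initial velocity, so no differential equation is solved: in a chart `y + N⁻¹
sin(N t) X(y)` is a diffeomorphism for every `t`, and finitely many such flows are composed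
(`exists_flow_hasVelocity`, `exists_isCurveAlong`). -/

namespace DiscontinuousFlow

noncomputable section

set_option linter.unusedSectionVars false

/-! ### The volume measure in arbitrary charts, and nullity of hypersurfaces. -/

section ChartMeasure

variable {d : ℕ} {M : Type*} [TopologicalSpace M] [ChartedSpace (Model d) M]
  [IsManifold (𝓡 (d + 1)) ∞ M]

lemma mdifferentiableAt_chart {e : OpenPartialHomeomorph M (Model d)}
    (he : e ∈ IsManifold.maximalAtlas (𝓡 (d + 1)) ∞ M) {x : M} (hx : x ∈ e.source) :
    MDifferentiableAt (𝓡 (d + 1)) (𝓡 (d + 1)) e x :=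
  (contMDiffAt_of_mem_maximalAtlas he hx).mdifferentiableAt (by simp)

lemma mdifferentiableAt_chart_symm {e : OpenPartialHomeomorph M (Model d)}
    (he : e ∈ IsManifold.maximalAtlas (𝓡 (d + 1)) ∞ M) {y : Model d} (hy : y ∈ e.target) :
    MDifferentiableAt (𝓡 (d + 1)) (𝓡 (d + 1)) e.symm y :=
  (contMDiffAt_symm_of_mem_maximalAtlas he hy).mdifferentiableAt (by simp)

lemma hasFDerivAt_transition {e e' : OpenPartialHomeomorph M (Model d)}
    (he : e ∈ IsManifold.maximalAtlas (𝓡 (d + 1)) ∞ M)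
    (he' : e' ∈ IsManifold.maximalAtlas (𝓡 (d + 1)) ∞ M) {y : Model d}
    (hy : y ∈ e.target) (hy' : e.symm y ∈ e'.source) :
    HasFDerivAt (e' ∘ e.symm) (fderiv ℝ (e' ∘ e.symm) y) y := by
  have h : MDifferentiableAt (𝓡 (d + 1)) (𝓡 (d + 1)) (e' ∘ e.symm) y :=
    (mdifferentiableAt_chart he' hy').comp y (mdifferentiableAt_chart_symm he hy)
  exact h.differentiableAt.hasFDerivAt

/-- Top-degree alternating forms are multiples of the determinant of a basis, and composing that
basis with `T` multiplies its determinant by `T.det`. -/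
lemma alternating_apply_comp_linear {d : ℕ} (f : (Model d) [⋀^Fin (d + 1)]→ₗ[ℝ] ℝ)
    (T : Model d →L[ℝ] Model d) :
    f (fun i => T (EuclideanSpace.single i 1)) =
      T.det * f (fun i => EuclideanSpace.single i (1 : ℝ)) := by
  let b := (EuclideanSpace.basisFun (Fin (d + 1)) ℝ).toBasis
  have hb : (fun i => EuclideanSpace.single i (1 : ℝ)) = (b : Fin (d + 1) → Model d) := by
    ext1 i; simp [b]
  have hb' : (fun i => T (EuclideanSpace.single i (1 : ℝ))) =
      (T : Model d →ₗ[ℝ] Model d) ∘ b := by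
    ext1 i; simp [b]
  rw [hb, hb', AlternatingMap.eq_smul_basis_det b f]
  simp only [AlternatingMap.smul_apply, smul_eq_mul]
  rw [Module.Basis.det_comp]
  change f b * (T.det * b.det b) = _
  ring

lemma chartCoeff_eq_det_mul (μ : KForm d M (d + 1)) {e e' : OpenPartialHomeomorph M (Model d)}
    (he : e ∈ IsManifold.maximalAtlas (𝓡 (d + 1)) ∞ M)
    (he' : e' ∈ IsManifold.maximalAtlas (𝓡 (d + 1)) ∞ M) {y : Model d}
    (hy : y ∈ e.target) (hy' : e.symm y ∈ e'.source) :
    chartCoeff μ e y = (fderiv ℝ (e' ∘ e.symm) y).det * chartCoeff μ e' (e' (e.symm y)) := by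
  let ν : M → (Model d) [⋀^Fin (d + 1)]→ₗ[ℝ] ℝ := μ
  let A : Model d →L[ℝ] Model d := mfderiv (𝓡 (d + 1)) (𝓡 (d + 1)) e'.symm (e' (e.symm y))
  have h1 : chartCoeff μ e' (e' (e.symm y)) =
      ((ν (e.symm y)).compLinearMap (A : Model d →ₗ[ℝ] Model d))
        (fun i => EuclideanSpace.single i (1 : ℝ)) := by
    change ν (e'.symm (e' (e.symm y))) (fun i => A (EuclideanSpace.single i (1 : ℝ))) = _
    rw [e'.left_inv hy']
    rfl
  -- Near `y` one has `e.symm = e'.symm ∘ (e' ∘ e.symm)`, so this is the chain rule.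
  have h2 : (mfderiv (𝓡 (d + 1)) (𝓡 (d + 1)) e.symm y : Model d →L[ℝ] Model d) =
      A.comp (fderiv ℝ (e' ∘ e.symm) y) := by
    have hc : HasMFDerivAt (𝓡 (d + 1)) (𝓡 (d + 1)) (e'.symm ∘ (e' ∘ e.symm)) y
        (A.comp (fderiv ℝ (e' ∘ e.symm) y)) := by
      refine HasMFDerivAt.comp (I' := 𝓡 (d + 1)) (M' := Model d) y ?_ ?_
      · exact (mdifferentiableAt_chart_symm he' (e'.map_source hy')).hasMFDerivAt
      · exact (hasFDerivAt_transition he he' hy hy').hasMFDerivAt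
    refine HasMFDerivAt.mfderiv (hc.congr_of_eventuallyEq ?_)
    have : ∀ᶠ z in 𝓝 y, e.symm z ∈ e'.source :=
      (e.continuousAt_symm hy).eventually (e'.open_source.mem_nhds hy')
    filter_upwards [this] with z hz
    simp [e'.left_inv hz]
  rw [h1, ← alternating_apply_comp_linear]
  change ν (e.symm y) (fun i => (mfderiv (𝓡 (d + 1)) (𝓡 (d + 1)) e.symm y : Model d →L[ℝ] Model d)
    (EuclideanSpace.single i (1 : ℝ))) = _
  rw [h2]
  rfl

variable [T2Space M] [SigmaCompactSpace M]

variable (d M) in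
lemma chartPartition_isSubordinate :
    (chartPartition d M).IsSubordinate fun x => (chartAt (Model d) x).source :=
  (SmoothPartitionOfUnity.exists_isSubordinate_chartAt_source (𝓡 (d + 1)) M).choose_spec

lemma chartPartition_eq_zero {i x : M} (hx : x ∉ (chartAt (Model d) i).source) :
    chartPartition d M i x = 0 := by
  by_contra h
  exact hx (chartPartition_isSubordinate d M i (subset_tsupport _ h))

variable [MeasurableSpace M] [BorelSpace M]

lemma continuousOn_chartCoeff {μ : KForm d M (d + 1)} (hμ : IsSmoothTopForm μ)
    {e : OpenPartialHomeomorph M (Model d)}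
    (he : e ∈ IsManifold.maximalAtlas (𝓡 (d + 1)) ∞ M) :
    ContinuousOn (chartCoeff μ e) e.target :=
  (hμ e he).continuousOn

lemma aemeasurable_chart_symm (e : OpenPartialHomeomorph M (Model d)) :
    AEMeasurable e.symm ((volume : Measure (Model d)).restrict e.target) :=
  e.continuousOn_symm.aemeasurable e.open_target.measurableSet

lemma aemeasurable_chartDensity {μ : KForm d M (d + 1)} (hμ : IsSmoothTopForm μ)
    {e : OpenPartialHomeomorph M (Model d)}
    (he : e ∈ IsManifold.maximalAtlas (𝓡 (d + 1)) ∞ M) {f : M → ℝ} (hf : Continuous f) :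
    AEMeasurable (fun y => ENNReal.ofReal (f (e.symm y) * |chartCoeff μ e y|))
      ((volume : Measure (Model d)).restrict e.target) := by
  refine AEMeasurable.ennreal_ofReal (ContinuousOn.aemeasurable ?_ e.open_target.measurableSet)
  exact (hf.comp_continuousOn e.continuousOn_symm).mul (continuousOn_chartCoeff hμ he).abs

lemma lintegral_volumeMeasure {μ : KForm d M (d + 1)} (hμ : IsSmoothTopForm μ)
    {f : M → ENNReal} (hf : Measurable f) :
    ∫⁻ x, f x ∂(volumeMeasure μ) = ∑' i : M, ∫⁻ y in (chartAt (Model d) i).target,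
      ENNReal.ofReal (chartPartition d M i ((chartAt (Model d) i).symm y) *
        |chartCoeff μ (chartAt (Model d) i) y|) * f ((chartAt (Model d) i).symm y) := by
  rw [volumeMeasure, lintegral_sum_measure]
  refine tsum_congr fun i => ?_
  have hd := aemeasurable_chartDensity hμ (IsManifold.chart_mem_maximalAtlas (I := 𝓡 (d + 1))
    (n := ∞) i) (chartPartition d M i).contMDiff.continuous
  have hm := aemeasurable_chart_symm (chartAt (Model d) i)
  rw [lintegral_map' hf.aemeasurable
    (hm.mono_ac (withDensity_absolutelyContinuous _ _))]
  exact lintegral_withDensity_eq_lintegral_mul₀ hd (hf.comp_aemeasurable hm)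

lemma setLIntegral_eq_of_subset_of_eq_zero {α : Type*} [MeasurableSpace α] {ν : Measure α}
    {s t : Set α} (hs : MeasurableSet s) (ht : MeasurableSet t) (hts : t ⊆ s) {f : α → ENNReal}
    (hf : ∀ x ∈ s, x ∉ t → f x = 0) : ∫⁻ x in s, f x ∂ν = ∫⁻ x in t, f x ∂ν := by
  rw [← lintegral_indicator hs, ← lintegral_indicator ht]
  congr 1
  ext1 x
  by_cases h1 : x ∈ t
  · simp [h1, hts h1]
  · by_cases h2 : x ∈ s
    · simp [h1, h2, hf x h2 h1]
    · simp [h1, h2]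

/-- The vanishing of `g` and `f` reduces both integrals to the overlap of the charts. There the
Jacobian of the change of variables is the factor `|det|` by which the two coefficients of `μ`
differ. -/
lemma lintegral_chart_eq_lintegral_chart {μ : KForm d M (d + 1)}
    {e e' : OpenPartialHomeomorph M (Model d)}
    (he : e ∈ IsManifold.maximalAtlas (𝓡 (d + 1)) ∞ M)
    (he' : e' ∈ IsManifold.maximalAtlas (𝓡 (d + 1)) ∞ M) {g : M → ℝ}
    (hg' : ∀ x ∉ e'.source, g x = 0) {f : M → ENNReal} (hf : ∀ x ∉ e.source, f x = 0) :
    ∫⁻ y in e'.target, ENNReal.ofReal (g (e'.symm y) * |chartCoeff μ e' y|) * f (e'.symm y) =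
      ∫⁻ y in e.target, ENNReal.ofReal (g (e.symm y) * |chartCoeff μ e y|) * f (e.symm y) := by
  set τ := e.symm.trans e' with hτ
  have h1 : ∫⁻ y in e'.target, ENNReal.ofReal (g (e'.symm y) * |chartCoeff μ e' y|) *
      f (e'.symm y) = ∫⁻ y in τ.target, ENNReal.ofReal (g (e'.symm y) * |chartCoeff μ e' y|) *
      f (e'.symm y) := by
    refine setLIntegral_eq_of_subset_of_eq_zero e'.open_target.measurableSet
      τ.open_target.measurableSet (by simp [hτ]) fun y hy hy' => ?_
    have : e'.symm y ∉ e.source := fun h => hy' (by simp [hτ, hy, h])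
    simp [hf _ this]
  have h2 : ∫⁻ y in e.target, ENNReal.ofReal (g (e.symm y) * |chartCoeff μ e y|) *
      f (e.symm y) = ∫⁻ y in τ.source, ENNReal.ofReal (g (e.symm y) * |chartCoeff μ e y|) *
      f (e.symm y) := by
    refine setLIntegral_eq_of_subset_of_eq_zero e.open_target.measurableSet
      τ.open_source.measurableSet (by simp [hτ]) fun y hy hy' => ?_
    have : e.symm y ∉ e'.source := fun h => hy' (by simp [hτ, hy, h])
    simp [hg' _ this]
  rw [h1, h2, ← τ.image_source_eq_target,
    lintegral_image_eq_lintegral_abs_det_fderiv_mul (f' := fun y => fderiv ℝ (e' ∘ e.symm) y)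
      _ τ.open_source.measurableSet _ τ.injOn]
  · refine setLIntegral_congr_fun τ.open_source.measurableSet fun y hy => ?_
    have hy1 : y ∈ e.target := by simpa [hτ] using hy.1
    have hy2 : e.symm y ∈ e'.source := by simpa [hτ] using hy.2
    have hc := chartCoeff_eq_det_mul μ he he' hy1 hy2
    have e1 : τ y = e' (e.symm y) := rfl
    simp only [e1, e'.left_inv hy2]
    rw [hc, abs_mul, ← mul_assoc, ← ENNReal.ofReal_mul (abs_nonneg _)]
    congr 2
    ring
  · intro y hy
    have hy1 : y ∈ e.target := by simpa [hτ] using hy.1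
    have hy2 : e.symm y ∈ e'.source := by simpa [hτ] using hy.2
    exact (hasFDerivAt_transition he he' hy1 hy2).hasFDerivWithinAt

/-- The volume measure in an arbitrary chart of the smooth structure. -/
lemma lintegral_volumeMeasure_chart {μ : KForm d M (d + 1)} (hμ : IsSmoothTopForm μ)
    {e : OpenPartialHomeomorph M (Model d)}
    (he : e ∈ IsManifold.maximalAtlas (𝓡 (d + 1)) ∞ M)
    {f : M → ENNReal} (hf : Measurable f) (hfe : ∀ x ∉ e.source, f x = 0) :
    ∫⁻ x, f x ∂(volumeMeasure μ) =
      ∫⁻ y in e.target, ENNReal.ofReal |chartCoeff μ e y| * f (e.symm y) := by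
  rw [lintegral_volumeMeasure hμ hf]
  set ρ := chartPartition d M
  have h1 : ∀ i : M, (∫⁻ y in (chartAt (Model d) i).target,
      ENNReal.ofReal (ρ i ((chartAt (Model d) i).symm y) *
        |chartCoeff μ (chartAt (Model d) i) y|) * f ((chartAt (Model d) i).symm y)) =
      ∫⁻ y in e.target, ENNReal.ofReal (ρ i (e.symm y) * |chartCoeff μ e y|) * f (e.symm y) :=
    fun i => lintegral_chart_eq_lintegral_chart he (IsManifold.chart_mem_maximalAtlas i)
      (fun x hx => chartPartition_eq_zero hx) hfe
  simp_rw [h1]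
  -- The partition is indexed by all points of `M`; local finiteness leaves only countably many
  -- nonzero functions, which permits exchanging sum and integral.
  let C : Set M := {i | (Function.support (ρ i)).Nonempty}
  have hC : Countable C := by
    have hl : LocallyFinite fun i : C => Function.support (ρ i) :=
      ρ.locallyFinite.comp_injective Subtype.val_injective
    have := hl.countable_univ fun i => i.2
    exact countable_univ_iff.1 this
  have hC0 : ∀ i ∉ C, ∀ x, ρ i x = 0 := fun i hi x => by
    by_contra h
    exact hi ⟨x, h⟩
  have hs : ∀ F : M → ENNReal, (∀ i ∉ C, F i = 0) → ∑' i : C, F i = ∑' i, F i := fun F hF =>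
    tsum_subtype_eq_of_support_subset fun i hi => by
      by_contra h
      exact hi (hF i h)
  rw [← hs _ fun i hi => by simp [hC0 i hi], ← lintegral_tsum]
  · refine setLIntegral_congr_fun e.open_target.measurableSet fun y _ => ?_
    rw [hs (fun i => ENNReal.ofReal (ρ i (e.symm y) * |chartCoeff μ e y|) * f (e.symm y))
      fun i hi => by simp [hC0 i hi], ENNReal.tsum_mul_right]
    congr 1
    have hfin : (Function.support fun i => ρ i (e.symm y)).Finite :=
      ρ.locallyFinite.point_finite (e.symm y)
    have hsum : ∑ i ∈ hfin.toFinset, ρ i (e.symm y) = 1 := by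
      rw [← ρ.sum_eq_one (mem_univ (e.symm y))]
      exact (finsum_eq_sum_of_support_subset _ (by simp)).symm
    rw [tsum_eq_sum (s := hfin.toFinset), ← ENNReal.ofReal_sum_of_nonneg, ← Finset.sum_mul, hsum,
      one_mul]
    · exact fun i _ => mul_nonneg (ρ.nonneg i _) (abs_nonneg _)
    · intro i hi
      have : ρ i (e.symm y) = 0 := by simpa using hi
      simp [this]
  · intro i
    exact (aemeasurable_chartDensity hμ he (ρ i).contMDiff.continuous).mul
      (hf.comp_aemeasurable (aemeasurable_chart_symm e))

lemma restrict_volumeMeasure_chart {μ : KForm d M (d + 1)} (hμ : IsSmoothTopForm μ)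
    {e : OpenPartialHomeomorph M (Model d)}
    (he : e ∈ IsManifold.maximalAtlas (𝓡 (d + 1)) ∞ M) :
    (volumeMeasure μ).restrict e.source =
      Measure.map e.symm (((volume : Measure (Model d)).restrict e.target).withDensity fun y =>
        ENNReal.ofReal |chartCoeff μ e y|) := by
  have hd : AEMeasurable (fun y => ENNReal.ofReal |chartCoeff μ e y|)
      ((volume : Measure (Model d)).restrict e.target) := by
    simpa using aemeasurable_chartDensity hμ he (continuous_const (y := (1 : ℝ)))
  have hm := aemeasurable_chart_symm e
  refine Measure.ext_of_lintegral _ fun f hf => ?_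
  rw [← lintegral_indicator e.open_source.measurableSet,
    lintegral_volumeMeasure_chart hμ he (hf.indicator e.open_source.measurableSet)
      (fun x hx => indicator_of_notMem hx f), lintegral_map' hf.aemeasurable
    (hm.mono_ac (withDensity_absolutelyContinuous _ _))]
  refine Eq.trans ?_ (lintegral_withDensity_eq_lintegral_mul₀ hd (hf.comp_aemeasurable hm)).symm
  refine setLIntegral_congr_fun e.open_target.measurableSet fun y hy => ?_
  simp [e.map_target hy]

lemma integral_volumeMeasure_chart {μ : KForm d M (d + 1)} (hμ : IsSmoothTopForm μ)
    {e : OpenPartialHomeomorph M (Model d)}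
    (he : e ∈ IsManifold.maximalAtlas (𝓡 (d + 1)) ∞ M) {f : M → ℝ}
    (hf : AEStronglyMeasurable f (volumeMeasure μ)) (hfe : ∀ x ∉ e.source, f x = 0) :
    ∫ x, f x ∂(volumeMeasure μ) = ∫ y in e.target, |chartCoeff μ e y| * f (e.symm y) := by
  have hd : AEMeasurable (fun y => ENNReal.ofReal |chartCoeff μ e y|)
      ((volume : Measure (Model d)).restrict e.target) := by
    simpa using aemeasurable_chartDensity hμ he (continuous_const (y := (1 : ℝ)))
  have hm := aemeasurable_chart_symm e
  have hr := restrict_volumeMeasure_chart hμ he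
  have h1 : ∫ x, f x ∂(volumeMeasure μ) = ∫ x in e.source, f x ∂(volumeMeasure μ) :=
    (setIntegral_eq_integral_of_forall_compl_eq_zero hfe).symm
  have hf' := hf.mono_measure (Measure.restrict_le_self (s := e.source))
  rw [hr] at hf'
  rw [h1, hr, integral_map (hm.mono_ac (withDensity_absolutelyContinuous _ _)) hf',
    integral_withDensity_eq_integral_toReal_smul₀ hd (by simp)]
  simp

/-- The density is continuous, hence bounded on a compact neighbourhood in a chart. This is what
makes continuous functions of compact support integrable in everything that follows. -/
lemma isLocallyFiniteMeasure_volumeMeasure {μ : KForm d M (d + 1)} (hμ : IsSmoothTopForm μ) :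
    IsLocallyFiniteMeasure (volumeMeasure μ) := by
  refine ⟨fun x => ?_⟩
  set e := chartAt (Model d) x
  have he : e ∈ IsManifold.maximalAtlas (𝓡 (d + 1)) ∞ M := IsManifold.chart_mem_maximalAtlas x
  have hx : x ∈ e.source := mem_chart_source _ x
  obtain ⟨K, ⟨hK, hKc⟩, hKt⟩ := (compact_basis_nhds (e x)).mem_iff.1
    (e.open_target.mem_nhds (e.map_source hx))
  obtain ⟨B, hB⟩ := hKc.exists_bound_of_continuousOn ((continuousOn_chartCoeff hμ he).mono hKt)
  have hU : IsOpen (e.source ∩ e ⁻¹' interior K) := e.isOpen_inter_preimage isOpen_interior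
  refine ⟨_, hU.mem_nhds ⟨hx, mem_interior_iff_mem_nhds.2 hK⟩, ?_⟩
  rw [← lintegral_indicator_one hU.measurableSet, lintegral_volumeMeasure_chart hμ he
    (measurable_one.indicator hU.measurableSet) (fun x hx => indicator_of_notMem (fun h => hx h.1) _)]
  have h2 : ∫⁻ y in e.target, ENNReal.ofReal |chartCoeff μ e y| *
      (e.source ∩ e ⁻¹' interior K).indicator 1 (e.symm y) ≤
      ∫⁻ y, K.indicator (fun _ => ENNReal.ofReal B) y := by
    refine (setLIntegral_mono' e.open_target.measurableSet fun y hy => ?_).trans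
      (setLIntegral_le_lintegral _ _)
    by_cases h : y ∈ interior K
    · have h3 : e.symm y ∈ e.source ∩ e ⁻¹' interior K := ⟨e.map_target hy, by simpa [hy] using h⟩
      rw [indicator_of_mem h3, indicator_of_mem (interior_subset h)]
      simpa using ENNReal.ofReal_le_ofReal (hB y (interior_subset h))
    · have h3 : e.symm y ∉ e.source ∩ e ⁻¹' interior K := fun h4 => h (by simpa [hy] using h4.2)
      simp [indicator_of_notMem h3]
  refine h2.trans_lt ?_
  rw [lintegral_indicator_const hKc.measurableSet]
  exact ENNReal.mul_lt_top ENNReal.ofReal_lt_top hKc.measure_lt_top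

lemma volume_first_coord_eq_zero : (volume : Measure (Model d)) {y | y 0 = 0} = 0 := by
  have h := Measure.addHaar_submodule (volume : Measure (Model d))
    (LinearMap.ker (EuclideanSpace.proj (𝕜 := ℝ) (0 : Fin (d + 1)) : Model d →L[ℝ] ℝ).toLinearMap) ?_
  · exact h
  · intro h
    have h1 : (EuclideanSpace.single 0 1 : Model d) ∈
      LinearMap.ker (EuclideanSpace.proj (𝕜 := ℝ) (0 : Fin (d + 1)) : Model d →L[ℝ] ℝ).toLinearMap :=
      h ▸ Submodule.mem_top
    simp at h1

/-- In a slice chart the hypersurface is the hyperplane `y₀ = 0`, a proper subspace; second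
countability passes from locally null to null. -/
lemma volumeMeasure_carrier {μ : KForm d M (d + 1)} (hμ : IsSmoothTopForm μ)
    (S : Hypersurface d M) : volumeMeasure μ S.carrier = 0 := by
  have : SecondCountableTopology M := ChartedSpace.secondCountable_of_sigmaCompact (Model d) M
  refine measure_null_of_locally_null _ fun x hx => ?_
  obtain ⟨e, he, hxe, hs⟩ := S.exists_slice x hx
  refine ⟨S.carrier ∩ e.source, inter_mem_nhdsWithin _ (e.open_source.mem_nhds hxe), ?_⟩
  have hm : MeasurableSet (S.carrier ∩ e.source) :=
    S.isClosed_carrier.measurableSet.inter e.open_source.measurableSet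
  rw [← lintegral_indicator_one hm, lintegral_volumeMeasure_chart hμ he
    (measurable_one.indicator hm) (fun x hx => indicator_of_notMem (fun h => hx h.2) _)]
  refine (lintegral_congr_ae ?_).trans lintegral_zero
  have h0 : ∀ᵐ y ∂((volume : Measure (Model d)).restrict e.target), ¬ y 0 = 0 :=
    ae_restrict_of_ae (by rw [ae_iff]; simpa using volume_first_coord_eq_zero)
  filter_upwards [h0, ae_restrict_mem e.open_target.measurableSet] with y hy hyt
  have : e.symm y ∉ S.carrier := fun h => hy (by
    have := (hs _ (e.map_target hyt)).2.1.1 h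
    rwa [e.right_inv hyt] at this)
  simp [this]

end ChartMeasure

/-! ### First variation of an integral over a moving half-space. -/

section MovingHalfSpace

variable {d : ℕ}

/-- The point `(s, y)` of `ℝ × ℝ^d`. -/
def consPoint (s : ℝ) (y : EuclideanSpace ℝ (Fin d)) : Model d :=
  WithLp.toLp 2 (Fin.cons s fun i => y i)

lemma consPoint_zero (y : EuclideanSpace ℝ (Fin d)) : consPoint 0 y = face y := rfl

@[simp] lemma consPoint_apply_zero (s : ℝ) (y : EuclideanSpace ℝ (Fin d)) :
    consPoint s y 0 = s := rfl

@[simp] lemma consPoint_apply_succ (s : ℝ) (y : EuclideanSpace ℝ (Fin d)) (i : Fin d) :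
    consPoint s y i.succ = y i := rfl

lemma consPoint_eq_add (s : ℝ) (y : EuclideanSpace ℝ (Fin d)) :
    consPoint s y = face y + s • EuclideanSpace.single 0 (1 : ℝ) := by
  ext i
  refine Fin.cases ?_ (fun j => ?_) i
  · simp [← consPoint_zero]
  · simp [← consPoint_zero]

lemma continuous_consPoint :
    Continuous fun p : EuclideanSpace ℝ (Fin d) × ℝ => consPoint p.2 p.1 := by
  refine (PiLp.continuous_toLp 2 _).comp (continuous_pi fun i => ?_)
  refine Fin.cases ?_ (fun j => ?_) i
  · exact continuous_snd
  · exact (EuclideanSpace.proj (𝕜 := ℝ) j).continuous.comp continuous_fst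

lemma continuous_face : Continuous (face : EuclideanSpace ℝ (Fin d) → Model d) :=
  continuous_consPoint.comp (continuous_id.prodMk continuous_const)

lemma measurePreserving_consPoint :
    MeasurePreserving (fun p : EuclideanSpace ℝ (Fin d) × ℝ => consPoint p.2 p.1) := by
  have h1 : MeasurePreserving (Prod.swap : EuclideanSpace ℝ (Fin d) × ℝ → _) :=
    Measure.measurePreserving_swap
  have h2 : MeasurePreserving (Prod.map (id : ℝ → ℝ)
      (WithLp.ofLp : EuclideanSpace ℝ (Fin d) → Fin d → ℝ)) :=
    (MeasurePreserving.id _).prod (PiLp.volume_preserving_ofLp _)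
  have h3 := (volume_preserving_piFinSuccAbove (fun _ : Fin (d + 1) => ℝ) 0).symm
  have h4 := ((PiLp.volume_preserving_toLp (Fin (d + 1))).comp h3).comp (h2.comp h1)
  convert h4 using 1
  ext p i
  refine Fin.cases ?_ (fun j => ?_) i <;> simp [MeasurableEquiv.piFinSuccAbove]

lemma injective_consPoint :
    Function.Injective fun p : EuclideanSpace ℝ (Fin d) × ℝ => consPoint p.2 p.1 := by
  intro p q h
  have h' : ∀ i, consPoint p.2 p.1 i = consPoint q.2 q.1 i := fun i => by
    change consPoint p.2 p.1 = consPoint q.2 q.1 at h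
    rw [h]
  refine Prod.ext ?_ (by simpa using h' 0)
  ext i
  simpa using h' i.succ

/-- The substitution `y₀ = t r` in the normal coordinate only; it magnifies the layer of width
`O(t)` that a moving hypersurface sweeps out. -/
lemma integral_eq_abs_mul_integral_consPoint (f : Model d → ℝ) {t : ℝ} (ht : t ≠ 0) :
    ∫ y, f y = |t| * ∫ p : EuclideanSpace ℝ (Fin d) × ℝ, f (consPoint (t * p.2) p.1) := by
  rw [← measurePreserving_consPoint.integral_comp
    (continuous_consPoint.measurableEmbedding injective_consPoint)]
  have hm : Measure.map (Prod.map id (t * ·)) (volume : Measure (EuclideanSpace ℝ (Fin d) × ℝ)) =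
      ENNReal.ofReal |t⁻¹| • volume := by
    rw [Measure.volume_eq_prod, ← Measure.map_prod_map _ _ measurable_id (measurable_const_mul t),
      Real.map_volume_mul_left ht, Measure.map_id, Measure.prod_smul_right]
  have he : MeasurableEmbedding (Prod.map id (t * ·) :
      EuclideanSpace ℝ (Fin d) × ℝ → EuclideanSpace ℝ (Fin d) × ℝ) :=
    (continuous_id.prodMap (continuous_const_mul t)).measurableEmbedding
      (Function.injective_id.prodMap (mul_right_injective₀ ht))
  have h := he.integral_map (μ := volume) fun p => f (consPoint p.2 p.1)
  rw [hm, integral_smul_measure] at h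
  change _ = |t| * ∫ p : EuclideanSpace ℝ (Fin d) × ℝ,
    (fun p : EuclideanSpace ℝ (Fin d) × ℝ => f (consPoint p.2 p.1)) (Prod.map id (t * ·) p)
  rw [← h]
  simp [ht]

/-- The signed length between `0` and `b`, for either sign of `b`: this is how the normal
displacement emerges from the limit of indicator functions. -/
lemma integral_indicator_Iio_sub (b : ℝ) :
    ∫ r : ℝ, ((Iio b).indicator 1 r - (Iio 0).indicator 1 r : ℝ) = b := by
  rcases le_total 0 b with hb | hb
  · have : (fun r : ℝ => ((Iio b).indicator 1 r - (Iio 0).indicator 1 r : ℝ)) =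
        (Ico 0 b).indicator 1 := by
      ext r
      simp only [indicator, mem_Iio, mem_Ico, Pi.one_apply]
      split_ifs <;> first | (exfalso; grind) | norm_num
    rw [this, integral_indicator_one measurableSet_Ico]
    simp [hb]
  · have : (fun r : ℝ => ((Iio b).indicator 1 r - (Iio 0).indicator 1 r : ℝ)) =
        fun r => - (Ico b 0).indicator 1 r := by
      ext r
      simp only [indicator, mem_Iio, mem_Ico, Pi.one_apply]
      split_ifs <;> first | (exfalso; grind) | norm_num
    rw [this, integral_neg, integral_indicator_one measurableSet_Ico]
    simp [hb]

/-- Pointwise limit of the rescaled indicator function of a moving half line. -/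
lemma tendsto_indicator_moving {ζ : ℝ → ℝ} {c r : ℝ} (hc : c ≠ 0) (hr : r ≠ 0)
    (hζ : HasDerivAt ζ c 0) (h0 : ζ 0 = 0) :
    ∀ᶠ t in 𝓝[≠] (0 : ℝ), t⁻¹ * |t| * ((Iio 0).indicator 1 (ζ t) - (Iio 0).indicator 1 (t * r)) =
      ((Iio 0).indicator 1 c - (Iio 0).indicator 1 r : ℝ) := by
  have h1 : Filter.Tendsto (fun t => t⁻¹ * ζ t) (𝓝[≠] 0) (𝓝 c) := by
    simpa [h0] using hζ.tendsto_slope_zero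
  have h2 : ∀ᶠ t in 𝓝[≠] (0 : ℝ), 0 < (t⁻¹ * ζ t) * c := by
    have := h1.mul_const c
    exact this.eventually_const_lt (mul_self_pos.2 hc)
  filter_upwards [h2, self_mem_nhdsWithin] with t ht ht0
  have ht0 : t ≠ 0 := ht0
  simp only [indicator, mem_Iio, Pi.one_apply]
  -- The factor `t⁻¹ * |t|` is the sign of `t`. For negative `t` both conditions `ζ t < 0` and `t *
  -- r < 0` are reversed, which flips the difference of indicators, and the factor `-1` restores it.
  rcases lt_or_gt_of_ne ht0 with h | h
  · have e1 : t⁻¹ * |t| = -1 := by rw [abs_of_neg h]; field_simp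
    have e2 : ζ t < 0 ↔ ¬ c < 0 := by
      have : t⁻¹ < 0 := inv_lt_zero.2 h
      constructor
      · intro h3 h4
        have := mul_pos_of_neg_of_neg this h3
        nlinarith
      · intro h3
        have h4 : 0 < c := lt_of_le_of_ne (not_lt.1 h3) hc.symm
        by_contra h5
        have : t⁻¹ * ζ t ≤ 0 := mul_nonpos_of_nonpos_of_nonneg this.le (not_lt.1 h5)
        nlinarith
    have e3 : t * r < 0 ↔ ¬ r < 0 := by
      rw [mul_neg_iff]
      constructor
      · rintro (⟨h3, _⟩ | ⟨_, h3⟩) <;> linarith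
      · intro h3
        exact Or.inr ⟨h, lt_of_le_of_ne (not_lt.1 h3) hr.symm⟩
    rw [e1]
    simp only [e2, e3]
    split_ifs <;> simp
  · have e1 : t⁻¹ * |t| = 1 := by rw [abs_of_pos h]; field_simp
    have e2 : ζ t < 0 ↔ c < 0 := by
      have : 0 < t⁻¹ := inv_pos.2 h
      constructor
      · intro h3
        by_contra h4
        have := mul_neg_of_pos_of_neg this h3
        nlinarith
      · intro h3
        by_contra h5
        have : 0 ≤ t⁻¹ * ζ t := mul_nonneg this.le (not_lt.1 h5)
        nlinarith
    have e3 : t * r < 0 ↔ r < 0 := by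
      rw [mul_neg_iff]
      constructor
      · rintro (⟨_, h3⟩ | ⟨h3, _⟩) <;> linarith
      · exact fun h3 => Or.inl ⟨h, h3⟩
    rw [e1]
    simp only [e2, e3]
    split_ifs <;> simp

/-- First variation of the integral over a region which is `{y₀ < 0}` at time `0`. -/
theorem hasDerivAt_setIntegral_moving {H : Model d → ℝ} (hH : Continuous H)
    (hc : HasCompactSupport H) {A : ℝ → Set (Model d)} (hA : ∀ t, MeasurableSet (A t))
    {η : ℝ → Model d → ℝ} {K : ℝ} {b : EuclideanSpace ℝ (Fin d) → ℝ}
    (hη : ∀ᶠ t in 𝓝 (0 : ℝ), ∀ y ∈ tsupport H,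
      (y ∈ A t ↔ η t y < 0) ∧ |η t y - y 0| ≤ K * |t|)
    (hbc : ContinuousOn b {y | H (face y) ≠ 0})
    (hb : ∀ y, H (face y) ≠ 0 → ∀ r : ℝ,
      HasDerivAt (fun t => η t (consPoint (t * r) y)) (r - b y) 0) :
    HasDerivAt (fun t => ∫ y in A t, H y) (∫ y, H (face y) * b y) 0 := by
  have hη0 : ∀ y ∈ tsupport H, η 0 y = y 0 := fun y hy => by
    have := (hη.self_of_nhds y hy).2
    simpa [sub_eq_zero] using this
  have hA0 : ∀ y ∈ tsupport H, (y ∈ A 0 ↔ y 0 < 0) := fun y hy => by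
    rw [(hη.self_of_nhds y hy).1, hη0 y hy]
  have hint : ∀ t, Integrable ((A t).indicator H) := fun t =>
    (hH.integrable_of_hasCompactSupport hc).indicator (hA t)
  set U : Set (EuclideanSpace ℝ (Fin d)) := {y | H (face y) ≠ 0} with hU
  have hUo : IsOpen U := isOpen_ne_fun (hH.comp continuous_face) continuous_const
  -- Since `b` is controlled only on `U`, it is extended by zero to get a measurable function whose
  -- graph is a null set.
  set β : EuclideanSpace ℝ (Fin d) → ℝ := U.indicator b with hβ
  have hβm : Measurable β := by
    classical
    have := hbc.measurable_piecewise (g := fun _ => (0 : ℝ)) continuousOn_const hUo.measurableSet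
    rw [hβ, ← Set.piecewise_eq_indicator]
    exact this
  -- The integrand of the difference quotient after `y₀ = t r`: the factor combines `t⁻¹` with the
  -- Jacobian `|t|`.
  let G : ℝ → EuclideanSpace ℝ (Fin d) × ℝ → ℝ := fun t p => t⁻¹ * |t| *
    ((A t).indicator H (consPoint (t * p.2) p.1) - (A 0).indicator H (consPoint (t * p.2) p.1))
  let G₀ : EuclideanSpace ℝ (Fin d) × ℝ → ℝ := fun p => H (face p.1) *
    ((Iio (β p.1)).indicator 1 p.2 - (Iio 0).indicator 1 p.2)
  have hcont : ∀ t : ℝ, Continuous fun p : EuclideanSpace ℝ (Fin d) × ℝ =>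
      consPoint (t * p.2) p.1 := fun t =>
    continuous_consPoint.comp (continuous_fst.prodMk (continuous_const.mul continuous_snd))
  have hGm : ∀ t, Measurable (G t) := fun t =>
    (((hH.measurable.indicator (hA t)).comp (hcont t).measurable).sub
      ((hH.measurable.indicator (hA 0)).comp (hcont t).measurable)).const_mul _
  obtain ⟨C, hC⟩ := hc.exists_bound_of_continuous hH
  obtain ⟨R, hR⟩ := hc.isBounded.exists_norm_le
  -- the difference quotient as an integral
  have hslope : ∀ᶠ t in 𝓝[≠] (0 : ℝ),
      t⁻¹ • ((∫ y in A (0 + t), H y) - ∫ y in A 0, H y) = ∫ p, G t p := by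
    filter_upwards [self_mem_nhdsWithin] with t ht
    rw [zero_add, ← integral_indicator (hA t), ← integral_indicator (hA 0),
      ← integral_sub (hint t) (hint 0), integral_eq_abs_mul_integral_consPoint _ ht,
      integral_const_mul, smul_eq_mul, mul_assoc]
  -- the domination
  let D : Set (EuclideanSpace ℝ (Fin d) × ℝ) := Metric.closedBall 0 R ×ˢ Icc (-K) K
  have hDm : MeasurableSet D := measurableSet_closedBall.prod measurableSet_Icc
  have hDf : volume D < ⊤ :=
    ((isCompact_closedBall _ _).prod isCompact_Icc).measure_lt_top
  have hbound : ∀ᶠ t in 𝓝[≠] (0 : ℝ), ∀ p, ‖G t p‖ ≤ D.indicator (fun _ => C) p := by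
    filter_upwards [self_mem_nhdsWithin, hη.filter_mono nhdsWithin_le_nhds] with t ht hηt p
    have ht' : t ≠ 0 := ht
    have hC0 : 0 ≤ C := (norm_nonneg _).trans (hC 0)
    set y := consPoint (t * p.2) p.1 with hy
    by_cases hyH : y ∈ tsupport H
    swap
    · have : H y = 0 := image_eq_zero_of_notMem_tsupport hyH
      have : G t p = 0 := by simp [G, ← hy, indicator, this]
      rw [this, norm_zero]
      exact indicator_nonneg (fun _ _ => hC0) _
    by_cases hiff : y ∈ A t ↔ y ∈ A 0
    · have : G t p = 0 := by
        have h : (A t).indicator H y = (A 0).indicator H y := by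
          by_cases h0 : y ∈ A 0
          · rw [indicator_of_mem h0, indicator_of_mem (hiff.2 h0)]
          · rw [indicator_of_notMem h0, indicator_of_notMem fun h => h0 (hiff.1 h)]
        simp only [G]
        rw [← hy, h, sub_self, mul_zero]
      rw [this, norm_zero]
      exact indicator_nonneg (fun _ _ => hC0) _
    -- Membership in `A t` and `A 0` differs only if exactly one of `η t y` and `y₀` is negative.
    -- Then `|y₀| ≤ |η t y - y₀| ≤ K * |t|`, and `y₀ = t r` gives `|r| ≤ K`.
    have hpD : p ∈ D := by
      obtain ⟨h1, h2⟩ := hηt y hyH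
      rw [h1, hA0 y hyH] at hiff
      have hy0 : y 0 = t * p.2 := rfl
      have h3 : |t * p.2| ≤ K * |t| := by
        rw [← hy0]
        refine le_trans ?_ h2
        by_cases h4 : η t y < 0
        · have h5 : 0 ≤ y 0 := not_lt.1 fun h => hiff ⟨fun _ => h, fun _ => h4⟩
          rw [abs_of_nonneg h5, abs_of_neg (by linarith)]
          linarith
        · have h5 : y 0 < 0 := by
            by_contra h
            exact hiff ⟨fun h6 => absurd h6 h4, fun h6 => absurd h6 h⟩
          rw [abs_of_neg h5, abs_of_nonneg (by linarith)]
          linarith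
      rw [abs_mul, mul_comm] at h3
      have h4 : |p.2| ≤ K := le_of_mul_le_mul_right h3 (abs_pos.2 ht')
      refine ⟨?_, abs_le.1 h4⟩
      rw [mem_closedBall_zero_iff]
      refine le_trans ?_ (hR y hyH)
      rw [EuclideanSpace.norm_eq, EuclideanSpace.norm_eq]
      refine Real.sqrt_le_sqrt ?_
      rw [Fin.sum_univ_succ]
      simp only [hy, consPoint_apply_succ]
      have := sq_nonneg ‖consPoint (t * p.2) p.1 0‖
      linarith
    rw [indicator_of_mem hpD]
    have h1 : |t⁻¹ * abs t| = 1 := by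
      rw [abs_mul, abs_abs, abs_inv, inv_mul_cancel₀ (abs_pos.2 ht').ne']
    have h2 : G t p = t⁻¹ * |t| * ((A t).indicator H y - (A 0).indicator H y) := rfl
    rw [h2, Real.norm_eq_abs, abs_mul, h1, one_mul]
    have h3 := hC y
    rw [Real.norm_eq_abs] at h3
    by_cases h4 : y ∈ A t <;> by_cases h5 : y ∈ A 0 <;> simp [h4, h5, h3, hC0]
  have hboundint : Integrable (D.indicator fun _ => C) :=
    (integrable_indicator_iff hDm).2 (integrableOn_const hDf.ne)
  -- the pointwise limit
  have hnull : ∀ᵐ p : EuclideanSpace ℝ (Fin d) × ℝ, p.2 ≠ 0 ∧ p.2 ≠ β p.1 := by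
    have h : ∀ g : EuclideanSpace ℝ (Fin d) → ℝ, Measurable g →
        ∀ᵐ p : EuclideanSpace ℝ (Fin d) × ℝ, p.2 ≠ g p.1 := by
      intro g hg
      have hm : MeasurableSet {p : EuclideanSpace ℝ (Fin d) × ℝ | p.2 = g p.1} :=
        measurableSet_eq_fun measurable_snd (hg.comp measurable_fst)
      rw [ae_iff]
      simp only [ne_eq, not_not]
      rw [Measure.volume_eq_prod, Measure.measure_prod_null hm]
      refine Filter.Eventually.of_forall fun y => ?_
      have : Prod.mk y ⁻¹' {p : EuclideanSpace ℝ (Fin d) × ℝ | p.2 = g p.1} = {g y} := by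
        ext r; simp
      simp only [this]
      simp
    filter_upwards [h _ measurable_const, h _ hβm] with p h1 h2 using ⟨h1, h2⟩
  have hlim : ∀ᵐ p : EuclideanSpace ℝ (Fin d) × ℝ,
      Filter.Tendsto (fun t => G t p) (𝓝[≠] 0) (𝓝 (G₀ p)) := by
    filter_upwards [hnull] with p ⟨hp0, hpβ⟩
    have hct : Continuous fun t : ℝ => consPoint (t * p.2) p.1 :=
      continuous_consPoint.comp (continuous_const.prodMk (continuous_id.mul continuous_const))
    have hHt : Filter.Tendsto (fun t : ℝ => H (consPoint (t * p.2) p.1)) (𝓝[≠] 0)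
        (𝓝 (H (face p.1))) := by
      have := (hH.comp hct).tendsto 0
      simp only [Function.comp_apply, zero_mul, consPoint_zero] at this
      exact this.mono_left nhdsWithin_le_nhds
    -- Where `H` vanishes on the hyperplane nothing is known about the derivative of `η`, but `|G t
    -- p|` is at most `|H|` at a point tending to the hyperplane.
    by_cases hU' : H (face p.1) = 0
    · have e0 : G₀ p = 0 := by simp [G₀, hU']
      rw [e0]
      rw [hU'] at hHt
      refine squeeze_zero_norm' (a := fun t => ‖H (consPoint (t * p.2) p.1)‖) ?_
        (by simpa using hHt.norm)
      filter_upwards [self_mem_nhdsWithin] with t ht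
      have ht' : t ≠ 0 := ht
      have h1 : |t⁻¹ * abs t| = 1 := by
        rw [abs_mul, abs_abs, abs_inv, inv_mul_cancel₀ (abs_pos.2 ht').ne']
      simp only [G]
      rw [norm_mul, Real.norm_eq_abs (t⁻¹ * |t|), h1, one_mul]
      set y := consPoint (t * p.2) p.1
      by_cases h4 : y ∈ A t <;> by_cases h5 : y ∈ A 0 <;> simp [h4, h5]
    · have hβb : β p.1 = b p.1 := indicator_of_mem (show p.1 ∈ U from hU') b
      have hmem : face p.1 ∈ tsupport H := subset_tsupport _ hU'
      have hne : ∀ᶠ t in 𝓝[≠] (0 : ℝ), H (consPoint (t * p.2) p.1) ≠ 0 :=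
        hHt.eventually_ne hU'
      have hζ0 : η 0 (consPoint (0 * p.2) p.1) = 0 := by
        rw [zero_mul, consPoint_zero, hη0 _ hmem]
        rfl
      -- The slope is `r - b`, nonzero because the graph of `β` has been discarded.
      have hind := tendsto_indicator_moving (sub_ne_zero.2 (hβb ▸ hpβ)) hp0 (hb p.1 hU' p.2) hζ0
      have hG : ∀ᶠ t in 𝓝[≠] (0 : ℝ), G t p = H (consPoint (t * p.2) p.1) *
          ((Iio (β p.1)).indicator 1 p.2 - (Iio 0).indicator 1 p.2) := by
        filter_upwards [hind, hne, hη.filter_mono nhdsWithin_le_nhds] with t h1 h2 h3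
        set y := consPoint (t * p.2) p.1 with hy
        have hys : y ∈ tsupport H := subset_tsupport _ h2
        have h4 : (Iio (β p.1)).indicator (1 : ℝ → ℝ) p.2 =
            (Iio 0).indicator 1 (p.2 - b p.1) := by
          simp [indicator, hβb]
        have h5 : (A t).indicator H y = H y * (Iio 0).indicator 1 (η t y) := by
          simp [indicator, (h3 y hys).1]
        have h6 : (A 0).indicator H y = H y * (Iio 0).indicator 1 (t * p.2) := by
          have : y 0 = t * p.2 := rfl
          simp [indicator, hA0 y hys, this]
        rw [h4, ← h1]
        simp only [G]
        rw [← hy, h5, h6]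
        ring
      refine Filter.Tendsto.congr' (Filter.EventuallyEq.symm hG) ?_
      exact hHt.mul_const _
  -- The bound passes to the limit; integrability is what Fubini requires below.
  have hG₀ : Integrable G₀ := by
    refine hboundint.mono' (aestronglyMeasurable_of_tendsto_ae (𝓝[≠] (0 : ℝ))
      (fun t => (hGm t).aestronglyMeasurable) hlim) ?_
    filter_upwards [hlim] with p hp
    exact le_of_tendsto hp.norm (hbound.mono fun t ht => ht p)
  have hval : ∫ p, G₀ p = ∫ y, H (face y) * b y := by
    rw [Measure.volume_eq_prod, integral_prod _ hG₀]
    refine integral_congr_ae (Filter.Eventually.of_forall fun y => ?_)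
    simp only [G₀]
    rw [integral_const_mul, integral_indicator_Iio_sub]
    by_cases h : H (face y) = 0
    · simp [h]
    · rw [hβ, indicator_of_mem (show y ∈ U from h)]
  rw [hasDerivAt_iff_tendsto_slope_zero, ← hval]
  refine Filter.Tendsto.congr' (Filter.EventuallyEq.symm hslope) ?_
  exact tendsto_integral_filter_of_dominated_convergence _
    (Filter.Eventually.of_forall fun t => (hGm t).aestronglyMeasurable)
    (hbound.mono fun t ht => Filter.Eventually.of_forall ht) hboundint hlim

end MovingHalfSpace

/-! ### Flows, velocities and contractions in coordinates. -/

section LocalReynolds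

variable {d : ℕ} {M : Type*} [TopologicalSpace M] [ChartedSpace (Model d) M]

lemma SmoothFlow.ψ_zero (Φ : SmoothFlow d M) (x : M) : Φ.ψ 0 x = x := by
  have := Φ.left_inv 0 x
  rwa [Φ.zero] at this

lemma SmoothFlow.image_eq_preimage (Φ : SmoothFlow d M) (t : ℝ) (s : Set M) :
    Φ.φ t '' s = Φ.ψ t ⁻¹' s :=
  congrFun (image_eq_preimage_of_inverse (Φ.left_inv t) (Φ.right_inv t)) s

lemma MapsHypersurface.mem_plus_iff {Φ : SmoothFlow d M} {t : ℝ} {S S' : Hypersurface d M}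
    (h : MapsHypersurface (Φ.φ t) S S') (x : M) : x ∈ S'.plus ↔ Φ.ψ t x ∈ S.plus := by
  rw [← h.1, Φ.image_eq_preimage, mem_preimage]

lemma MapsHypersurface.mem_minus_iff {Φ : SmoothFlow d M} {t : ℝ} {S S' : Hypersurface d M}
    (h : MapsHypersurface (Φ.φ t) S S') (x : M) : x ∈ S'.minus ↔ Φ.ψ t x ∈ S.minus := by
  rw [← h.2.2, Φ.image_eq_preimage, mem_preimage]

lemma SmoothFlow.continuous_φ (Φ : SmoothFlow d M) :
    Continuous fun p : ℝ × M => Φ.φ p.1 p.2 := Φ.contMDiff_φ.continuous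

lemma SmoothFlow.continuous_ψ (Φ : SmoothFlow d M) :
    Continuous fun p : ℝ × M => Φ.ψ p.1 p.2 := Φ.contMDiff_ψ.continuous

variable [IsManifold (𝓡 (d + 1)) ∞ M]

lemma contDiffAt_of_contMDiffAt_prod {E F : Type*} [NormedAddCommGroup E] [NormedSpace ℝ E]
    [NormedAddCommGroup F] [NormedSpace ℝ F] {n : ℕ∞ω} {f : ℝ × E → F} {p : ℝ × E}
    (h : ContMDiffAt (𝓘(ℝ, ℝ).prod 𝓘(ℝ, E)) 𝓘(ℝ, F) n f p) : ContDiffAt ℝ n f p := by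
  rw [← modelWithCornersSelf_prod, chartedSpaceSelf_prod] at h
  exact h.contDiffAt

/-- The coordinate expression of an isotopy is smooth near time `0`. -/
lemma contDiffAt_isotopy_in_chart {Ψ : ℝ → M → M}
    (hΨ : ContMDiff (𝓘(ℝ, ℝ).prod (𝓡 (d + 1))) (𝓡 (d + 1)) ∞ fun p : ℝ × M => Ψ p.1 p.2)
    (h0 : ∀ x, Ψ 0 x = x) {e : OpenPartialHomeomorph M (Model d)}
    (he : e ∈ IsManifold.maximalAtlas (𝓡 (d + 1)) ∞ M) {y : Model d} (hy : y ∈ e.target) :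
    ContDiffAt ℝ ∞ (fun p : ℝ × Model d => e (Ψ p.1 (e.symm p.2))) (0, y) := by
  refine contDiffAt_of_contMDiffAt_prod ?_
  have h1 : ContMDiffAt (𝓘(ℝ, ℝ).prod (𝓡 (d + 1))) (𝓘(ℝ, ℝ).prod (𝓡 (d + 1))) ∞
      (fun p : ℝ × Model d => (p.1, e.symm p.2)) (0, y) := by
    refine contMDiffAt_fst.prodMk ?_
    exact ContMDiffAt.comp (0, y) (contMDiffAt_symm_of_mem_maximalAtlas he hy) contMDiffAt_snd
  have h2 : ContMDiffAt (𝓘(ℝ, ℝ).prod (𝓡 (d + 1))) (𝓡 (d + 1)) ∞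
      (fun p : ℝ × Model d => Ψ p.1 (e.symm p.2)) (0, y) :=
    ContMDiffAt.comp (0, y) hΨ.contMDiffAt h1
  refine ContMDiffAt.comp (0, y) ?_ h2
  simp only [h0]
  exact contMDiffAt_of_mem_maximalAtlas he (e.map_target hy)

/-- The derivative of the coordinate expression of an isotopy at time `0`. -/
lemma fderiv_isotopy_in_chart {Ψ : ℝ → M → M}
    (hΨ : ContMDiff (𝓘(ℝ, ℝ).prod (𝓡 (d + 1))) (𝓡 (d + 1)) ∞ fun p : ℝ × M => Ψ p.1 p.2)
    (h0 : ∀ x, Ψ 0 x = x) {e : OpenPartialHomeomorph M (Model d)}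
    (he : e ∈ IsManifold.maximalAtlas (𝓡 (d + 1)) ∞ M) {y : Model d} (hy : y ∈ e.target)
    (ζ : Model d) :
    fderiv ℝ (fun p : ℝ × Model d => e (Ψ p.1 (e.symm p.2))) (0, y) (0, ζ) = ζ := by
  have h1 := ((contDiffAt_isotopy_in_chart hΨ h0 he hy).differentiableAt (by simp)).hasFDerivAt
  have h2 : HasFDerivAt (fun z : Model d => ((0 : ℝ), z))
      (ContinuousLinearMap.inr ℝ ℝ (Model d)) y := hasFDerivAt_prodMk_right 0 y
  have h3 := h1.comp y h2
  have h4 : HasFDerivAt (fun z : Model d => z) (ContinuousLinearMap.id ℝ (Model d)) y :=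
    hasFDerivAt_id y
  have h5 : (fun p : ℝ × Model d => e (Ψ p.1 (e.symm p.2))) ∘ (fun z : Model d => ((0 : ℝ), z))
      =ᶠ[𝓝 y] fun z => z := by
    filter_upwards [e.open_target.mem_nhds hy] with z hz
    simp [h0, e.right_inv hz]
  have h6 := (h4.congr_of_eventuallyEq h5).unique h3
  have h7 := congrArg (fun T : Model d →L[ℝ] Model d => T ζ) h6
  simpa using h7.symm

/-- The coordinate expression of a vector field. -/
def coordField (e : OpenPartialHomeomorph M (Model d)) (v : VField d M) (y : Model d) : Model d :=
  mfderiv (𝓡 (d + 1)) (𝓡 (d + 1)) e (e.symm y) (v (e.symm y))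

lemma SmoothFlow.HasVelocity.fderiv_φ {Φ : SmoothFlow d M} {v : VField d M}
    (hv : Φ.HasVelocity 0 v) {e : OpenPartialHomeomorph M (Model d)}
    (he : e ∈ IsManifold.maximalAtlas (𝓡 (d + 1)) ∞ M) {y : Model d} (hy : y ∈ e.target) :
    fderiv ℝ (fun p : ℝ × Model d => e (Φ.φ p.1 (e.symm p.2))) (0, y) (1, 0) =
      coordField e v y := by
  have h1 := ((contDiffAt_isotopy_in_chart Φ.contMDiff_φ Φ.zero he hy).differentiableAt
    (by simp)).hasFDerivAt
  have h2 : HasFDerivAt (fun t : ℝ => (t, y))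
      (ContinuousLinearMap.inl ℝ ℝ (Model d)) 0 := hasFDerivAt_prodMk_left 0 y
  have h3 := h1.comp 0 h2
  have h4 := hv (e.symm y)
  have h5 : HasMFDerivAt (𝓡 (d + 1)) (𝓡 (d + 1)) e (Φ.φ 0 (e.symm y))
      (mfderiv (𝓡 (d + 1)) (𝓡 (d + 1)) e (Φ.φ 0 (e.symm y))) :=
    (mdifferentiableAt_chart he (by rw [Φ.zero]; exact e.map_target hy)).hasMFDerivAt
  have h6 := (h5.comp (0 : ℝ) h4).hasFDerivAt
  have h7 := h3.unique h6
  have h8 := congrArg (fun T : ℝ →L[ℝ] Model d => T 1) h7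
  -- `HasVelocity` bases the velocity at `Φ.φ 0 x`, which equals `x` only through `Φ.zero`; an
  -- equation between base points is needed to rewrite in the dependent type.
  have h9 : (mfderiv (𝓡 (d + 1)) (𝓡 (d + 1)) e (Φ.φ 0 (e.symm y)) (v (Φ.φ 0 (e.symm y))) :
      Model d) = coordField e v y := by
    have : ∀ x x' : M, x = x' → (mfderiv (𝓡 (d + 1)) (𝓡 (d + 1)) e x (v x) : Model d) =
        mfderiv (𝓡 (d + 1)) (𝓡 (d + 1)) e x' (v x') := by rintro x _ rfl; rfl
    exact this _ _ (Φ.zero _)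
  rw [← h9]
  refine Eq.trans ?_ (h8.trans ?_)
  · simp
  · change mfderiv (𝓡 (d + 1)) (𝓡 (d + 1)) e (Φ.φ 0 (e.symm y)) ((1 : ℝ) • v (Φ.φ 0 (e.symm y))) = _
    rw [one_smul]

/-- Differentiate `φ_t(ψ_t(y)) = y` at `t = 0`. Since `φ_0` is the identity, the velocities of `φ`
and `ψ` add up to zero. -/
lemma SmoothFlow.HasVelocity.fderiv_ψ {Φ : SmoothFlow d M} {v : VField d M}
    (hv : Φ.HasVelocity 0 v) {e : OpenPartialHomeomorph M (Model d)}
    (he : e ∈ IsManifold.maximalAtlas (𝓡 (d + 1)) ∞ M) {y : Model d} (hy : y ∈ e.target) :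
    fderiv ℝ (fun p : ℝ × Model d => e (Φ.ψ p.1 (e.symm p.2))) (0, y) (1, 0) =
      -coordField e v y := by
  set P : ℝ × Model d → Model d := fun p => e (Φ.φ p.1 (e.symm p.2)) with hP
  set Q : ℝ × Model d → Model d := fun p => e (Φ.ψ p.1 (e.symm p.2)) with hQ
  have hQ0 : Q (0, y) = y := by simp [hQ, Φ.ψ_zero, e.right_inv hy]
  have h1 : HasFDerivAt P (fderiv ℝ P (0, y)) (0, y) :=
    ((contDiffAt_isotopy_in_chart Φ.contMDiff_φ Φ.zero he hy).differentiableAt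
      (by simp)).hasFDerivAt
  have h2 : HasFDerivAt Q (fderiv ℝ Q (0, y)) (0, y) :=
    ((contDiffAt_isotopy_in_chart Φ.contMDiff_ψ Φ.ψ_zero he hy).differentiableAt
      (by simp)).hasFDerivAt
  have h3 : HasDerivAt (fun t : ℝ => (t, y)) ((1 : ℝ), (0 : Model d)) 0 :=
    (hasDerivAt_id 0).prodMk (hasDerivAt_const 0 y)
  have h4 : HasDerivAt (fun t : ℝ => Q (t, y)) (fderiv ℝ Q (0, y) (1, 0)) 0 :=
    HasFDerivAt.comp_hasDerivAt (l := Q) (f := fun t : ℝ => (t, y)) (0 : ℝ) h2 h3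
  have h5 : HasDerivAt (fun t : ℝ => (t, Q (t, y))) ((1 : ℝ), fderiv ℝ Q (0, y) (1, 0)) 0 :=
    (hasDerivAt_id 0).prodMk h4
  have h6 : HasDerivAt (fun t : ℝ => P (t, Q (t, y)))
      (fderiv ℝ P (0, y) (1, fderiv ℝ Q (0, y) (1, 0))) 0 := by
    rw [← hQ0] at h1
    have := h1.comp_hasDerivAt (0 : ℝ) h5
    rwa [hQ0] at this
  have h7 : (fun t : ℝ => P (t, Q (t, y))) =ᶠ[𝓝 0] fun _ => y := by
    have hc : ContinuousAt (fun t : ℝ => Φ.ψ t (e.symm y)) 0 :=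
      (Φ.continuous_ψ.comp (continuous_id.prodMk continuous_const)).continuousAt
    have : ∀ᶠ t in 𝓝 (0 : ℝ), Φ.ψ t (e.symm y) ∈ e.source :=
      hc.eventually (e.open_source.mem_nhds (by simpa only [Φ.ψ_zero] using e.map_target hy))
    filter_upwards [this] with t ht
    simp only [hP, hQ]
    rw [e.left_inv ht, Φ.right_inv, e.right_inv hy]
  have h8 := ((hasDerivAt_const (0 : ℝ) y).congr_of_eventuallyEq h7).unique h6
  have h9 : ((1 : ℝ), fderiv ℝ Q (0, y) (1, 0)) = (1, 0) + (0, fderiv ℝ Q (0, y) (1, 0)) := by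
    simp
  rw [h9, map_add, hP, fderiv_isotopy_in_chart Φ.contMDiff_φ Φ.zero he hy, hv.fderiv_φ he hy] at h8
  exact (neg_eq_of_add_eq_zero_right h8.symm).symm

/-- Expand `u` in the standard basis: every component except the zeroth repeats an argument of an
alternating form. -/
lemma curryLeft_apply_single_succ (f : (Model d) [⋀^Fin (d + 1)]→ₗ[ℝ] ℝ) (u : Model d) :
    f.curryLeft u (fun i => EuclideanSpace.single i.succ (1 : ℝ)) =
      u 0 * f (fun i => EuclideanSpace.single i (1 : ℝ)) := by
  have hu : u = ∑ i, u i • EuclideanSpace.single i (1 : ℝ) := by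
    ext j
    simp [Pi.single_apply]
  have h0 : f.curryLeft (EuclideanSpace.single 0 (1 : ℝ))
      (fun i => EuclideanSpace.single i.succ (1 : ℝ)) =
      f (fun i => EuclideanSpace.single i (1 : ℝ)) := by
    rw [AlternatingMap.curryLeft_apply_apply]
    congr 1
    ext1 i
    refine Fin.cases ?_ (fun j => ?_) i <;> simp
  have hs : ∀ j : Fin d, f.curryLeft (EuclideanSpace.single j.succ (1 : ℝ))
      (fun i => EuclideanSpace.single i.succ (1 : ℝ)) = 0 := fun j => by
    rw [AlternatingMap.curryLeft_apply_apply]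
    exact f.map_eq_zero_of_eq _ (i := 0) (j := j.succ) (by simp) (Fin.succ_ne_zero j).symm
  let g : Model d →ₗ[ℝ] ℝ :=
    { toFun := fun w => f.curryLeft w (fun i => EuclideanSpace.single i.succ (1 : ℝ))
      map_add' := by simp
      map_smul' := by simp }
  change g u = _
  change g _ = _ at h0
  change ∀ j : Fin d, g _ = 0 at hs
  conv_lhs => rw [hu, map_sum, Fin.sum_univ_succ]
  simp only [map_smul, h0, hs, smul_eq_mul, mul_zero, Finset.sum_const_zero, add_zero]

lemma mfderiv_symm_mfderiv_chart {e : OpenPartialHomeomorph M (Model d)}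
    (he : e ∈ IsManifold.maximalAtlas (𝓡 (d + 1)) ∞ M) {y : Model d} (hy : y ∈ e.target)
    (w : TangentSpace (𝓡 (d + 1)) (e.symm y)) :
    (mfderiv (𝓡 (d + 1)) (𝓡 (d + 1)) e.symm y : Model d →L[ℝ] Model d)
      (mfderiv (𝓡 (d + 1)) (𝓡 (d + 1)) e (e.symm y) w : Model d) = (w : Model d) := by
  have h1 := (mdifferentiableAt_chart he (e.map_target hy)).hasMFDerivAt
  have h2 : HasMFDerivAt (𝓡 (d + 1)) (𝓡 (d + 1)) e.symm (e (e.symm y))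
      (mfderiv (𝓡 (d + 1)) (𝓡 (d + 1)) e.symm (e (e.symm y))) :=
    (mdifferentiableAt_chart_symm he (e.map_source (e.map_target hy))).hasMFDerivAt
  have h3 := h2.comp (e.symm y) h1
  have h4 : HasMFDerivAt (𝓡 (d + 1)) (𝓡 (d + 1)) (e.symm ∘ e) (e.symm y)
      (ContinuousLinearMap.id ℝ (TangentSpace (𝓡 (d + 1)) (e.symm y))) := by
    refine (hasMFDerivAt_id (e.symm y)).congr_of_eventuallyEq ?_
    filter_upwards [e.open_source.mem_nhds (e.map_target hy)] with z hz
    simp [e.left_inv hz]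
  have h5 := hasMFDerivAt_unique h3 h4
  have h6 := congrArg (fun T : Model d →L[ℝ] Model d => T w) h5
  have h7 : (mfderiv (𝓡 (d + 1)) (𝓡 (d + 1)) e.symm (e (e.symm y)) : Model d →L[ℝ] Model d) =
      mfderiv (𝓡 (d + 1)) (𝓡 (d + 1)) e.symm y := by
    rw [e.right_inv hy]
  rw [← h7]
  exact h6

/-- In coordinates, `i_v μ` on the coordinate hyperplane is `v⁰ μ(∂₀, …, ∂_d)`. -/
lemma sign_mul_contract (μ : KForm d M (d + 1)) (v : VField d M)
    {e : OpenPartialHomeomorph M (Model d)}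
    (he : e ∈ IsManifold.maximalAtlas (𝓡 (d + 1)) ∞ M) {y : Model d} (hy : y ∈ e.target) :
    Real.sign (chartCoeff μ e y) * contract v μ (e.symm y) (fun i =>
      mfderiv (𝓡 (d + 1)) (𝓡 (d + 1)) e.symm y (EuclideanSpace.single i.succ (1 : ℝ) : Model d)) =
      |chartCoeff μ e y| * coordField e v y 0 := by
  let ν : (Model d) [⋀^Fin (d + 1)]→ₗ[ℝ] ℝ := μ (e.symm y)
  let A : Model d →L[ℝ] Model d := mfderiv (𝓡 (d + 1)) (𝓡 (d + 1)) e.symm y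
  let u : Model d := coordField e v y
  have hAu : A u = v (e.symm y) := mfderiv_symm_mfderiv_chart he hy _
  have h1 : contract v μ (e.symm y) (fun i =>
      mfderiv (𝓡 (d + 1)) (𝓡 (d + 1)) e.symm y (EuclideanSpace.single i.succ (1 : ℝ) : Model d)) =
      (ν.compLinearMap (A : Model d →ₗ[ℝ] Model d)).curryLeft u
        (fun i => EuclideanSpace.single i.succ (1 : ℝ)) := by
    change ν.curryLeft (v (e.symm y)) (fun i => A (EuclideanSpace.single i.succ (1 : ℝ))) = _
    rw [← hAu, AlternatingMap.curryLeft_apply_apply, AlternatingMap.curryLeft_apply_apply,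
      AlternatingMap.compLinearMap_apply]
    congr 1
    ext1 i
    refine Fin.cases ?_ (fun j => ?_) i <;> simp
  have h2 : (ν.compLinearMap (A : Model d →ₗ[ℝ] Model d))
      (fun i => EuclideanSpace.single i (1 : ℝ)) = chartCoeff μ e y := rfl
  rw [h1, curryLeft_apply_single_succ, h2]
  change _ = |chartCoeff μ e y| * u 0
  -- The sign that orients `Γ` turns the coefficient of `μ` into the density of the volume measure,
  -- whatever the orientation of the chart.
  rcases lt_trichotomy (chartCoeff μ e y) 0 with h | h | h
  · rw [Real.sign_of_neg h, abs_of_neg h]; ring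
  · simp [h]
  · rw [Real.sign_of_pos h, abs_of_pos h]; ring

end LocalReynolds

/-! ### First variation of the volume integral of a fixed function. -/

section Reynolds

variable {d : ℕ} {M : Type*} [TopologicalSpace M] [ChartedSpace (Model d) M]
  [IsManifold (𝓡 (d + 1)) ∞ M]

/-- A `C¹` function is Lipschitz near `(0, x)` in a chart, and compactness of `C` reduces to
finitely many constants. The result supplies the dominating functions for both kinds of difference
quotient. -/
lemma exists_lipschitz_in_time {f : ℝ → M → ℝ} {C : Set M} (hC : IsCompact C)
    (hf : ∀ x ∈ C, ContMDiffAt (𝓘(ℝ, ℝ).prod (𝓡 (d + 1))) 𝓘(ℝ, ℝ) 1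
      (fun p : ℝ × M => f p.1 p.2) (0, x)) :
    ∃ K : ℝ, ∀ᶠ t in 𝓝 (0 : ℝ), ∀ x ∈ C, |f t x - f 0 x| ≤ K * |t| := by
  refine hC.induction_on (p := fun s => ∃ K : ℝ, ∀ᶠ t in 𝓝 (0 : ℝ), ∀ x ∈ s,
    |f t x - f 0 x| ≤ K * |t|) ⟨0, by simp⟩ ?_ ?_ ?_
  · rintro s s' hs ⟨K, hK⟩
    exact ⟨K, hK.mono fun t ht x hx => ht x (hs hx)⟩
  · rintro s s' ⟨K, hK⟩ ⟨K', hK'⟩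
    refine ⟨max K K', ?_⟩
    filter_upwards [hK, hK'] with t h1 h2 x hx
    rcases hx with hx | hx
    · exact (h1 x hx).trans (mul_le_mul_of_nonneg_right (le_max_left _ _) (abs_nonneg _))
    · exact (h2 x hx).trans (mul_le_mul_of_nonneg_right (le_max_right _ _) (abs_nonneg _))
  · intro x₀ hx₀
    set e := chartAt (Model d) x₀
    have he : e ∈ IsManifold.maximalAtlas (𝓡 (d + 1)) ∞ M := IsManifold.chart_mem_maximalAtlas x₀
    have hxe : x₀ ∈ e.source := mem_chart_source _ x₀
    have h1 : ContDiffAt ℝ 1 (fun p : ℝ × Model d => f p.1 (e.symm p.2)) (0, e x₀) := by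
      refine contDiffAt_of_contMDiffAt_prod ?_
      have h2 : ContMDiffAt (𝓘(ℝ, ℝ).prod (𝓡 (d + 1))) (𝓘(ℝ, ℝ).prod (𝓡 (d + 1))) 1
          (fun p : ℝ × Model d => (p.1, e.symm p.2)) (0, e x₀) := by
        refine contMDiffAt_fst.prodMk ?_
        exact ContMDiffAt.comp (0, e x₀) ((contMDiffAt_symm_of_mem_maximalAtlas he
          (e.map_source hxe)).of_le (by simp)) contMDiffAt_snd
      refine ContMDiffAt.comp (0, e x₀) (g := fun p : ℝ × M => f p.1 p.2) ?_ h2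
      simp only [e.left_inv hxe]
      exact hf x₀ hx₀
    obtain ⟨K, N, hN, hK⟩ := h1.exists_lipschitzOnWith
    obtain ⟨U, hU, V, hV, hUV⟩ := mem_nhds_prod_iff.1 hN
    refine ⟨e.source ∩ e ⁻¹' V, mem_nhdsWithin_of_mem_nhds (Filter.inter_mem
      (e.open_source.mem_nhds hxe) ((e.continuousAt hxe).preimage_mem_nhds hV)), K, ?_⟩
    filter_upwards [hU] with t ht x hx
    have h3 := hK.dist_le_mul (t, e x) (hUV ⟨ht, hx.2⟩) (0, e x) (hUV ⟨mem_of_mem_nhds hU, hx.2⟩)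
    simpa [Prod.dist_eq, e.left_inv hx.1, Real.dist_eq] using h3

/-- The image of the support of `h` is compact inside the target, so the extension by zero is
continuous although `k` is controlled only on the target. -/
lemma continuous_indicator_chart [T2Space M] {e : OpenPartialHomeomorph M (Model d)} {h : M → ℝ}
    (hh : Continuous h) (hc : HasCompactSupport h) (hs : tsupport h ⊆ e.source)
    {k : Model d → ℝ} (hk : ContinuousOn k e.target) :
    Continuous (e.target.indicator fun y => k y * h (e.symm y)) ∧
      HasCompactSupport (e.target.indicator fun y => k y * h (e.symm y)) ∧
      tsupport (e.target.indicator fun y => k y * h (e.symm y)) ⊆ e '' tsupport h := by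
  set H := e.target.indicator fun y => k y * h (e.symm y) with hH
  have hC : IsCompact (e '' tsupport h) := hc.isCompact.image_of_continuousOn
    (e.continuousOn.mono hs)
  have h0 : ∀ y ∉ e '' tsupport h, H y = 0 := by
    intro y hy
    by_cases hyt : y ∈ e.target
    · rw [hH, indicator_of_mem hyt]
      have : e.symm y ∉ tsupport h := fun h' => hy ⟨_, h', e.right_inv hyt⟩
      simp [image_eq_zero_of_notMem_tsupport this]
    · rw [hH, indicator_of_notMem hyt]
  refine ⟨continuous_iff_continuousAt.2 fun y => ?_, HasCompactSupport.intro hC h0,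
    closure_minimal (fun y hy => by_contra fun h' => hy (h0 y h')) hC.isClosed⟩
  by_cases hyt : y ∈ e.target
  · have h1 : ContinuousAt (fun y => k y * h (e.symm y)) y :=
      ((hk.continuousAt (e.open_target.mem_nhds hyt)).mul
        (hh.continuousAt.comp (e.continuousAt_symm hyt)))
    refine h1.congr ?_
    filter_upwards [e.open_target.mem_nhds hyt] with z hz
    rw [hH, indicator_of_mem hz]
  · have h1 : y ∈ (e '' tsupport h)ᶜ := fun ⟨x, hx, hxy⟩ => hyt (hxy ▸ e.map_source (hs hx))
    refine (continuousAt_const (y := (0 : ℝ))).congr ?_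
    filter_upwards [hC.isClosed.isOpen_compl.mem_nhds h1] with z hz
    exact (h0 z hz).symm

variable [T2Space M] [SigmaCompactSpace M] [MeasurableSpace M] [BorelSpace M]

/-- Transport of the region `D⁺`, for functions supported in a slice chart. -/
lemma hasDerivAt_setIntegral_plus_slice {μ : KForm d M (d + 1)} (hμ : IsSmoothTopForm μ)
    {Φ : SmoothFlow d M} {v : VField d M} (hv : Φ.HasVelocity 0 v) {S : Hypersurface d M}
    {S' : ℝ → Hypersurface d M} (hS : ∀ t, MapsHypersurface (Φ.φ t) S (S' t))
    {e : OpenPartialHomeomorph M (Model d)}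
    (he : e ∈ IsManifold.maximalAtlas (𝓡 (d + 1)) ∞ M)
    (hslice : ∀ x ∈ e.source, (x ∈ S.plus ↔ e x 0 < 0))
    {h : M → ℝ} (hh : Continuous h) (hc : HasCompactSupport h) (hs : tsupport h ⊆ e.source) :
    HasDerivAt (fun t => ∫ x in (S' t).plus, h x ∂(volumeMeasure μ))
      (∫ y in {y : EuclideanSpace ℝ (Fin d) | face y ∈ e.target}, h (e.symm (face y)) *
        (Real.sign (chartCoeff μ e (face y)) * contract v μ (e.symm (face y)) fun i =>
          mfderiv (𝓡 (d + 1)) (𝓡 (d + 1)) e.symm (face y)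
            (EuclideanSpace.single i.succ (1 : ℝ) : Model d))) 0 := by
  have := isLocallyFiniteMeasure_volumeMeasure hμ
  obtain ⟨hH, hHc, hHs⟩ := continuous_indicator_chart hh hc hs (continuousOn_chartCoeff hμ he).abs
  set H := e.target.indicator fun y => |chartCoeff μ e y| * h (e.symm y) with hHdef
  have hHt : tsupport H ⊆ e.target := hHs.trans (by
    rintro _ ⟨x, hx, rfl⟩
    exact e.map_source (hs hx))
  let A : ℝ → Set (Model d) := fun t => e.target ∩ e.symm ⁻¹' (S' t).plus
  have hAo : ∀ t, IsOpen (A t) := fun t => e.isOpen_inter_preimage_symm (S' t).isOpen_plus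
  -- A defining function of the moved region: a point lies in it exactly when `ψ_t` pulls it back to
  -- `y₀ < 0`.
  let η : ℝ → Model d → ℝ := fun t y => e (Φ.ψ t (e.symm y)) 0
  let Q : ℝ × Model d → Model d := fun p => e (Φ.ψ p.1 (e.symm p.2))
  have hQ : ∀ y ∈ e.target, ContDiffAt ℝ ∞ Q (0, y) := fun y hy =>
    contDiffAt_isotopy_in_chart Φ.contMDiff_ψ Φ.ψ_zero he hy
  have hint : ∀ t, ∫ x in (S' t).plus, h x ∂(volumeMeasure μ) = ∫ y in A t, H y := by
    intro t
    rw [← integral_indicator (S' t).isOpen_plus.measurableSet,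
      integral_volumeMeasure_chart hμ he ((hh.integrable_of_hasCompactSupport
        hc).aestronglyMeasurable.indicator (S' t).isOpen_plus.measurableSet),
      ← integral_indicator e.open_target.measurableSet, ← integral_indicator (hAo t).measurableSet]
    · congr 1
      ext1 y
      by_cases hy : y ∈ e.target <;> by_cases hy' : e.symm y ∈ (S' t).plus <;>
        simp [A, H, hy, hy', indicator]
    · intro x hx
      have : h x = 0 := image_eq_zero_of_notMem_tsupport fun h' => hx (hs h')
      simp [indicator, this]
  simp_rw [hint]
  obtain ⟨K, hK⟩ := exists_lipschitz_in_time (f := fun t x => e (Φ.ψ t x) 0) hc.isCompact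
    fun x hx => by
      have h1 : ContMDiffAt (𝓘(ℝ, ℝ).prod (𝓡 (d + 1))) (𝓡 (d + 1)) ∞
          (fun p : ℝ × M => e (Φ.ψ p.1 p.2)) (0, x) := by
        refine ContMDiffAt.comp (0, x) ?_ Φ.contMDiff_ψ.contMDiffAt
        simp only [Φ.ψ_zero]
        exact contMDiffAt_of_mem_maximalAtlas he (hs hx)
      have h2 : ContMDiff (𝓡 (d + 1)) 𝓘(ℝ, ℝ) ∞ fun y : Model d => y 0 :=
        (EuclideanSpace.proj (𝕜 := ℝ) (0 : Fin (d + 1))).contDiff.contMDiff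
      exact (h2.contMDiffAt.comp (0, x) h1).of_le (by simp)
  have hsrc : ∀ᶠ t in 𝓝 (0 : ℝ), ∀ x ∈ tsupport h, Φ.ψ t x ∈ e.source :=
    hc.isCompact.eventually_forall_of_forall_eventually fun x hx =>
      Φ.continuous_ψ.continuousAt.eventually (e.open_source.mem_nhds (by
        simpa only [Φ.ψ_zero] using hs hx))
  have hη : ∀ᶠ t in 𝓝 (0 : ℝ), ∀ y ∈ tsupport H,
      (y ∈ A t ↔ η t y < 0) ∧ |η t y - y 0| ≤ K * |t| := by
    filter_upwards [hK, hsrc] with t h1 h2 y hy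
    obtain ⟨x, hx, rfl⟩ := hHs hy
    have hxe := hs hx
    have h3 := h1 x hx
    simp only [Φ.ψ_zero] at h3
    simp only [η, e.left_inv hxe]
    refine ⟨?_, h3⟩
    rw [← hslice _ (h2 x hx), ← (hS t).mem_plus_iff]
    simp [A, e.map_source hxe, e.left_inv hxe]
  have hUt : ∀ y : EuclideanSpace ℝ (Fin d), H (face y) ≠ 0 → face y ∈ e.target := fun y hy =>
    hHt (subset_tsupport _ hy)
  have hder : ∀ y ∈ e.target, ∀ r : ℝ, fderiv ℝ Q (0, y) (1, r • EuclideanSpace.single 0 (1 : ℝ)) =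
      r • EuclideanSpace.single 0 (1 : ℝ) - coordField e v y := fun y hy r => by
    have h1 : ((1 : ℝ), r • (EuclideanSpace.single 0 (1 : ℝ) : Model d)) =
        (1, 0) + (0, r • EuclideanSpace.single 0 (1 : ℝ)) := by simp
    rw [h1, map_add, hv.fderiv_ψ he hy, fderiv_isotopy_in_chart Φ.contMDiff_ψ Φ.ψ_zero he hy]
    abel
  -- The normal displacement is the zeroth coordinate of `v`. It enters with a minus sign through
  -- `ψ`, which matches the slope `r - b`.
  have hmain := hasDerivAt_setIntegral_moving hH hHc (fun t => (hAo t).measurableSet) hη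
    (b := fun y => coordField e v (face y) 0) ?_ ?_
  · convert hmain using 1
    have hm : MeasurableSet {y : EuclideanSpace ℝ (Fin d) | face y ∈ e.target} :=
      (e.open_target.preimage continuous_face).measurableSet
    rw [← integral_indicator hm]
    congr 1
    ext1 y
    by_cases hy : face y ∈ e.target
    · rw [indicator_of_mem (show y ∈ {y : EuclideanSpace ℝ (Fin d) | face y ∈ e.target} from hy),
        sign_mul_contract μ v he hy, hHdef, indicator_of_mem hy]
      ring
    · rw [indicator_of_notMem (show y ∉ {y : EuclideanSpace ℝ (Fin d) | face y ∈ e.target} from hy),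
        hHdef, indicator_of_notMem hy, zero_mul]
  -- No regularity of `v` is assumed; its continuity on the hyperplane is read off from the time
  -- derivative of the coordinate flow, which equals `-v`.
  · intro y hy
    have hyt := hUt y hy
    have h1 : ContinuousAt (fun y : EuclideanSpace ℝ (Fin d) =>
        -(fderiv ℝ Q (0, face y) (1, 0)) 0) y := by
      have h2 : ContinuousAt (fderiv ℝ Q) (0, face y) :=
        ((hQ _ hyt).fderiv_right (m := 0) (by simp)).continuousAt
      have h3 : ContinuousAt (fun y : EuclideanSpace ℝ (Fin d) => ((0 : ℝ), face y)) y :=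
        (continuous_const.prodMk continuous_face).continuousAt
      have h4 : ContinuousAt (fun y : EuclideanSpace ℝ (Fin d) => fderiv ℝ Q (0, face y)) y :=
        ContinuousAt.comp (g := fderiv ℝ Q) (f := fun y : EuclideanSpace ℝ (Fin d) =>
          ((0 : ℝ), face y)) h2 h3
      have h5 := h4.clm_apply (continuousAt_const (y := ((1 : ℝ), (0 : Model d))))
      exact ((EuclideanSpace.proj (𝕜 := ℝ) (0 : Fin (d + 1))).continuous.continuousAt.comp h5).neg
    refine (h1.congr ?_).continuousWithinAt
    filter_upwards [(e.open_target.preimage continuous_face).mem_nhds hyt] with z hz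
    have h6 : fderiv ℝ Q (0, face z) (1, 0) = -coordField e v (face z) := hv.fderiv_ψ he hz
    rw [h6]
    simp
  · intro y hy r
    have hyt := hUt y hy
    have h1 := ((hQ _ hyt).differentiableAt (by simp)).hasFDerivAt
    have h2 : HasDerivAt (fun t : ℝ => (t, consPoint (t * r) y))
        ((1 : ℝ), r • EuclideanSpace.single 0 (1 : ℝ)) 0 := by
      refine (hasDerivAt_id 0).prodMk ?_
      simp_rw [consPoint_eq_add]
      have h3 : HasDerivAt (fun t : ℝ => t * r) r 0 := by
        simpa using (hasDerivAt_id (0 : ℝ)).mul_const r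
      exact (h3.smul_const _).const_add _
    have h3 : ((0 : ℝ), face y) = (0, consPoint (0 * r) y) := by
      rw [zero_mul, consPoint_zero]
    have h4 : HasDerivAt (fun t : ℝ => Q (t, consPoint (t * r) y))
        (fderiv ℝ Q (0, face y) (1, r • EuclideanSpace.single 0 (1 : ℝ))) 0 := by
      rw [h3] at h1 ⊢
      exact HasFDerivAt.comp_hasDerivAt (l := Q) (f := fun t : ℝ => (t, consPoint (t * r) y))
        (0 : ℝ) h1 h2
    rw [hder _ hyt] at h4
    have h5 := (EuclideanSpace.proj (𝕜 := ℝ) (0 : Fin (d + 1))).hasFDerivAt.comp_hasDerivAt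
      (0 : ℝ) h4
    refine h5.congr_deriv ?_
    change (r • (EuclideanSpace.single 0 (1 : ℝ) : Model d) - coordField e v (face y)) 0 = _
    rw [PiLp.sub_apply, PiLp.smul_apply]
    simp

/-- Functions supported away from the moving hypersurface. -/
lemma hasDerivAt_setIntegral_plus_of_disjoint {μ : KForm d M (d + 1)}
    {Φ : SmoothFlow d M} {S : Hypersurface d M}
    {S' : ℝ → Hypersurface d M} (hS : ∀ t, MapsHypersurface (Φ.φ t) S (S' t))
    {h : M → ℝ} (hc : HasCompactSupport h) (hs : tsupport h ⊆ S.carrierᶜ) :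
    HasDerivAt (fun t => ∫ x in (S' t).plus, h x ∂(volumeMeasure μ)) 0 0 := by
  have h1 : ∀ᶠ t in 𝓝 (0 : ℝ), ∀ x ∈ tsupport h, (x ∈ (S' t).plus ↔ x ∈ S.plus) := by
    refine hc.isCompact.eventually_forall_of_forall_eventually fun x hx => ?_
    have h2 : x ∈ S.plus ∪ S.minus := by
      have := hs hx
      rwa [S.carrier_eq, compl_compl] at this
    have h3 : ∀ U : Set M, IsOpen U → x ∈ U → ∀ᶠ z : ℝ × M in 𝓝 (0, x),
        Φ.ψ z.1 z.2 ∈ U ∧ z.2 ∈ U := fun U hU hxU =>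
      (Φ.continuous_ψ.continuousAt.eventually (hU.mem_nhds (by
        simpa only [Φ.ψ_zero] using hxU))).and
        (continuous_snd.continuousAt.eventually (hU.mem_nhds hxU))
    rcases h2 with h2 | h2
    · filter_upwards [h3 _ S.isOpen_plus h2] with z hz
      simp [(hS z.1).mem_plus_iff, hz.1, hz.2]
    · filter_upwards [h3 _ S.isOpen_minus h2] with z hz
      have h4 := disjoint_right.1 S.disjoint_plus_minus
      simp [(hS z.1).mem_plus_iff, h4 hz.1, h4 hz.2]
  refine (hasDerivAt_const (0 : ℝ) (∫ x in S.plus, h x ∂(volumeMeasure μ))).congr_of_eventuallyEq ?_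
  filter_upwards [h1] with t ht
  rw [← integral_indicator (S' t).isOpen_plus.measurableSet,
    ← integral_indicator S.isOpen_plus.measurableSet]
  congr 1
  ext1 x
  by_cases hx : x ∈ tsupport h
  · by_cases h2 : x ∈ S.plus
    · rw [indicator_of_mem h2, indicator_of_mem ((ht x hx).2 h2)]
    · rw [indicator_of_notMem h2, indicator_of_notMem fun h3 => h2 ((ht x hx).1 h3)]
  · simp [indicator, image_eq_zero_of_notMem_tsupport hx]

lemma tsupport_mul_subset_inter {f g : M → ℝ} : tsupport (fun x => f x * g x) ⊆
    tsupport f ∩ tsupport g :=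
  subset_inter (tsupport_mul_subset_left (f := f) (g := g))
    (tsupport_mul_subset_right (f := f) (g := g))

lemma hasDerivAt_setIntegral_sum {μ : KForm d M (d + 1)} (hμ : IsSmoothTopForm μ) {ι : Type*}
    {S' : ℝ → Hypersurface d M} {I : Finset ι} {f : ι → M → ℝ} {c : ι → ℝ} {h : M → ℝ}
    (hh : ∀ x, h x = ∑ i ∈ I, f i x) (hf : ∀ i ∈ I, Continuous (f i))
    (hc : ∀ i ∈ I, HasCompactSupport (f i))
    (hd : ∀ i ∈ I, HasDerivAt (fun t => ∫ x in (S' t).plus, f i x ∂(volumeMeasure μ)) (c i) 0) :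
    HasDerivAt (fun t => ∫ x in (S' t).plus, h x ∂(volumeMeasure μ)) (∑ i ∈ I, c i) 0 := by
  have := isLocallyFiniteMeasure_volumeMeasure hμ
  have h1 : (fun t => ∫ x in (S' t).plus, h x ∂(volumeMeasure μ)) =
      fun t => ∑ i ∈ I, ∫ x in (S' t).plus, f i x ∂(volumeMeasure μ) := by
    ext1 t
    simp_rw [hh]
    exact integral_finsetSum _ fun i hi =>
      ((hf i hi).integrable_of_hasCompactSupport (hc i hi)).integrableOn
  rw [h1]
  exact HasDerivAt.fun_sum hd

/-- Functions that vanish on the moving hypersurface do not contribute to first order. -/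
lemma hasDerivAt_setIntegral_plus_of_eq_zero {μ : KForm d M (d + 1)} (hμ : IsSmoothTopForm μ)
    {Φ : SmoothFlow d M} {v : VField d M} (hv : Φ.HasVelocity 0 v) {S : Hypersurface d M}
    {S' : ℝ → Hypersurface d M} (hS : ∀ t, MapsHypersurface (Φ.φ t) S (S' t))
    {h : M → ℝ} (hh : Continuous h) (hc : HasCompactSupport h) (h0 : ∀ x ∈ S.carrier, h x = 0) :
    HasDerivAt (fun t => ∫ x in (S' t).plus, h x ∂(volumeMeasure μ)) 0 0 := by
  -- `M` is covered by the complement of `Γ` (index `none`) and the slice charts. Pieces of the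
  -- first kind are eventually constant in `t`; for the others the boundary integrand contains the
  -- value of `h` on `Γ`, which is zero.
  let U : Option S.carrier → Set M := fun o => o.elim S.carrierᶜ fun p => (S.slice p).source
  obtain ⟨q, hq⟩ := SmoothPartitionOfUnity.exists_isSubordinate (𝓡 (d + 1)) isClosed_univ U
    (by
      rintro (_ | p)
      · exact S.isClosed_carrier.isOpen_compl
      · exact (S.slice p).open_source)
    (fun x _ => by
      by_cases hx : x ∈ S.carrier
      · exact mem_iUnion_of_mem (some ⟨x, hx⟩) (S.mem_slice_source ⟨x, hx⟩)
      · exact mem_iUnion_of_mem none hx)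
  have hfin := q.locallyFinite.finite_nonempty_inter_compact hc.isCompact
  have hsum : ∀ x, h x = ∑ i ∈ hfin.toFinset, q i x * h x := fun x => by
    by_cases hx : h x = 0
    · simp [hx]
    · rw [← Finset.sum_mul, ← finsum_eq_sum_of_support_subset, q.sum_eq_one (mem_univ x), one_mul]
      intro i hi
      simp only [Finite.coe_toFinset]
      exact ⟨x, hi, subset_tsupport _ hx⟩
  have hqc : ∀ i, Continuous fun x => q i x * h x := fun i => (q i).contMDiff.continuous.mul hh
  have hqs : ∀ i, HasCompactSupport fun x => q i x * h x := fun i => hc.mul_left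
  suffices hd : ∀ i, HasDerivAt (fun t => ∫ x in (S' t).plus, q i x * h x ∂(volumeMeasure μ)) 0 0 by
    simpa using hasDerivAt_setIntegral_sum hμ (S' := S') (c := fun _ => 0) hsum (fun i _ => hqc i)
      (fun i _ => hqs i) fun i _ => hd i
  intro i
  have hsub : tsupport (fun x => q i x * h x) ⊆ U i :=
    fun x hx => hq i (tsupport_mul_subset_inter hx).1
  rcases i with _ | p
  · exact hasDerivAt_setIntegral_plus_of_disjoint hS (hqs none) hsub
  · have he := (S.exists_slice p p.2).choose_spec.1
    have hsl := (S.exists_slice p p.2).choose_spec.2.2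
    have h2 := hasDerivAt_setIntegral_plus_slice hμ hv hS he (fun x hx => (hsl x hx).1)
      (hqc (some p)) (hqs (some p)) hsub
    convert h2 using 1
    have hm : MeasurableSet {y : EuclideanSpace ℝ (Fin d) | face y ∈ (S.slice p).target} :=
      ((S.slice p).open_target.preimage continuous_face).measurableSet
    refine (setIntegral_eq_zero_of_forall_eq_zero fun y hy => ?_).symm
    have hy' : face y ∈ (S.slice p).target := hy
    have h3 : (S.slice p).symm (face y) ∈ S.carrier := by
      refine (hsl _ ((S.slice p).map_target hy')).2.1.2 ?_
      change (S.slice p) ((S.slice p).symm (face y)) 0 = 0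
      rw [(S.slice p).right_inv hy']
      rfl
    have h4 := h0 _ h3
    change q (some p) ((S.slice p).symm (face y)) * h ((S.slice p).symm (face y)) * _ = 0
    rw [h4, mul_zero, zero_mul]

/-- First variation of `∫_{D⁺} h μ`. -/
theorem hasDerivAt_setIntegral_plus {μ : KForm d M (d + 1)} (hμ : IsSmoothTopForm μ)
    {Φ : SmoothFlow d M} {v : VField d M} (hv : Φ.HasVelocity 0 v) {S : Hypersurface d M}
    {S' : ℝ → Hypersurface d M} (hS : ∀ t, MapsHypersurface (Φ.φ t) S (S' t))
    {h : M → ℝ} (hh : Continuous h) (hc : HasCompactSupport h) :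
    HasDerivAt (fun t => ∫ x in (S' t).plus, h x ∂(volumeMeasure μ))
      (surfaceIntegral μ S fun x => h x • contract v μ x) 0 := by
  have := isLocallyFiniteMeasure_volumeMeasure hμ
  set ρ := S.partition with hρdef
  have hρ : ρ.IsSubordinate fun p => (S.slice p).source := S.exists_partition.choose_spec
  -- Only finitely many functions of the partition meet the support of `h`, so the `finsum` in
  -- `surfaceIntegral` is a finite sum.
  have hfin := ρ.locallyFinite.finite_nonempty_inter_compact hc.isCompact
  set I := hfin.toFinset with hI
  have hIc : ∀ p ∉ I, ∀ x, ρ p x * h x = 0 := fun p hp x => by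
    by_contra h1
    refine hp ?_
    rw [hI, Finite.mem_toFinset]
    exact ⟨x, left_ne_zero_of_mul h1, subset_tsupport _ (right_ne_zero_of_mul h1)⟩
  have hρc : ∀ p, Continuous fun x => ρ p x * h x := fun p => (ρ p).contMDiff.continuous.mul hh
  have hρs : ∀ p, HasCompactSupport fun x => ρ p x * h x := fun p => hc.mul_left
  let c : S.carrier → ℝ := fun p =>
    ∫ y in {y : EuclideanSpace ℝ (Fin d) | face y ∈ (S.slice p).target},
    S.partition p ((S.slice p).symm (face y)) *
      (Real.sign (chartCoeff μ (S.slice p) (face y)) *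
        ((h ((S.slice p).symm (face y)) • contract v μ ((S.slice p).symm (face y))) fun i =>
          mfderiv (𝓡 (d + 1)) (𝓡 (d + 1)) (S.slice p).symm (face y)
            (EuclideanSpace.single i.succ (1 : ℝ) : Model d)))
  have hcI : ∀ p ∉ I, c p = 0 := fun p hp => by
    refine setIntegral_eq_zero_of_forall_eq_zero fun y _ => ?_
    rw [AlternatingMap.smul_apply, smul_eq_mul]
    have h1 := hIc p hp ((S.slice p).symm (face y))
    linear_combination (Real.sign (chartCoeff μ (S.slice p) (face y)) *
        (contract v μ ((S.slice p).symm (face y)) fun i =>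
          mfderiv (𝓡 (d + 1)) (𝓡 (d + 1)) (S.slice p).symm (face y)
            (EuclideanSpace.single i.succ (1 : ℝ) : Model d))) * h1
  have hsurf : surfaceIntegral μ S (fun x => h x • contract v μ x) = ∑ p ∈ I, c p :=
    finsum_eq_sum_of_support_subset _ fun p hp => by
      by_contra h1
      exact hp (hcI p h1)
  have hd : ∀ p, HasDerivAt (fun t => ∫ x in (S' t).plus, ρ p x * h x ∂(volumeMeasure μ))
      (c p) 0 := fun p => by
    have he := (S.exists_slice p p.2).choose_spec.1
    have hsl := (S.exists_slice p p.2).choose_spec.2.2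
    convert hasDerivAt_setIntegral_plus_slice hμ hv hS he (fun x hx => (hsl x hx).1)
      (hρc p) (hρs p) (fun x hx => hρ p (tsupport_mul_subset_inter hx).1) using 1
    refine integral_congr_ae (Filter.Eventually.of_forall fun y => ?_)
    simp only [AlternatingMap.smul_apply, smul_eq_mul]
    change _ = S.partition p ((S.slice p).symm (face y)) * h ((S.slice p).symm (face y)) *
      (Real.sign (chartCoeff μ (S.slice p) (face y)) *
        (contract v μ ((S.slice p).symm (face y)) fun i =>
          mfderiv (𝓡 (d + 1)) (𝓡 (d + 1)) (S.slice p).symm (face y)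
            (EuclideanSpace.single i.succ (1 : ℝ) : Model d)))
    ring
  have hsumd := hasDerivAt_setIntegral_sum hμ (S' := S') (I := I) (fun x => rfl)
    (fun p _ => hρc p) (fun p _ => hρs p) (fun p _ => hd p)
  -- The functions `ρ p` sum to one on `Γ` but perhaps nowhere else. The remainder vanishes on `Γ`
  -- and therefore has derivative zero.
  let r : M → ℝ := fun x => h x - ∑ p ∈ I, ρ p x * h x
  have hr : Continuous r := hh.sub (continuous_finsetSum _ fun p _ => hρc p)
  have hrs : HasCompactSupport r := by
    refine HasCompactSupport.intro hc.isCompact fun x hx => ?_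
    simp [r, image_eq_zero_of_notMem_tsupport hx]
  have hr0 : ∀ x ∈ S.carrier, r x = 0 := fun x hx => by
    by_cases h1 : h x = 0
    · simp [r, h1]
    · have h2 : ∑ p ∈ I, ρ p x = 1 := by
        rw [← ρ.sum_eq_one hx]
        refine (finsum_eq_sum_of_support_subset _ fun p hp => ?_).symm
        by_contra h2
        exact (mul_ne_zero hp h1) (hIc p h2 x)
      simp [r, ← Finset.sum_mul, h2]
  have hrd := hasDerivAt_setIntegral_plus_of_eq_zero hμ hv hS hr hrs hr0
  have hadd := hsumd.add hrd
  rw [hsurf]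
  rw [add_zero] at hadd
  refine hadd.congr_of_eventuallyEq (Filter.Eventually.of_forall fun t => ?_)
  have hs1 : IntegrableOn (fun x => ∑ p ∈ I, ρ p x * h x) (S' t).plus (volumeMeasure μ) :=
    (integrable_finsetSum _ fun p _ =>
      (hρc p).integrable_of_hasCompactSupport (hρs p)).integrableOn
  have hs2 : IntegrableOn r (S' t).plus (volumeMeasure μ) :=
    (hr.integrable_of_hasCompactSupport hrs).integrableOn
  simp only [Pi.add_apply]
  rw [← integral_add hs1 hs2]
  simp [r]

/-- Since `Γ` is null, the two sides carry the whole integral. The total does not depend on the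
hypersurface, so the derivative over `D⁻` is minus the one over `D⁺`. -/
lemma setIntegral_minus_eq {μ : KForm d M (d + 1)} (hμ : IsSmoothTopForm μ)
    (S : Hypersurface d M) {h : M → ℝ} (hh : Continuous h) (hc : HasCompactSupport h) :
    ∫ x in S.minus, h x ∂(volumeMeasure μ) =
      ∫ x, h x ∂(volumeMeasure μ) - ∫ x in S.plus, h x ∂(volumeMeasure μ) := by
  have := isLocallyFiniteMeasure_volumeMeasure hμ
  have hi := hh.integrable_of_hasCompactSupport (μ := volumeMeasure μ) hc
  have h1 := setIntegral_union S.disjoint_plus_minus S.isOpen_minus.measurableSet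
    hi.integrableOn hi.integrableOn (μ := volumeMeasure μ)
  have h2 : ∫ x in S.plus ∪ S.minus, h x ∂(volumeMeasure μ) = ∫ x, h x ∂(volumeMeasure μ) := by
    rw [Measure.restrict_eq_self_of_ae_mem]
    rw [ae_iff]
    have := volumeMeasure_carrier hμ S
    rw [S.carrier_eq] at this
    exact this
  rw [← h2, h1]
  ring

/-- First variation of `∫_{D⁻} h μ`. -/
theorem hasDerivAt_setIntegral_minus {μ : KForm d M (d + 1)} (hμ : IsSmoothTopForm μ)
    {Φ : SmoothFlow d M} {v : VField d M} (hv : Φ.HasVelocity 0 v) {S : Hypersurface d M}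
    {S' : ℝ → Hypersurface d M} (hS : ∀ t, MapsHypersurface (Φ.φ t) S (S' t))
    {h : M → ℝ} (hh : Continuous h) (hc : HasCompactSupport h) :
    HasDerivAt (fun t => ∫ x in (S' t).minus, h x ∂(volumeMeasure μ))
      (-surfaceIntegral μ S fun x => h x • contract v μ x) 0 := by
  simp_rw [setIntegral_minus_eq hμ _ hh hc]
  exact (hasDerivAt_setIntegral_plus hμ hv hS hh hc).const_sub _

end Reynolds

/-! ### Transport theorem for integrands that depend on time. -/

section TimeDependentReynolds

variable {d : ℕ} {M : Type*} [TopologicalSpace M] [ChartedSpace (Model d) M]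
  [IsManifold (𝓡 (d + 1)) ∞ M]
  [T2Space M] [SigmaCompactSpace M] [MeasurableSpace M] [BorelSpace M]

/-- Differentiation under the integral sign over a varying region. -/
lemma hasDerivAt_setIntegral_sub {μ : KForm d M (d + 1)} (hμ : IsSmoothTopForm μ)
    {R : ℝ → Set M} {R₀ : Set M} (hR : ∀ t, MeasurableSet (R t)) (hR₀ : MeasurableSet R₀)
    (hRR : ∀ᵐ x ∂(volumeMeasure μ), ∀ᶠ t in 𝓝 (0 : ℝ), (x ∈ R t ↔ x ∈ R₀))
    {g : ℝ → M → ℝ} {g' : M → ℝ}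
    (hg : ContMDiff (𝓘(ℝ, ℝ).prod (𝓡 (d + 1))) 𝓘(ℝ, ℝ) ∞ fun p : ℝ × M => g p.1 p.2)
    {K : Set M} (hK : IsCompact K) (hgK : ∀ t, |t| ≤ 1 → ∀ x ∉ K, g t x = 0)
    (hg' : ∀ x, HasDerivAt (fun t => g t x) (g' x) 0) :
    HasDerivAt (fun t => ∫ x in R t, (g t x - g 0 x) ∂(volumeMeasure μ))
      (∫ x in R₀, g' x ∂(volumeMeasure μ)) 0 := by
  have := isLocallyFiniteMeasure_volumeMeasure hμ
  obtain ⟨L, hL⟩ := exists_lipschitz_in_time (f := g) hK fun x _ =>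
    hg.contMDiffAt.of_le (by simp)
  have hgc : ∀ t, Continuous (g t) := fun t =>
    hg.continuous.comp (continuous_const.prodMk continuous_id)
  have hsmall : ∀ᶠ t in 𝓝 (0 : ℝ), |t| ≤ 1 :=
    (continuous_abs.tendsto' 0 0 abs_zero).eventually (eventually_le_nhds one_pos)
  rw [hasDerivAt_iff_tendsto_slope_zero]
  simp only [zero_add, sub_self, integral_zero, sub_zero]
  rw [← integral_indicator hR₀]
  have h1 : ∀ t : ℝ, t⁻¹ • ∫ x in R t, (g t x - g 0 x) ∂(volumeMeasure μ) =
      ∫ x, (R t).indicator (fun x => t⁻¹ * (g t x - g 0 x)) x ∂(volumeMeasure μ) := fun t => by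
    rw [integral_indicator (hR t), integral_const_mul, smul_eq_mul]
  simp_rw [h1]
  -- The difference quotients are bounded by the Lipschitz constant on `K` and vanish elsewhere;
  -- almost every point eventually keeps its membership, so the indicator does not disturb the
  -- pointwise limit.
  refine tendsto_integral_filter_of_dominated_convergence (K.indicator fun _ => L)
    (Filter.Eventually.of_forall fun t => ?_) ?_ ?_ ?_
  · exact ((((hgc t).sub (hgc 0)).const_mul _).measurable.indicator (hR t)).aestronglyMeasurable
  · filter_upwards [self_mem_nhdsWithin, hL.filter_mono nhdsWithin_le_nhds,
      hsmall.filter_mono nhdsWithin_le_nhds] with t ht0 ht ht1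
    refine Filter.Eventually.of_forall fun x => ?_
    have ht0' : 0 < |t| := abs_pos.2 ht0
    by_cases hx : x ∈ K
    · rw [indicator_of_mem hx]
      refine (norm_indicator_le_norm_self _ _).trans ?_
      rw [norm_mul, norm_inv, Real.norm_eq_abs, Real.norm_eq_abs, inv_mul_le_iff₀ ht0', mul_comm]
      exact ht x hx
    · rw [indicator_of_notMem hx]
      have h2 : (R t).indicator (fun x => t⁻¹ * (g t x - g 0 x)) x = 0 := by
        simp [indicator, hgK t ht1 x hx, hgK 0 (by simp) x hx]
      rw [h2, norm_zero]
  · exact (integrable_indicator_iff hK.isClosed.measurableSet).2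
      (integrableOn_const hK.measure_lt_top.ne)
  · filter_upwards [hRR] with x hx
    by_cases hx0 : x ∈ R₀
    · rw [indicator_of_mem hx0]
      refine ((hg' x).tendsto_slope_zero).congr' ?_
      filter_upwards [hx.filter_mono nhdsWithin_le_nhds] with t ht
      rw [indicator_of_mem (ht.2 hx0), zero_add, smul_eq_mul]
    · rw [indicator_of_notMem hx0]
      refine tendsto_const_nhds.congr' ?_
      filter_upwards [hx.filter_mono nhdsWithin_le_nhds] with t ht
      rw [indicator_of_notMem fun h => hx0 (ht.1 h)]

/-- A point off `Γ` lies in one of the two open sides, and `ψ_t` keeps it there for small `t`. -/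
lemma eventually_mem_moving_iff {Φ : SmoothFlow d M} {S : Hypersurface d M}
    {S' : ℝ → Hypersurface d M} (hS : ∀ t, MapsHypersurface (Φ.φ t) S (S' t)) {x : M}
    (hx : x ∉ S.carrier) :
    ∀ᶠ t in 𝓝 (0 : ℝ), (x ∈ (S' t).plus ↔ x ∈ S.plus) ∧ (x ∈ (S' t).minus ↔ x ∈ S.minus) := by
  have h2 : x ∈ S.plus ∪ S.minus := by
    rwa [S.carrier_eq, notMem_compl_iff] at hx
  have hc : Continuous fun t => Φ.ψ t x :=
    Φ.continuous_ψ.comp (continuous_id.prodMk continuous_const)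
  have h3 : ∀ U : Set M, IsOpen U → x ∈ U → ∀ᶠ t in 𝓝 (0 : ℝ), Φ.ψ t x ∈ U := fun U hU hxU =>
    hc.continuousAt.eventually (hU.mem_nhds (by simpa only [Φ.ψ_zero] using hxU))
  have h4 := disjoint_right.1 S.disjoint_plus_minus
  have h5 := disjoint_left.1 S.disjoint_plus_minus
  rcases h2 with h2 | h2
  · filter_upwards [h3 _ S.isOpen_plus h2] with t ht
    simp [(hS t).mem_plus_iff, (hS t).mem_minus_iff, ht, h2, h5 ht, h5 h2]
  · filter_upwards [h3 _ S.isOpen_minus h2] with t ht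
    simp [(hS t).mem_plus_iff, (hS t).mem_minus_iff, ht, h2, h4 ht, h4 h2]

lemma ae_notMem_carrier {μ : KForm d M (d + 1)} (hμ : IsSmoothTopForm μ) (S : Hypersurface d M) :
    ∀ᵐ x ∂(volumeMeasure μ), x ∉ S.carrier := by
  rw [ae_iff]
  simpa using volumeMeasure_carrier hμ S

/-- Write `g t = (g t - g 0) + g 0`: the first summand sees only the change of the integrand, the
second only the motion of the region. -/
lemma hasDerivAt_setIntegral_of_fixed {μ : KForm d M (d + 1)} (hμ : IsSmoothTopForm μ)
    {R : ℝ → Set M} {R₀ : Set M} (hR : ∀ t, MeasurableSet (R t)) (hR₀ : MeasurableSet R₀)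
    (hRR : ∀ᵐ x ∂(volumeMeasure μ), ∀ᶠ t in 𝓝 (0 : ℝ), (x ∈ R t ↔ x ∈ R₀))
    {g : ℝ → M → ℝ} {g' : M → ℝ}
    (hg : ContMDiff (𝓘(ℝ, ℝ).prod (𝓡 (d + 1))) 𝓘(ℝ, ℝ) ∞ fun p : ℝ × M => g p.1 p.2)
    {K : Set M} (hK : IsCompact K) (hgK : ∀ t, |t| ≤ 1 → ∀ x ∉ K, g t x = 0)
    (hg' : ∀ x, HasDerivAt (fun t => g t x) (g' x) 0) {c : ℝ}
    (hc : HasDerivAt (fun t => ∫ x in R t, g 0 x ∂(volumeMeasure μ)) c 0) :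
    HasDerivAt (fun t => ∫ x in R t, g t x ∂(volumeMeasure μ))
      (∫ x in R₀, g' x ∂(volumeMeasure μ) + c) 0 := by
  have := isLocallyFiniteMeasure_volumeMeasure hμ
  have hgc : ∀ t, Continuous (g t) := fun t =>
    hg.continuous.comp (continuous_const.prodMk continuous_id)
  have hgi : ∀ t, |t| ≤ 1 → Integrable (g t) (volumeMeasure μ) := fun t ht =>
    (hgc t).integrable_of_hasCompactSupport (HasCompactSupport.intro hK (hgK t ht))
  refine ((hasDerivAt_setIntegral_sub hμ hR hR₀ hRR hg hK hgK hg').add hc).congr_of_eventuallyEq ?_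
  have hsmall : ∀ᶠ t in 𝓝 (0 : ℝ), |t| ≤ 1 :=
    (continuous_abs.tendsto' 0 0 abs_zero).eventually (eventually_le_nhds one_pos)
  filter_upwards [hsmall] with t ht
  simp only [Pi.add_apply]
  rw [integral_sub (hgi t ht).integrableOn (hgi 0 (by simp)).integrableOn]
  ring

/-- The transport theorem for the region `D⁺`. -/
theorem hasDerivAt_setIntegral_plus_family {μ : KForm d M (d + 1)} (hμ : IsSmoothTopForm μ)
    {Φ : SmoothFlow d M} {v : VField d M} (hv : Φ.HasVelocity 0 v) {S : Hypersurface d M}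
    {S' : ℝ → Hypersurface d M} (hS : ∀ t, MapsHypersurface (Φ.φ t) S (S' t))
    {g : ℝ → M → ℝ} {g' : M → ℝ}
    (hg : ContMDiff (𝓘(ℝ, ℝ).prod (𝓡 (d + 1))) 𝓘(ℝ, ℝ) ∞ fun p : ℝ × M => g p.1 p.2)
    {K : Set M} (hK : IsCompact K) (hgK : ∀ t, |t| ≤ 1 → ∀ x ∉ K, g t x = 0)
    (hg' : ∀ x, HasDerivAt (fun t => g t x) (g' x) 0) :
    HasDerivAt (fun t => ∫ x in (S' t).plus, g t x ∂(volumeMeasure μ))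
      (∫ x in S.plus, g' x ∂(volumeMeasure μ) +
        surfaceIntegral μ S fun x => g 0 x • contract v μ x) 0 :=
  hasDerivAt_setIntegral_of_fixed hμ (fun t => (S' t).isOpen_plus.measurableSet)
    S.isOpen_plus.measurableSet ((ae_notMem_carrier hμ S).mono fun _ hx =>
      (eventually_mem_moving_iff hS hx).mono fun _ h => h.1) hg hK hgK hg'
    (hasDerivAt_setIntegral_plus hμ hv hS (hg.continuous.comp (continuous_const.prodMk continuous_id))
      (HasCompactSupport.intro hK (hgK 0 (by simp))))

/-- The transport theorem for the region `D⁻`. -/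
theorem hasDerivAt_setIntegral_minus_family {μ : KForm d M (d + 1)} (hμ : IsSmoothTopForm μ)
    {Φ : SmoothFlow d M} {v : VField d M} (hv : Φ.HasVelocity 0 v) {S : Hypersurface d M}
    {S' : ℝ → Hypersurface d M} (hS : ∀ t, MapsHypersurface (Φ.φ t) S (S' t))
    {g : ℝ → M → ℝ} {g' : M → ℝ}
    (hg : ContMDiff (𝓘(ℝ, ℝ).prod (𝓡 (d + 1))) 𝓘(ℝ, ℝ) ∞ fun p : ℝ × M => g p.1 p.2)
    {K : Set M} (hK : IsCompact K) (hgK : ∀ t, |t| ≤ 1 → ∀ x ∉ K, g t x = 0)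
    (hg' : ∀ x, HasDerivAt (fun t => g t x) (g' x) 0) :
    HasDerivAt (fun t => ∫ x in (S' t).minus, g t x ∂(volumeMeasure μ))
      (∫ x in S.minus, g' x ∂(volumeMeasure μ) +
        -surfaceIntegral μ S fun x => g 0 x • contract v μ x) 0 :=
  hasDerivAt_setIntegral_of_fixed hμ (fun t => (S' t).isOpen_minus.measurableSet)
    S.isOpen_minus.measurableSet ((ae_notMem_carrier hμ S).mono fun _ hx =>
      (eventually_mem_moving_iff hS hx).mono fun _ h => h.2) hg hK hgK hg'
    (hasDerivAt_setIntegral_minus hμ hv hS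
      (hg.continuous.comp (continuous_const.prodMk continuous_id))
      (HasCompactSupport.intro hK (hgK 0 (by simp))))

end TimeDependentReynolds

/-! ### Time derivatives of smooth families of sections. -/

section TimeDerivative

/-- The fibres of the bundle are topological vector spaces without a norm, hence the argument by
`isLittleOTVS`. -/
lemma _root_.ContinuousLinearMap.hasDerivAt_comp {E F : Type*} [AddCommGroup E] [Module ℝ E]
    [TopologicalSpace E] [ContinuousSMul ℝ E] [AddCommGroup F] [Module ℝ F] [TopologicalSpace F]
    [ContinuousSMul ℝ F] (L : E →L[ℝ] F) {f : ℝ → E} {f' : E} {t : ℝ}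
    (hf : HasDerivAt f f' t) : HasDerivAt (fun s => L (f s)) (L f') t := by
  refine HasFDerivAtFilter.of_isLittleOTVS ?_
  have h := (L.isBigOTVS_comp (f := fun p : ℝ × ℝ => f p.1 - f p.2 -
    ContinuousLinearMap.toSpanSingleton ℝ f' (p.1 - p.2))
    (l := 𝓝 t ×ˢ pure t)).trans_isLittleOTVS hf.isLittleOTVS
  refine h.congr_left fun p => ?_
  simp

variable {d : ℕ} {M : Type*} [TopologicalSpace M] [ChartedSpace (Model d) M]
  {F : Type*} [NormedAddCommGroup F] [NormedSpace ℝ F]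
  {E : M → Type*} [TopologicalSpace (Bundle.TotalSpace F E)] [∀ x, AddCommGroup (E x)]
  [∀ x, Module ℝ (E x)] [∀ x, TopologicalSpace (E x)] [∀ x, ContinuousSMul ℝ (E x)] [FiberBundle F E] [VectorBundle ℝ F E]
  [IsManifold (𝓡 (d + 1)) ∞ M] [ContMDiffVectorBundle ∞ F E (𝓡 (d + 1))]

lemma contMDiff_deriv_of_contMDiff_prod {G : Type*} [NormedAddCommGroup G] [NormedSpace ℝ G]
    {σ : ℝ → M → G} {x₀ : M}
    (hσ : ContMDiffAt (𝓘(ℝ, ℝ).prod (𝓡 (d + 1))) 𝓘(ℝ, G) ∞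
      (fun p : ℝ × M => σ p.1 p.2) (0, x₀)) :
    ContMDiffAt (𝓡 (d + 1)) 𝓘(ℝ, G) ∞ (fun x => deriv (fun t => σ t x) 0) x₀ := by
  have h1 : ContMDiffAt ((𝓡 (d + 1)).prod 𝓘(ℝ, ℝ)) 𝓘(ℝ, G) ∞
      (Function.uncurry fun (x : M) (t : ℝ) => σ t x) (x₀, 0) :=
    ContMDiffAt.comp (x₀, (0 : ℝ)) (g := fun p : ℝ × M => σ p.1 p.2) hσ
      (contMDiffAt_snd.prodMk contMDiffAt_fst)
  have h2 := ContMDiffAt.mfderiv (m := ∞) (fun (x : M) (t : ℝ) => σ t x) (fun _ => (0 : ℝ)) h1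
    contMDiffAt_const (by simp)
  have h2 : ContMDiffAt (𝓡 (d + 1)) 𝓘(ℝ, ℝ →L[ℝ] G) ∞
      (fun x => fderiv ℝ (fun t => σ t x) 0) x₀ := by
    refine h2.congr_of_eventuallyEq (Filter.Eventually.of_forall fun x => ?_)
    have h4 := inTangentCoordinates_model_space (I := 𝓘(ℝ, ℝ)) (I' := 𝓘(ℝ, G))
      (fun _ : M => (0 : ℝ)) (fun x => σ 0 x) (fun x => fderiv ℝ (fun t => σ t x) 0) x₀
    refine (congrFun h4 x).symm.trans ?_
    simp only [mfderiv_eq_fderiv]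
  have h3 := h2.clm_apply (contMDiffAt_const (c := (1 : ℝ)))
  refine h3.congr_of_eventuallyEq (Filter.Eventually.of_forall fun x => ?_)
  rfl

/-- The time derivative of a smooth family of sections of a vector bundle is a smooth section. -/
lemma exists_contMDiff_hasDerivAt {s : ℝ → ∀ x, E x}
    (hs : ContMDiff (𝓘(ℝ, ℝ).prod (𝓡 (d + 1))) ((𝓡 (d + 1)).prod 𝓘(ℝ, F)) ∞
      fun p : ℝ × M => Bundle.TotalSpace.mk' F p.2 (s p.1 p.2)) :
    ∃ s' : ∀ x, E x, (∀ x, HasDerivAt (fun t => s t x) (s' x) 0) ∧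
      ContMDiff (𝓡 (d + 1)) ((𝓡 (d + 1)).prod 𝓘(ℝ, F)) ∞
        fun x => Bundle.TotalSpace.mk' F x (s' x) := by
  let σ : M → ℝ → M → F := fun x₀ t x => (trivializationAt F E x₀ ⟨x, s t x⟩).2
  have hσ : ∀ x₀, ContMDiffAt (𝓘(ℝ, ℝ).prod (𝓡 (d + 1))) 𝓘(ℝ, F) ∞
      (fun p : ℝ × M => σ x₀ p.1 p.2) (0, x₀) := fun x₀ =>
    (Bundle.contMDiffAt_totalSpace.1 (hs (0, x₀))).2
  have hmem : ∀ x, x ∈ (trivializationAt F E x).baseSet := fun x =>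
    FiberBundle.mem_baseSet_trivializationAt' x
  have hd0 : ∀ x, HasDerivAt (fun t => σ x t x) (deriv (fun t => σ x t x) 0) 0 := fun x => by
    have h1 : ContMDiffAt 𝓘(ℝ, ℝ) 𝓘(ℝ, F) ∞ (fun t : ℝ => σ x t x) 0 :=
      ContMDiffAt.comp (0 : ℝ) (g := fun p : ℝ × M => σ x p.1 p.2) (hσ x)
        (contMDiffAt_id.prodMk contMDiffAt_const)
    exact (h1.contDiffAt.differentiableAt (by simp)).hasDerivAt
  -- The derivative at `x` is taken in the trivialization at `x` itself and carried back to the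
  -- fibre; its smoothness has to be checked in the trivialization at a fixed `x₀`.
  let s' : ∀ x, E x := fun x =>
    (trivializationAt F E x).symmL ℝ x (deriv (fun t => σ x t x) 0)
  have hs' : ∀ x, HasDerivAt (fun t => s t x) (s' x) 0 := fun x => by
    have h1 := ((trivializationAt F E x).symmL ℝ x).hasDerivAt_comp (hd0 x)
    have h2 : (fun t => (trivializationAt F E x).symmL ℝ x (σ x t x)) = fun t => s t x := by
      ext1 t
      have h3 := (trivializationAt F E x).continuousLinearMapAt_apply_of_mem (R := ℝ) (hmem x) (s t x)
      simp only [σ]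
      rw [← h3, Bundle.Trivialization.symmL_continuousLinearMapAt _ (hmem x)]
    rwa [h2] at h1
  refine ⟨s', hs', fun x₀ => Bundle.contMDiffAt_totalSpace.2 ⟨contMDiffAt_id, ?_⟩⟩
  refine (contMDiff_deriv_of_contMDiff_prod (hσ x₀)).congr_of_eventuallyEq ?_
  -- The trivialization at `x₀` is linear and continuous on each fibre over its base set, so it
  -- commutes with the time derivative.
  filter_upwards [(trivializationAt F E x₀).open_baseSet.mem_nhds (hmem x₀)] with x hx
  have h1 := ((trivializationAt F E x₀).continuousLinearMapAt ℝ x).hasDerivAt_comp (hs' x)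
  have h2 : ∀ z : E x, (trivializationAt F E x₀).continuousLinearMapAt ℝ x z =
      (trivializationAt F E x₀ ⟨x, z⟩).2 := fun z =>
    (trivializationAt F E x₀).continuousLinearMapAt_apply_of_mem (R := ℝ) hx z
  simp only [h2] at h1
  exact h1.deriv.symm

end TimeDerivative

/-! ### Dependence of surface integrals on the form and linearity in the coefficient. -/

section SurfaceIntegral

variable {d : ℕ} {M : Type*} [TopologicalSpace M] [ChartedSpace (Model d) M]
  [IsManifold (𝓡 (d + 1)) ∞ M]

/-- A function vanishing on `Γ` vanishes along the coordinate line in direction `∂_{i+1}`, because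
that line stays in `y₀ = 0`. -/
lemma isTangent_slice {S : Hypersurface d M} {e : OpenPartialHomeomorph M (Model d)}
    (he : e ∈ IsManifold.maximalAtlas (𝓡 (d + 1)) ∞ M)
    (hslice : ∀ x ∈ e.source, (x ∈ S.carrier ↔ e x 0 = 0)) {y : EuclideanSpace ℝ (Fin d)}
    (hy : face y ∈ e.target) (i : Fin d) :
    S.IsTangent (e.symm (face y)) (mfderiv (𝓡 (d + 1)) (𝓡 (d + 1)) e.symm (face y)
      (EuclideanSpace.single i.succ (1 : ℝ) : Model d)) := by
  intro h hh h0
  have h1 : HasMFDerivAt (𝓡 (d + 1)) 𝓘(ℝ, ℝ) (h ∘ e.symm) (face y)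
      ((mfderiv (𝓡 (d + 1)) 𝓘(ℝ, ℝ) h (e.symm (face y))).comp
        (mfderiv (𝓡 (d + 1)) (𝓡 (d + 1)) e.symm (face y))) :=
    (hh.mdifferentiableAt (by simp)).hasMFDerivAt.comp (face y)
      (mdifferentiableAt_chart_symm he hy).hasMFDerivAt
  have h2 := h1.hasFDerivAt
  let l : ℝ → Model d := fun t => face y + t • EuclideanSpace.single i.succ (1 : ℝ)
  have hl0 : l 0 = face y := by simp [l]
  have hl : HasDerivAt l (EuclideanSpace.single i.succ (1 : ℝ)) 0 := by
    have h1 := ((hasDerivAt_id (0 : ℝ)).smul_const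
      (EuclideanSpace.single i.succ (1 : ℝ) : Model d)).const_add (face y)
    rwa [one_smul] at h1
  have hlc : Filter.Tendsto l (𝓝 0) (𝓝 (face y)) := by
    simpa only [hl0] using hl.continuousAt.tendsto
  have h3 := HasFDerivAt.comp_hasDerivAt_of_eq (0 : ℝ) h2 hl hl0.symm
  have h4 : (h ∘ e.symm) ∘ l =ᶠ[𝓝 0] fun _ => 0 := by
    have h5 := (eventually_nhdsWithin_iff.1 h0)
    have h6 := (e.continuousAt_symm hy).tendsto.comp hlc
    filter_upwards [h6.eventually h5, hlc.eventually (e.open_target.mem_nhds hy)] with t ht ht'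
    refine ht ((hslice _ (e.map_target ht')).2 ?_)
    rw [e.right_inv ht']
    simp [l, ← consPoint_zero]
  exact ((hasDerivAt_const (0 : ℝ) (0 : ℝ)).congr_of_eventuallyEq h4).unique h3 |>.symm

variable [T2Space M] [SigmaCompactSpace M]

/-- The coordinate frames used in the integral consist of tangent vectors of `Γ`, so only the
restriction of the form enters. This allows the velocity of a flow to be replaced by any field with
the same flux form. -/
lemma surfaceIntegral_congr (μ : KForm d M (d + 1)) {S : Hypersurface d M} {α β : KForm d M d}
    (h : S.FormEqOn α β) : surfaceIntegral μ S α = surfaceIntegral μ S β := by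
  refine finsum_congr fun p => ?_
  have he := (S.exists_slice p p.2).choose_spec.1
  have hsl := (S.exists_slice p p.2).choose_spec.2.2
  have hm : MeasurableSet {y : EuclideanSpace ℝ (Fin d) | face y ∈ (S.slice p).target} :=
    ((S.slice p).open_target.preimage continuous_face).measurableSet
  refine setIntegral_congr_fun hm fun y hy => ?_
  have hy' : face y ∈ (S.slice p).target := hy
  have h3 : (S.slice p).symm (face y) ∈ S.carrier := by
    refine (hsl _ ((S.slice p).map_target hy')).2.1.2 ?_
    change (S.slice p) ((S.slice p).symm (face y)) 0 = 0
    rw [(S.slice p).right_inv hy']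
    rfl
  exact congrArg (fun r => S.partition p ((S.slice p).symm (face y)) *
    (Real.sign (chartCoeff μ (S.slice p) (face y)) * r))
    (h _ h3 _ fun i => isTangent_slice he (fun x hx => (hsl x hx).2.1) hy' i)

lemma surfaceIntegral_congr_smul (μ : KForm d M (d + 1)) {S : Hypersurface d M} {f g : M → ℝ}
    (α : KForm d M d) (h : ∀ x ∈ S.carrier, f x • α x = g x • α x) :
    surfaceIntegral μ S (fun x => f x • α x) = surfaceIntegral μ S (fun x => g x • α x) :=
  surfaceIntegral_congr μ fun x hx z _ => by rw [h x hx]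

lemma surfaceIntegral_smul_congr_form (μ : KForm d M (d + 1)) {S : Hypersurface d M} (f : M → ℝ)
    {α β : KForm d M d} (h : S.FormEqOn α β) :
    surfaceIntegral μ S (fun x => f x • α x) = surfaceIntegral μ S (fun x => f x • β x) :=
  surfaceIntegral_congr μ fun x hx z hz => by
    rw [AlternatingMap.smul_apply, AlternatingMap.smul_apply, h x hx z hz]

variable [MeasurableSpace M] [BorelSpace M]

/-- Both sides of the formula are first variations of volume integrals. -/
lemma surfaceIntegral_sub {μ : KForm d M (d + 1)} (hμ : IsSmoothTopForm μ)
    {Φ : SmoothFlow d M} {v : VField d M} (hv : Φ.HasVelocity 0 v) {S : Hypersurface d M}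
    {S' : ℝ → Hypersurface d M} (hS : ∀ t, MapsHypersurface (Φ.φ t) S (S' t))
    {f g : M → ℝ} (hf : Continuous f) (hfc : HasCompactSupport f)
    (hg : Continuous g) (hgc : HasCompactSupport g) :
    surfaceIntegral μ S (fun x => (f x - g x) • contract v μ x) =
      surfaceIntegral μ S (fun x => f x • contract v μ x) -
        surfaceIntegral μ S (fun x => g x • contract v μ x) := by
  have := isLocallyFiniteMeasure_volumeMeasure hμ
  have h1 := (hasDerivAt_setIntegral_plus hμ hv hS hf hfc).sub
    (hasDerivAt_setIntegral_plus hμ hv hS hg hgc)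
  refine (hasDerivAt_setIntegral_plus hμ hv hS (hf.sub hg) (hfc.sub hgc)).unique
    (h1.congr_of_eventuallyEq (Filter.Eventually.of_forall fun t => ?_))
  exact integral_sub (hf.integrable_of_hasCompactSupport hfc).integrableOn
    (hg.integrable_of_hasCompactSupport hgc).integrableOn

/-- Outside the support of the flow for `|t| ≤ 1` its orbits are constant near time zero. -/
lemma SmoothFlow.HasVelocity.exists_isCompact {Φ : SmoothFlow d M} {v : VField d M}
    (hv : Φ.HasVelocity 0 v) : ∃ K : Set M, IsCompact K ∧ ∀ x ∉ K, v x = 0 := by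
  obtain ⟨K, hK, hΦ⟩ := Φ.compact_support 1
  refine ⟨K, hK, fun x hx => ?_⟩
  have hsmall : ∀ᶠ t in 𝓝 (0 : ℝ), |t| ≤ 1 :=
    (continuous_abs.tendsto' 0 0 abs_zero).eventually (eventually_le_nhds one_pos)
  have h1 : HasMFDerivAt 𝓘(ℝ, ℝ) (𝓡 (d + 1)) (fun s => Φ.φ s x) 0
      (0 : ℝ →L[ℝ] TangentSpace (𝓡 (d + 1)) (Φ.φ 0 x)) := by
    have h3 : ∀ z : M, HasMFDerivAt 𝓘(ℝ, ℝ) (𝓡 (d + 1)) (fun _ : ℝ => z) 0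
      (0 : ℝ →L[ℝ] TangentSpace (𝓡 (d + 1)) z) := fun z => hasMFDerivAt_const z (0 : ℝ)
    exact (h3 (Φ.φ 0 x)).congr_of_eventuallyEq (hsmall.mono fun t ht => by
      simp only [hΦ t ht x hx, Φ.zero])
  have h2 := congrArg (fun T : ℝ →L[ℝ] Model d => T 1) (hasMFDerivAt_unique (hv x) h1)
  have h3 : v (Φ.φ 0 x) = 0 := by
    have h4 : ((1 : ℝ) • v (Φ.φ 0 x) : TangentSpace (𝓡 (d + 1)) (Φ.φ 0 x)) = 0 := h2
    rwa [one_smul] at h4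
  have h5 : ∀ z, z = x → v z = 0 → v x = 0 := by rintro _ rfl h; exact h
  exact h5 _ (Φ.zero x) h3

lemma exists_cutoff [LocallyCompactSpace M] {K : Set M} (hK : IsCompact K) :
    ∃ χ : M → ℝ, Continuous χ ∧ HasCompactSupport χ ∧ ∀ x ∈ K, χ x = 1 := by
  obtain ⟨f, h1, -, h2, -⟩ := exists_continuous_one_zero_of_isCompact hK isClosed_empty
    (disjoint_empty K)
  exact ⟨f, f.continuous, h2, fun x hx => h1 hx⟩

/-- `surfaceIntegral_sub` when only the second function has compact support. -/
lemma surfaceIntegral_sub' {μ : KForm d M (d + 1)} (hμ : IsSmoothTopForm μ)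
    {Φ : SmoothFlow d M} {v : VField d M} (hv : Φ.HasVelocity 0 v) {S : Hypersurface d M}
    {S' : ℝ → Hypersurface d M} (hS : ∀ t, MapsHypersurface (Φ.φ t) S (S' t))
    {f g : M → ℝ} (hf : Continuous f) (hg : Continuous g) (hgc : HasCompactSupport g) :
    surfaceIntegral μ S (fun x => (f x - g x) • contract v μ x) =
      surfaceIntegral μ S (fun x => f x • contract v μ x) -
        surfaceIntegral μ S (fun x => g x • contract v μ x) := by
  obtain ⟨K, hK, hvK⟩ := hv.exists_isCompact
  have : LocallyCompactSpace M := ChartedSpace.locallyCompactSpace (Model d) M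
  -- A cutoff equal to one on the support of `v` makes `f` compactly supported without changing
  -- either integral. It is needed because covectors `n` on `Γ` may have noncompact support.
  obtain ⟨χ, hχ, hχc, hχ1⟩ := exists_cutoff hK
  have h0 : ∀ x ∉ K, contract v μ x = 0 := fun x hx => by
    simp only [contract, hvK x hx, map_zero]
  have h1 : ∀ x, (χ x * f x) • contract v μ x = f x • contract v μ x := fun x => by
    by_cases hx : x ∈ K
    · rw [hχ1 x hx, one_mul]
    · rw [h0 x hx, smul_zero, smul_zero]
  have h2 : ∀ x, (χ x * f x - g x) • contract v μ x = (f x - g x) • contract v μ x := fun x => by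
    by_cases hx : x ∈ K
    · rw [hχ1 x hx, one_mul]
    · rw [h0 x hx, smul_zero, smul_zero]
  rw [← surfaceIntegral_congr_smul μ _ fun x _ => h1 x,
    ← surfaceIntegral_congr_smul μ _ fun x _ => h2 x]
  exact surfaceIntegral_sub hμ hv hS (hχ.mul hf) hχc.mul_right hg hgc

end SurfaceIntegral

/-! ### Smooth extensions of one-sided fields. -/

section RegularizedDerivative

variable {d : ℕ} {M : Type*} [TopologicalSpace M] [ChartedSpace (Model d) M]
  [IsManifold (𝓡 (d + 1)) ∞ M]

open Classical in
/-- The restriction of `V` to `D`, extended by zero. -/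
def restrictTo {T : M → Type*} [∀ x, Zero (T x)] (D : Set M) (V : ∀ x, T x) : ∀ x, T x :=
  fun x => if x ∈ D then V x else 0

lemma isRestriction_restrictTo {T : M → Type*} [∀ x, Zero (T x)] (D : Set M) (V : ∀ x, T x) :
    IsRestriction D V (restrictTo D V) :=
  ⟨fun _ hx => if_pos hx, fun _ hx => if_neg hx⟩

lemma SmoothVFamily.const {V : VField d M} (hV : ContMDiff (𝓡 (d + 1)) (𝓡 (d + 1)).tangent ∞
    (fun x : M => (⟨x, V x⟩ : TangentBundle (𝓡 (d + 1)) M))) : SmoothVFamily fun _ => V :=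
  hV.comp contMDiff_snd

lemma SmoothFormFamily.const {m : OneForm d M}
    (hm : ContMDiff (𝓡 (d + 1)) ((𝓡 (d + 1)).prod 𝓘(ℝ, Model d →L[ℝ] ℝ)) ∞
      (fun x : M => Bundle.TotalSpace.mk' (Model d →L[ℝ] ℝ)
        (E := fun x : M => TangentSpace (𝓡 (d + 1)) x →L[ℝ] Bundle.Trivial M ℝ x) x (m x))) :
    SmoothFormFamily fun _ => m :=
  hm.comp contMDiff_snd

lemma SmoothVFamily.apply {V : ℝ → VField d M} (hV : SmoothVFamily V) (t : ℝ) :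
    ContMDiff (𝓡 (d + 1)) (𝓡 (d + 1)).tangent ∞
      (fun x : M => (⟨x, V t x⟩ : TangentBundle (𝓡 (d + 1)) M)) :=
  ContMDiff.comp (g := fun p : ℝ × M => (⟨p.2, V p.1 p.2⟩ : TangentBundle (𝓡 (d + 1)) M)) hV
    (contMDiff_const.prodMk contMDiff_id)

lemma SmoothVFamily.exists_hasDerivAt {V : ℝ → VField d M} (hV : SmoothVFamily V)
    (hc : LocUnifCompactSupport V) :
    ∃ V' : VField d M, (∀ x, HasDerivAt (fun t => V t x) (V' x) 0) ∧
      SmoothVFamily (fun _ => V') ∧ LocUnifCompactSupport fun _ : ℝ => V' := by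
  obtain ⟨V', h1, h2⟩ := exists_contMDiff_hasDerivAt (E := fun x : M => TangentSpace (𝓡 (d + 1)) x)
    (F := Model d) (s := V) hV
  refine ⟨V', h1, SmoothVFamily.const h2, fun R => ?_⟩
  obtain ⟨K, hK, h3⟩ := hc 1
  refine ⟨K, hK, fun t _ x hx => ?_⟩
  have hsmall : ∀ᶠ t in 𝓝 (0 : ℝ), |t| ≤ 1 :=
    (continuous_abs.tendsto' 0 0 abs_zero).eventually (eventually_le_nhds one_pos)
  have h4 : (fun t => (V t x : Model d)) =ᶠ[𝓝 0] fun _ => (0 : Model d) :=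
    hsmall.mono fun s hs => h3 s hs x hx
  exact HasDerivAt.unique (F := Model d) (f := fun t => V t x) (h1 x) ((hasDerivAt_const (0 : ℝ) (0 : Model d)).congr_of_eventuallyEq h4)

lemma SmoothFormFamily.exists_hasDerivAt {V : ℝ → OneForm d M} (hV : SmoothFormFamily V)
    (hc : LocUnifCompactSupport V) :
    ∃ V' : OneForm d M, (∀ x, HasDerivAt (fun t => V t x) (V' x) 0) ∧
      SmoothFormFamily (fun _ => V') ∧ LocUnifCompactSupport fun _ : ℝ => V' := by
  obtain ⟨V', h1, h2⟩ := exists_contMDiff_hasDerivAt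
    (E := fun x : M => TangentSpace (𝓡 (d + 1)) x →L[ℝ] Bundle.Trivial M ℝ x)
    (F := Model d →L[ℝ] ℝ) (s := V) hV
  refine ⟨V', h1, SmoothFormFamily.const h2, fun R => ?_⟩
  obtain ⟨K, hK, h3⟩ := hc 1
  refine ⟨K, hK, fun t _ x hx => ?_⟩
  have hsmall : ∀ᶠ t in 𝓝 (0 : ℝ), |t| ≤ 1 :=
    (continuous_abs.tendsto' 0 0 abs_zero).eventually (eventually_le_nhds one_pos)
  have h4 : (fun t => (V t x : Model d →L[ℝ] ℝ)) =ᶠ[𝓝 0] fun _ => (0 : Model d →L[ℝ] ℝ) :=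
    hsmall.mono fun s hs => h3 s hs x hx
  exact HasDerivAt.unique (F := Model d →L[ℝ] ℝ) (f := fun t => V t x) (h1 x) ((hasDerivAt_const (0 : ℝ) (0 : Model d →L[ℝ] ℝ)).congr_of_eventuallyEq h4)

lemma SmoothFormFamily.contMDiff_apply {m : ℝ → OneForm d M} (hm : SmoothFormFamily m)
    {V : ℝ → VField d M} (hV : SmoothVFamily V) :
    ContMDiff (𝓘(ℝ, ℝ).prod (𝓡 (d + 1))) 𝓘(ℝ, ℝ) ∞ fun p : ℝ × M => m p.1 p.2 (V p.1 p.2) := by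
  intro p
  have h := ContMDiffAt.clm_bundle_apply (F₁ := Model d) (F₂ := ℝ)
    (E₁ := fun x : M => TangentSpace (𝓡 (d + 1)) x) (E₂ := Bundle.Trivial M ℝ)
    (b := fun p : ℝ × M => p.2) (ϕ := fun p => m p.1 p.2) (v := fun p => V p.1 p.2) (hm p) (hV p)
  exact (Bundle.contMDiffAt_totalSpace.1 h).2

end RegularizedDerivative

/-! ### Derivatives of the pairing and of its Legendre-type difference with `F`. -/

section PairingDerivative

variable {d : ℕ} {M : Type*} [TopologicalSpace M] [ChartedSpace (Model d) M]
  [IsManifold (𝓡 (d + 1)) ∞ M]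

lemma hasDerivAt_clm_apply_self {G : Type*} [NormedAddCommGroup G] [NormedSpace ℝ G]
    {c : ℝ → G →L[ℝ] ℝ} {u : ℝ → G} {c' : G →L[ℝ] ℝ} {u' : G} (hc : HasDerivAt c c' 0)
    (hu : HasDerivAt u u' 0) : HasDerivAt (fun t => c t (u t)) (c' (u 0) + c 0 u') 0 :=
  hc.clm_apply hu

lemma hasDerivAt_form_apply {m : ℝ → OneForm d M} {V : ℝ → VField d M} {m' : OneForm d M}
    {V' : VField d M} {x : M} (hm : HasDerivAt (fun t => m t x) (m' x) 0)
    (hV : HasDerivAt (fun t => V t x) (V' x) 0) :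
    HasDerivAt (fun t => m t x (V t x)) (m' x (V 0 x) + m 0 x (V' x)) 0 :=
  hasDerivAt_clm_apply_self (G := Model d) (c := fun t => m t x) (u := fun t => V t x) hm hV

lemma HasDerivAt.congr_eventually_field {V W : ℝ → VField d M} {V' : VField d M} {x : M}
    (h : HasDerivAt (fun t => V t x) (V' x) 0) (hVW : ∀ᶠ t in 𝓝 (0 : ℝ), W t x = V t x) :
    HasDerivAt (fun t => W t x) (V' x) 0 :=
  HasDerivAt.congr_of_eventuallyEq (F := Model d) h hVW

lemma HasDerivAt.congr_eventually_form {V W : ℝ → OneForm d M} {V' : OneForm d M} {x : M}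
    (h : HasDerivAt (fun t => V t x) (V' x) 0) (hVW : ∀ᶠ t in 𝓝 (0 : ℝ), W t x = V t x) :
    HasDerivAt (fun t => W t x) (V' x) 0 :=
  HasDerivAt.congr_of_eventuallyEq (F := Model d →L[ℝ] ℝ) h hVW

variable [T2Space M] [SigmaCompactSpace M] [MeasurableSpace M] [BorelSpace M]

lemma setIntegral_add_of_smooth {μ : KForm d M (d + 1)} (hμ : IsSmoothTopForm μ) {D : Set M}
    {f g : M → ℝ} (hf : Continuous f) (hfc : HasCompactSupport f) (hg : Continuous g)
    (hgc : HasCompactSupport g) :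
    ∫ x in D, (f x + g x) ∂(volumeMeasure μ) =
      ∫ x in D, f x ∂(volumeMeasure μ) + ∫ x in D, g x ∂(volumeMeasure μ) := by
  have := isLocallyFiniteMeasure_volumeMeasure hμ
  exact integral_add (hf.integrable_of_hasCompactSupport hfc).integrableOn
    (hg.integrable_of_hasCompactSupport hgc).integrableOn

lemma hasCompactSupport_form_apply {m : ℝ → OneForm d M} (hm : LocUnifCompactSupport m)
    (V : VField d M) (t : ℝ) : HasCompactSupport fun x => m t x (V x) := by
  obtain ⟨K, hK, h⟩ := hm |t|
  exact HasCompactSupport.intro hK fun x hx => by rw [h t le_rfl x hx]; rfl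

lemma SmoothFormFamily.continuous_apply {m : ℝ → OneForm d M} (hm : SmoothFormFamily m)
    {V : ℝ → VField d M} (hV : SmoothVFamily V) (t : ℝ) : Continuous fun x => m t x (V t x) :=
  (hm.contMDiff_apply hV).continuous.comp (continuous_const.prodMk continuous_id)

lemma SmoothVFamily.freeze {V : ℝ → VField d M} (hV : SmoothVFamily V) (t : ℝ) :
    SmoothVFamily fun _ => V t := SmoothVFamily.const (hV.apply t)

lemma SmoothFormFamily.freeze {m : ℝ → OneForm d M} (hm : SmoothFormFamily m) (t : ℝ) :
    SmoothFormFamily fun _ => m t :=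
  ContMDiff.comp (g := fun p : ℝ × M => Bundle.TotalSpace.mk' (Model d →L[ℝ] ℝ)
      (E := fun x : M => TangentSpace (𝓡 (d + 1)) x →L[ℝ] Bundle.Trivial M ℝ x)
      p.2 (m p.1 p.2)) hm (contMDiff_const.prodMk contMDiff_snd)

/-- The derivative of the pairing of two moving discontinuous fields. -/
theorem exists_hasDerivAt_pairing {μ : KForm d M (d + 1)} (hμ : IsSmoothTopForm μ)
    {Φ : SmoothFlow d M} {v : VField d M} (hv : Φ.HasVelocity 0 v)
    {S : ℝ → Hypersurface d M} (hS : ∀ t, MapsHypersurface (Φ.φ t) (S 0) (S t))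
    {m : ℝ → TwoSided (OneForm d M)} (hm : SmoothDFormFamily S m)
    {u : ℝ → TwoSided (VField d M)} (hu : SmoothDVFamily S u) :
    ∃ (m' : TwoSided (OneForm d M)) (u' : TwoSided (VField d M)) (j : M → ℝ),
      HasRegDerivForm S m m' 0 ∧ HasRegDerivV S u u' 0 ∧
      Continuous j ∧ HasCompactSupport j ∧
      (∀ x ∈ (S 0).carrier, jump (formApply (u 0) (m 0)) x = j x) ∧
      HasDerivAt (fun t => pairing μ (S t) (m t) (u t))
        (pairing μ (S 0) m' (u 0) + pairing μ (S 0) (m 0) u' +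
          surfaceIntegral μ (S 0) (fun x => j x • contract v μ x)) 0 := by
  obtain ⟨A, B, hA, hB, hAc, hBc, hAB⟩ := hm
  obtain ⟨V, W, hV, hW, hVc, hWc, hVW⟩ := hu
  obtain ⟨A', hA1, hA2, hA3⟩ := hA.exists_hasDerivAt hAc
  obtain ⟨B', hB1, hB2, hB3⟩ := hB.exists_hasDerivAt hBc
  obtain ⟨V', hV1, hV2, hV3⟩ := hV.exists_hasDerivAt hVc
  obtain ⟨W', hW1, hW2, hW3⟩ := hW.exists_hasDerivAt hWc
  have hp : ∀ t x, x ∈ (S t).plus → x ∈ (S t).closedPlus := fun t x hx => Or.inl hx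
  have hn : ∀ t x, x ∈ (S t).minus → x ∈ (S t).closedMinus := fun t x hx => Or.inl hx
  have hev : ∀ x ∉ (S 0).carrier, ∀ᶠ t in 𝓝 (0 : ℝ), (x ∈ (S t).plus ↔ x ∈ (S 0).plus) ∧
      (x ∈ (S t).minus ↔ x ∈ (S 0).minus) := fun x hx => eventually_mem_moving_iff hS hx
  have hnp : ∀ x ∈ (S 0).plus, x ∉ (S 0).carrier := fun x hx h => by
    rw [(S 0).carrier_eq] at h
    exact h (Or.inl hx)
  have hnm : ∀ x ∈ (S 0).minus, x ∉ (S 0).carrier := fun x hx h => by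
    rw [(S 0).carrier_eq] at h
    exact h (Or.inr hx)
  -- The functions `i_u m` of the two sides, formed from extensions smooth on all of `M`; the
  -- transport theorem applies to each separately.
  let a : ℝ → M → ℝ := fun t x => A t x (V t x)
  let b : ℝ → M → ℝ := fun t x => B t x (W t x)
  have hac : ∀ t, HasCompactSupport (a t) := fun t => hasCompactSupport_form_apply hAc (V t) t
  have hbc : ∀ t, HasCompactSupport (b t) := fun t => hasCompactSupport_form_apply hBc (W t) t
  have hacont : Continuous (a 0) := hA.continuous_apply hV 0
  have hbcont : Continuous (b 0) := hB.continuous_apply hW 0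
  obtain ⟨KA, hKA, hKA'⟩ := hAc 1
  obtain ⟨KB, hKB, hKB'⟩ := hBc 1
  have hd1 := hasDerivAt_setIntegral_plus_family hμ hv hS (g := a) (hA.contMDiff_apply hV) hKA
    (fun t ht x hx => by simp only [a, hKA' t ht x hx]; rfl)
    (fun x => hasDerivAt_form_apply (hA1 x) (hV1 x))
  have hd2 := hasDerivAt_setIntegral_minus_family hμ hv hS (g := b) (hB.contMDiff_apply hW) hKB
    (fun t ht x hx => by simp only [b, hKB' t ht x hx]; rfl)
    (fun x => hasDerivAt_form_apply (hB1 x) (hW1 x))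
  -- The regularized derivatives are the derivatives of the extensions, cut down to the sides of `S
  -- 0`. The extensions also yield a globally continuous `j` that agrees with the jump on `Γ`.
  refine ⟨⟨restrictTo (S 0).closedPlus A', restrictTo (S 0).closedMinus B'⟩,
    ⟨restrictTo (S 0).closedPlus V', restrictTo (S 0).closedMinus W'⟩,
    fun x => a 0 x - b 0 x, ?_, ?_, hacont.sub hbcont, (hac 0).sub (hbc 0), ?_, ?_⟩
  · refine ⟨⟨fun _ => A', fun _ => B', hA2, hB2, hA3, hB3, fun _ =>
      ⟨isRestriction_restrictTo _ _, isRestriction_restrictTo _ _⟩⟩, fun x hx => ?_, fun x hx => ?_⟩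
    · have h1 : restrictTo (S 0).closedPlus A' x = A' x := if_pos (hp 0 x hx)
      simp only [h1]
      refine HasDerivAt.congr_eventually_form (W := fun t => (m t).plus) (hA1 x) ?_
      filter_upwards [hev x (hnp x hx)] with t ht
      exact (hAB t).1.1 x (hp t x (ht.1.2 hx))
    · have h1 : restrictTo (S 0).closedMinus B' x = B' x := if_pos (hn 0 x hx)
      simp only [h1]
      refine HasDerivAt.congr_eventually_form (W := fun t => (m t).minus) (hB1 x) ?_
      filter_upwards [hev x (hnm x hx)] with t ht
      exact (hAB t).2.1 x (hn t x (ht.2.2 hx))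
  · refine ⟨⟨fun _ => V', fun _ => W', hV2, hW2, hV3, hW3, fun _ =>
      ⟨isRestriction_restrictTo _ _, isRestriction_restrictTo _ _⟩⟩, fun x hx => ?_, fun x hx => ?_⟩
    · have h1 : restrictTo (S 0).closedPlus V' x = V' x := if_pos (hp 0 x hx)
      simp only [h1]
      refine HasDerivAt.congr_eventually_field (W := fun t => (u t).plus) (hV1 x) ?_
      filter_upwards [hev x (hnp x hx)] with t ht
      exact (hVW t).1.1 x (hp t x (ht.1.2 hx))
    · have h1 : restrictTo (S 0).closedMinus W' x = W' x := if_pos (hn 0 x hx)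
      simp only [h1]
      refine HasDerivAt.congr_eventually_field (W := fun t => (u t).minus) (hW1 x) ?_
      filter_upwards [hev x (hnm x hx)] with t ht
      exact (hVW t).2.1 x (hn t x (ht.2.2 hx))
  · intro x hx
    simp only [jump, formApply, a, b]
    rw [(hAB 0).1.1 x (Or.inr hx), (hAB 0).2.1 x (Or.inr hx), (hVW 0).1.1 x (Or.inr hx),
      (hVW 0).2.1 x (Or.inr hx)]
  · have hpair : (fun t => pairing μ (S t) (m t) (u t)) = fun t =>
        ∫ x in (S t).plus, a t x ∂(volumeMeasure μ) +
          ∫ x in (S t).minus, b t x ∂(volumeMeasure μ) := by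
      ext1 t
      simp only [pairing, integralM, formApply]
      congr 1
      · refine setIntegral_congr_fun (S t).isOpen_plus.measurableSet fun x hx => ?_
        simp only [a]
        rw [(hAB t).1.1 x (hp t x hx), (hVW t).1.1 x (hp t x hx)]
      · refine setIntegral_congr_fun (S t).isOpen_minus.measurableSet fun x hx => ?_
        simp only [b]
        rw [(hAB t).2.1 x (hn t x hx), (hVW t).2.1 x (hn t x hx)]
    rw [hpair]
    -- The boundary terms of `D⁺` and `D⁻` have opposite signs and combine into the jump.
    refine (hd1.add hd2).congr_deriv ?_
    rw [setIntegral_add_of_smooth hμ (hA2.continuous_apply (hV.freeze 0) 0)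
        (hasCompactSupport_form_apply hA3 _ 0)
        ((hA.freeze 0).continuous_apply hV2 0)
        (hasCompactSupport_form_apply hAc _ 0),
      setIntegral_add_of_smooth hμ (hB2.continuous_apply (hW.freeze 0) 0)
        (hasCompactSupport_form_apply hB3 _ 0)
        ((hB.freeze 0).continuous_apply hW2 0)
        (hasCompactSupport_form_apply hBc _ 0),
      surfaceIntegral_sub hμ hv hS hacont (hac 0) hbcont (hbc 0)]
    have e1 : pairing μ (S 0) ⟨restrictTo (S 0).closedPlus A', restrictTo (S 0).closedMinus B'⟩
        (u 0) = ∫ x in (S 0).plus, A' x (V 0 x) ∂(volumeMeasure μ) +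
          ∫ x in (S 0).minus, B' x (W 0 x) ∂(volumeMeasure μ) := by
      simp only [pairing, integralM, formApply]
      congr 1
      · refine setIntegral_congr_fun (S 0).isOpen_plus.measurableSet fun x hx => ?_
        have h1 : restrictTo (S 0).closedPlus A' x = A' x := if_pos (hp 0 x hx)
        simp only [h1]
        rw [(hVW 0).1.1 x (hp 0 x hx)]
      · refine setIntegral_congr_fun (S 0).isOpen_minus.measurableSet fun x hx => ?_
        have h1 : restrictTo (S 0).closedMinus B' x = B' x := if_pos (hn 0 x hx)
        simp only [h1]
        rw [(hVW 0).2.1 x (hn 0 x hx)]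
    have e2 : pairing μ (S 0) (m 0) ⟨restrictTo (S 0).closedPlus V',
        restrictTo (S 0).closedMinus W'⟩ = ∫ x in (S 0).plus, A 0 x (V' x) ∂(volumeMeasure μ) +
          ∫ x in (S 0).minus, B 0 x (W' x) ∂(volumeMeasure μ) := by
      simp only [pairing, integralM, formApply]
      congr 1
      · refine setIntegral_congr_fun (S 0).isOpen_plus.measurableSet fun x hx => ?_
        have h1 : restrictTo (S 0).closedPlus V' x = V' x := if_pos (hp 0 x hx)
        simp only [h1]
        rw [(hAB 0).1.1 x (hp 0 x hx)]
      · refine setIntegral_congr_fun (S 0).isOpen_minus.measurableSet fun x hx => ?_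
        have h1 : restrictTo (S 0).closedMinus W' x = W' x := if_pos (hn 0 x hx)
        simp only [h1]
        rw [(hAB 0).2.1 x (hn 0 x hx)]
    rw [e1, e2]
    ring

/-- The derivative of `F(A) - ⟨A, d^F F(A)⟩` along a curve in the base. -/
theorem exists_hasDerivAt_legendre {μ : KForm d M (d + 1)} (hμ : IsSmoothTopForm μ)
    {S₀ : Hypersurface d M} {F : DualAlgebroid S₀ → ℝ}
    {dF : ∀ p : DualAlgebroid S₀, Cotangent p} (hF : IsDifferential μ F dF)
    {A : ∀ S : BaseSpace S₀, DOmega S.1} (hA : SmoothSection A)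
    {Φ : SmoothFlow d M} {γ : ℝ → BaseSpace S₀} (hγ : Traces Φ γ)
    {v : VField d M} (hv : Φ.HasVelocity 0 v) {α : KForm d M d}
    (hα : (γ 0).1.FormEqOn (contract v μ) α) :
    ∃ L : TwoSided (VField d M),
      HasRegDerivV (fun t => (γ t).1) (fun t => fibrePart dF ⟨γ t, A (γ t)⟩) L 0 ∧
      HasDerivAt (fun t => F ⟨γ t, A (γ t)⟩ -
          pairing μ (γ t).1 (A (γ t)).1 (fibrePart dF ⟨γ t, A (γ t)⟩))
        (surfaceIntegral μ (γ 0).1 (fun x => ((dF ⟨γ 0, A (γ 0)⟩).2.1 x -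
            jump (formApply (fibrePart dF ⟨γ 0, A (γ 0)⟩) (A (γ 0)).1) x) • α x) -
          pairing μ (γ 0).1 (A (γ 0)).1 L) 0 := by
  have hAγ := hA Φ γ hγ
  obtain ⟨hU, hder⟩ := hF Φ γ hγ (fun t => A (γ t)) hAγ
  obtain ⟨m', L, j, hm', hL, hj, hjc, hjump, hpair⟩ := exists_hasDerivAt_pairing hμ hv
    (S := fun t => (γ t).1) hγ hAγ hU
  -- Both derivatives contain the pairing of the same `m'` with the same fibre differential, so the
  -- derivative of the section drops out.
  refine ⟨L, hL, ((hder 0 m' v hm' hv).sub hpair).congr_deriv ?_⟩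
  -- The covector is zero off `Γ`; its smooth extension `N` provides the continuity needed to split
  -- the surface integral.
  obtain ⟨N, hN, hNr⟩ := (dF ⟨γ 0, A (γ 0)⟩).2.2
  have h1 : surfaceIntegral μ (γ 0).1 (fun x => (dF ⟨γ 0, A (γ 0)⟩).2.1 x • contract v μ x) =
      surfaceIntegral μ (γ 0).1 (fun x => N x • contract v μ x) :=
    surfaceIntegral_congr_smul μ _ fun x hx => by rw [hNr.1 x hx]
  have h2 : surfaceIntegral μ (γ 0).1 (fun x => ((dF ⟨γ 0, A (γ 0)⟩).2.1 x -
      jump (formApply (fibrePart dF ⟨γ 0, A (γ 0)⟩) (A (γ 0)).1) x) • α x) =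
      surfaceIntegral μ (γ 0).1 (fun x => (N x - j x) • contract v μ x) := by
    rw [← surfaceIntegral_smul_congr_form μ _ hα]
    refine surfaceIntegral_congr_smul μ _ fun x hx => ?_
    rw [hNr.1 x hx, hjump x hx]
  rw [h1, h2, surfaceIntegral_sub' hμ hv (S' := fun t => (γ t).1) hγ hN.continuous hj hjc]
  ring

end PairingDerivative

/-! ### Integrability and linearity of the pairing. -/

section Pairing

variable {d : ℕ} {M : Type*} [TopologicalSpace M] [ChartedSpace (Model d) M]
  [IsManifold (𝓡 (d + 1)) ∞ M]

lemma SmoothVFamily.mlieBracket {V W : VField d M} (hV : SmoothVFamily fun _ => V)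
    (hW : SmoothVFamily fun _ => W) :
    SmoothVFamily fun _ => VectorField.mlieBracket (𝓡 (d + 1)) V W := by
  -- The bracket costs one derivative, which is harmless since `∞ + 1 = ∞`.
  have : IsManifold (𝓡 (d + 1)) ((⊤ : ℕ∞) + 1) M := ‹IsManifold (𝓡 (d + 1)) ∞ M›
  have : IsManifold (𝓡 (d + 1)) (minSmoothness ℝ 2) M := by
    rw [minSmoothness_of_isRCLikeNormedField]
    infer_instance
  refine SmoothVFamily.const ?_
  exact ContDiff.mlieBracket_vectorField (m := ⊤) (n := ⊤) (hV.apply 0) (hW.apply 0) (by simp)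

lemma LocUnifCompactSupport.freeze {T : M → Type*} [∀ x, Zero (T x)] {V : ℝ → ∀ x, T x}
    (h : LocUnifCompactSupport V) (t : ℝ) : LocUnifCompactSupport fun _ : ℝ => V t := fun _ => by
  obtain ⟨K, hK, h'⟩ := h |t|
  exact ⟨K, hK, fun _ _ => h' t le_rfl⟩

variable [T2Space M] [SigmaCompactSpace M] [MeasurableSpace M] [BorelSpace M]

lemma integrableOn_of_eqOn_apply {μ : KForm d M (d + 1)} (hμ : IsSmoothTopForm μ) {D : Set M}
    (hD : IsOpen D) {A : OneForm d M} (hA : SmoothFormFamily fun _ => A)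
    (hAc : LocUnifCompactSupport fun _ : ℝ => A) {V : VField d M} (hV : SmoothVFamily fun _ => V)
    {f : M → ℝ} (hf : ∀ x ∈ D, f x = A x (V x)) : IntegrableOn f D (volumeMeasure μ) := by
  have := isLocallyFiniteMeasure_volumeMeasure hμ
  exact ((hA.continuous_apply hV 0).integrable_of_hasCompactSupport
    (hasCompactSupport_form_apply hAc V 0)).integrableOn.congr_fun
      (fun x hx => (hf x hx).symm) hD.measurableSet

/-- A discontinuous field is admissible if its pairings with `1`-forms are integrable. -/
def IntegrablePairing (μ : KForm d M (d + 1)) (S : Hypersurface d M) (m : TwoSided (OneForm d M))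
    (u : TwoSided (VField d M)) : Prop :=
  IntegrableOn (formApply u m).plus S.plus (volumeMeasure μ) ∧
    IntegrableOn (formApply u m).minus S.minus (volumeMeasure μ)

/-- On each side the integrand is the restriction of a continuous function on `M`, whose compact
support comes from the form. -/
lemma integrablePairing_of_isDVect' {μ : KForm d M (d + 1)} (hμ : IsSmoothTopForm μ)
    {S : Hypersurface d M} (m : DOmega S) {u : TwoSided (VField d M)} (hu : IsDVect' S u) :
    IntegrablePairing μ S m.1 u := by
  obtain ⟨A, B, hA, hB, hAc, hBc, hAB⟩ := m.2
  obtain ⟨V, W, hV, hW, -, -, hVW⟩ := hu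
  obtain ⟨⟨a1, -⟩, b1, -⟩ := hAB 0
  obtain ⟨⟨v1, -⟩, w1, -⟩ := hVW 0
  refine ⟨integrableOn_of_eqOn_apply hμ S.isOpen_plus (hA.freeze 0) (hAc.freeze 0) (hV.freeze 0)
    fun x hx => ?_, integrableOn_of_eqOn_apply hμ S.isOpen_minus (hB.freeze 0) (hBc.freeze 0)
    (hW.freeze 0) fun x hx => ?_⟩
  · simp only [formApply]
    rw [a1 x (Or.inl hx), v1 x (Or.inl hx)]
  · simp only [formApply]
    rw [b1 x (Or.inl hx), w1 x (Or.inl hx)]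

/-- The bracket is local, so on the open sides it agrees with the bracket of the smooth extensions.
-/
lemma integrablePairing_regBracket {μ : KForm d M (d + 1)} (hμ : IsSmoothTopForm μ)
    {S : Hypersurface d M} (m : DOmega S) {u v : TwoSided (VField d M)} (hu : IsDVect' S u)
    (hv : IsDVect' S v) : IntegrablePairing μ S m.1 (regBracket u v) := by
  obtain ⟨A, B, hA, hB, hAc, hBc, hAB⟩ := m.2
  obtain ⟨V, W, hV, hW, -, -, hVW⟩ := hu
  obtain ⟨V', W', hV', hW', -, -, hVW'⟩ := hv
  obtain ⟨⟨a1, -⟩, b1, -⟩ := hAB 0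
  obtain ⟨⟨v1, -⟩, w1, -⟩ := hVW 0
  obtain ⟨⟨v1', -⟩, w1', -⟩ := hVW' 0
  refine ⟨integrableOn_of_eqOn_apply hμ S.isOpen_plus (hA.freeze 0) (hAc.freeze 0)
    ((hV.freeze 0).mlieBracket (hV'.freeze 0))
    fun x hx => ?_, integrableOn_of_eqOn_apply hμ S.isOpen_minus (hB.freeze 0) (hBc.freeze 0)
    ((hW.freeze 0).mlieBracket (hW'.freeze 0)) fun x hx => ?_⟩
  · simp only [formApply, regBracket]
    have h1 : u.plus =ᶠ[𝓝 x] V 0 := Filter.eventually_of_mem (S.isOpen_plus.mem_nhds hx)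
      fun y hy => v1 y (Or.inl hy)
    have h2 : v.plus =ᶠ[𝓝 x] V' 0 := Filter.eventually_of_mem (S.isOpen_plus.mem_nhds hx)
      fun y hy => v1' y (Or.inl hy)
    rw [a1 x (Or.inl hx), h1.mlieBracket_vectorField_eq h2]
  · simp only [formApply, regBracket]
    have h1 : u.minus =ᶠ[𝓝 x] W 0 := Filter.eventually_of_mem (S.isOpen_minus.mem_nhds hx)
      fun y hy => w1 y (Or.inl hy)
    have h2 : v.minus =ᶠ[𝓝 x] W' 0 := Filter.eventually_of_mem (S.isOpen_minus.mem_nhds hx)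
      fun y hy => w1' y (Or.inl hy)
    rw [b1 x (Or.inl hx), h1.mlieBracket_vectorField_eq h2]

lemma IntegrablePairing.add {μ : KForm d M (d + 1)} {S : Hypersurface d M}
    {m : TwoSided (OneForm d M)} {u v : TwoSided (VField d M)} (hu : IntegrablePairing μ S m u)
    (hv : IntegrablePairing μ S m v) : IntegrablePairing μ S m (u + v) :=
  ⟨(hu.1.add hv.1).congr (Filter.Eventually.of_forall fun x => ((m.plus x).map_add _ _).symm),
    (hu.2.add hv.2).congr (Filter.Eventually.of_forall fun x => ((m.minus x).map_add _ _).symm)⟩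

lemma pairing_add {μ : KForm d M (d + 1)} {S : Hypersurface d M}
    {m : TwoSided (OneForm d M)} {u v : TwoSided (VField d M)} (hu : IntegrablePairing μ S m u)
    (hv : IntegrablePairing μ S m v) :
    pairing μ S m (u + v) = pairing μ S m u + pairing μ S m v := by
  have h1 : (formApply (u + v) m).plus = fun x => (formApply u m).plus x + (formApply v m).plus x :=
    funext fun x => (m.plus x).map_add _ _
  have h2 : (formApply (u + v) m).minus =
      fun x => (formApply u m).minus x + (formApply v m).minus x :=
    funext fun x => (m.minus x).map_add _ _
  rw [pairing, integralM, h1, h2, integral_add hu.1 hv.1, integral_add hu.2 hv.2]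
  simp only [pairing, integralM]
  ring

lemma pairing_sub {μ : KForm d M (d + 1)} {S : Hypersurface d M}
    {m : TwoSided (OneForm d M)} {u v : TwoSided (VField d M)} (hu : IntegrablePairing μ S m u)
    (hv : IntegrablePairing μ S m v) :
    pairing μ S m (u - v) = pairing μ S m u - pairing μ S m v := by
  have h1 : (formApply (u - v) m).plus = fun x => (formApply u m).plus x - (formApply v m).plus x :=
    funext fun x => (m.plus x).map_sub _ _
  have h2 : (formApply (u - v) m).minus =
      fun x => (formApply u m).minus x - (formApply v m).minus x :=
    funext fun x => (m.minus x).map_sub _ _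
  rw [pairing, integralM, h1, h2, integral_sub hu.1 hv.1, integral_sub hu.2 hv.2]
  simp only [pairing, integralM]
  ring

end Pairing

/-! ### Smooth sections through a given point of the dual algebroid. -/

section Sections

variable {d : ℕ} {M : Type*} [TopologicalSpace M] [ChartedSpace (Model d) M]
  [IsManifold (𝓡 (d + 1)) ∞ M] [T2Space M] [SigmaCompactSpace M] [MeasurableSpace M]
  [BorelSpace M]

lemma IsRestriction.eq_restrictTo {T : M → Type*} [∀ x, Zero (T x)] {D : Set M} {V u : ∀ x, T x}
    (h : IsRestriction D V u) : u = restrictTo D V := by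
  funext x
  by_cases hx : x ∈ D
  · rw [h.1 x hx, (isRestriction_restrictTo D V).1 x hx]
  · rw [h.2 x hx, (isRestriction_restrictTo D V).2 x hx]

/-- The restrictions of global forms make up a smooth section through a given form. -/
lemma exists_smoothSection {S₀ : Hypersurface d M} (p : DualAlgebroid S₀) :
    ∃ A : ∀ S : BaseSpace S₀, DOmega S.1, SmoothSection A ∧ A p.1 = p.2 := by
  obtain ⟨A, B, hA, hB, hAc, hBc, hAB⟩ := p.2.2
  -- Constant families of global forms serve as extensions for every moving hypersurface, so
  -- smoothness of the section requires nothing of the curve.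
  have key : ∀ S : ℝ → Hypersurface d M, SmoothDFormFamily S fun t =>
      ⟨restrictTo (S t).closedPlus (A 0), restrictTo (S t).closedMinus (B 0)⟩ := fun S =>
    ⟨fun _ => A 0, fun _ => B 0, hA.freeze 0, hB.freeze 0, hAc.freeze 0, hBc.freeze 0, fun _ =>
      ⟨isRestriction_restrictTo _ _, isRestriction_restrictTo _ _⟩⟩
  refine ⟨fun S => ⟨_, key fun _ => S.1⟩, fun Φ γ _ => key fun t => (γ t).1, Subtype.ext ?_⟩
  have h1 := (hAB 0).1.eq_restrictTo
  have h2 := (hAB 0).2.eq_restrictTo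
  simp only [← h1, ← h2]

end Sections

/-! ### Evaluation of the Poisson bracket. -/

section Bracket

variable {d : ℕ} {M : Type*} [TopologicalSpace M] [ChartedSpace (Model d) M]
  [IsManifold (𝓡 (d + 1)) ∞ M] [T2Space M] [SigmaCompactSpace M] [MeasurableSpace M]
  [BorelSpace M]

lemma IsCurveAlong.exists_hasDerivAt {μ : KForm d M (d + 1)} (hμ : IsSmoothTopForm μ)
    {S₀ : Hypersurface d M} {F : DualAlgebroid S₀ → ℝ}
    {dF : ∀ p : DualAlgebroid S₀, Cotangent p} (hF : IsDifferential μ F dF)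
    {A : ∀ S : BaseSpace S₀, DOmega S.1} (hA : SmoothSection A) {Γ : BaseSpace S₀}
    {u : DVect Γ.1} {Φ : SmoothFlow d M} {γ : ℝ → BaseSpace S₀}
    (hγ : IsCurveAlong μ u Φ γ) :
    ∃ L : TwoSided (VField d M), IsDVect' Γ.1 L ∧
      HasRegDerivV (fun t => (γ t).1) (fun t => fibrePart dF ⟨γ t, A (γ t)⟩) L 0 ∧
      HasDerivAt (fun t => F ⟨γ t, A (γ t)⟩ -
          pairing μ (γ t).1 (A (γ t)).1 (fibrePart dF ⟨γ t, A (γ t)⟩))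
        (surfaceIntegral μ Γ.1 (fun x => ((dF ⟨Γ, A Γ⟩).2.1 x -
            jump (formApply (dF ⟨Γ, A Γ⟩).1.1 (A Γ).1) x) • contract u.1.plus μ x) -
          pairing μ Γ.1 (A Γ).1 L) 0 := by
  obtain ⟨h1, h2, v, h3, h4⟩ := hγ
  subst h2
  obtain ⟨L, h5, h6⟩ := exists_hasDerivAt_legendre hμ hF hA h1 h3 h4
  exact ⟨L, h5.1, h5, h6⟩

/-- The derivatives `a₁` and `a₂` contain `-⟨m, L₁⟩` and `-⟨m, L₂⟩`. The bracket adds `⟨m, L₁⟩ - ⟨m,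
L₂⟩ + a₁ - a₂`, in which both Lie derivatives cancel, leaving the regularized bracket and the two
surface terms. -/
theorem hasPoissonBracket_of_exists_curve {μ : KForm d M (d + 1)} (hμ : IsSmoothTopForm μ)
    {S₀ : Hypersurface d M} {F₁ F₂ : DualAlgebroid S₀ → ℝ}
    {dF₁ dF₂ : ∀ p : DualAlgebroid S₀, Cotangent p}
    (hF₁ : IsDifferential μ F₁ dF₁) (hF₂ : IsDifferential μ F₂ dF₂) (p : DualAlgebroid S₀)
    (hcurve : ∀ u : DVect p.1.1, ∃ (Φ : SmoothFlow d M) (γ : ℝ → BaseSpace S₀),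
      IsCurveAlong μ u Φ γ) :
    HasPoissonBracket μ F₁ F₂ dF₁ dF₂ p
      (integralM μ p.1.1 (formApply (regBracket (dF₁ p).1.1 (dF₂ p).1.1) p.2.1)
        + surfaceIntegral μ p.1.1 (fun x => ((dF₂ p).2.1 x -
            jump (formApply (dF₂ p).1.1 p.2.1) x) • contract (dF₁ p).1.1.plus μ x)
        - surfaceIntegral μ p.1.1 (fun x => ((dF₁ p).2.1 x -
            jump (formApply (dF₁ p).1.1 p.2.1) x) • contract (dF₂ p).1.1.plus μ x)) := by
  refine ⟨exists_smoothSection p, hcurve _, hcurve _, ?_⟩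
  obtain ⟨Γ, m⟩ := p
  intro A hA hm
  change A Γ = m at hm
  subst hm
  rintro Φ₁ γ₁ hγ₁ Φ₂ γ₂ hγ₂
  obtain ⟨L₁, hL₁, h₁, h₁'⟩ := hγ₁.exists_hasDerivAt hμ hF₂ hA
  obtain ⟨L₂, hL₂, h₂, h₂'⟩ := hγ₂.exists_hasDerivAt hμ hF₁ hA
  refine ⟨L₁, L₂, _, _, h₁, h₂, h₁', h₂', ?_⟩
  -- Splitting the pairing over the three summands of the algebroid bracket requires integrability
  -- of each.
  have i0 := integrablePairing_regBracket hμ (A Γ) (dF₁ ⟨Γ, A Γ⟩).1.2.1 (dF₂ ⟨Γ, A Γ⟩).1.2.1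
  have i1 := integrablePairing_of_isDVect' hμ (A Γ) hL₁
  have i2 := integrablePairing_of_isDVect' hμ (A Γ) hL₂
  dsimp only [fibrePart]
  rw [pairing_sub (i0.add i1) i2, pairing_add i0 i1, pairing]
  ring

end Bracket

/-! ### Isotopies with prescribed initial velocity in a Banach space. -/

section EuclideanIsotopy

open scoped NNReal

variable {E : Type*} [NormedAddCommGroup E] [NormedSpace ℝ E] [CompleteSpace E]

/-- A smooth map that differs from the identity by a contraction is a diffeomorphism. -/
lemma exists_contDiff_inverse_of_lipschitzWith {H : E → E} (hH : ContDiff ℝ ∞ H) {c : ℝ≥0}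
    (hc : c < 1) (hl : LipschitzWith c fun x => H x - x) :
    ∃ G : E → E, ContDiff ℝ ∞ G ∧ Function.LeftInverse G H ∧ Function.RightInverse G H := by
  have hA : ApproximatesLinearOn H ((ContinuousLinearEquiv.refl ℝ E : E ≃L[ℝ] E) : E →L[ℝ] E)
      univ c := by
    intro x _ y _
    have h := hl.dist_le_mul x y
    rw [dist_eq_norm, dist_eq_norm] at h
    refine le_trans (le_of_eq (congrArg norm ?_)) h
    simp only [ContinuousLinearEquiv.coe_coe, ContinuousLinearEquiv.coe_refl', id]
    abel
  have hN : Subsingleton E ∨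
      c < ‖((ContinuousLinearEquiv.refl ℝ E).symm : E →L[ℝ] E)‖₊⁻¹ := by
    rcases subsingleton_or_nontrivial E with h | h
    · exact Or.inl h
    · right
      have : ‖((ContinuousLinearEquiv.refl ℝ E).symm : E →L[ℝ] E)‖₊ = 1 :=
        NNReal.eq ContinuousLinearMap.norm_id
      rwa [this, inv_one]
  let f : E ≃ₜ E := hA.toHomeomorph H hN
  have hf : ∀ x, f x = H x := fun x => rfl
  -- The derivative differs from the identity by an operator of norm less than one, so the Neumann
  -- series inverts it; this makes the inverse homeomorphism smooth.
  have hd : ∀ a, ∃ T : E ≃L[ℝ] E, HasFDerivAt H (T : E →L[ℝ] E) a := by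
    intro a
    have h1 : HasFDerivAt H (fderiv ℝ H a) a := (hH.differentiable (by simp) a).hasFDerivAt
    have h2 : HasFDerivAt (fun x => H x - x) (fderiv ℝ H a - ContinuousLinearMap.id ℝ E) a :=
      h1.sub (hasFDerivAt_id a)
    have h3 : ‖ContinuousLinearMap.id ℝ E - fderiv ℝ H a‖ < 1 := by
      rw [← norm_neg, neg_sub]
      exact (h2.le_of_lipschitz hl).trans_lt hc
    refine ⟨ContinuousLinearEquiv.ofUnit (Units.oneSub _ h3), h1.congr_fderiv ?_⟩
    ext v
    change _ = (1 - (ContinuousLinearMap.id ℝ E - fderiv ℝ H a)) v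
    simp
  choose T hT using hd
  exact ⟨f.symm, f.contDiff_symm (f₀' := T) (fun a => hT a) hH, f.symm_apply_apply,
    f.apply_symm_apply⟩

/-- A product of bounded Lipschitz functions is Lipschitz. The sine stands in for `t` because it is
bounded, which makes the estimate valid for all times at once. -/
lemma lipschitzWith_sin_smul {X : E → E} {K B : ℝ≥0} (hK : LipschitzWith K X)
    (hB : ∀ y, ‖X y‖ ≤ B) :
    LipschitzWith (B + K) fun p : ℝ × E => Real.sin p.1 • X p.2 := by
  refine LipschitzWith.of_dist_le_mul fun p q => ?_
  have h1 : Real.sin p.1 • X p.2 - Real.sin q.1 • X q.2 =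
      (Real.sin p.1 - Real.sin q.1) • X p.2 + Real.sin q.1 • (X p.2 - X q.2) := by
    rw [sub_smul, smul_sub]
    abel
  have h2 : |Real.sin p.1 - Real.sin q.1| ≤ dist p q := by
    have h := Real.lipschitzWith_sin.dist_le_mul p.1 q.1
    rw [Real.dist_eq, NNReal.coe_one, one_mul] at h
    exact h.trans (le_max_left _ _)
  have h3 : ‖X p.2 - X q.2‖ ≤ K * dist p q := by
    rw [← dist_eq_norm]
    exact (hK.dist_le_mul p.2 q.2).trans
      (mul_le_mul_of_nonneg_left (le_max_right _ _) K.coe_nonneg)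
  rw [dist_eq_norm, h1]
  refine (norm_add_le _ _).trans ?_
  rw [norm_smul, norm_smul, Real.norm_eq_abs, Real.norm_eq_abs, NNReal.coe_add, add_mul]
  refine add_le_add ?_ ?_
  · rw [mul_comm]
    exact mul_le_mul (hB _) h2 (abs_nonneg _) B.coe_nonneg
  · exact (mul_le_of_le_one_left (norm_nonneg _) (Real.abs_sin_le_one _)).trans h3

/-- A compactly supported vector field is the initial velocity of an isotopy with the same
support. -/
lemma exists_isotopy_of_hasCompactSupport {X : E → E} (hX : ContDiff ℝ ∞ X)
    (hc : HasCompactSupport X) :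
    ∃ F G : ℝ → E → E, ContDiff ℝ ∞ (fun p : ℝ × E => F p.1 p.2) ∧
      ContDiff ℝ ∞ (fun p : ℝ × E => G p.1 p.2) ∧ (∀ t y, G t (F t y) = y) ∧
      (∀ t y, F t (G t y) = y) ∧ (∀ y, F 0 y = y) ∧ (∀ t, ∀ y ∉ tsupport X, F t y = y) ∧
      ∀ y, HasDerivAt (fun t => F t y) (X y) 0 := by
  obtain ⟨K, hK⟩ := ContDiff.lipschitzWith_of_hasCompactSupport hc hX (by simp)
  obtain ⟨b, hb⟩ := hc.exists_bound_of_continuous hX.continuous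
  have hB : ∀ y, ‖X y‖ ≤ (Real.toNNReal b : ℝ) := fun y => (hb y).trans (Real.le_coe_toNNReal b)
  set B := Real.toNNReal b
  -- The `+ 1` makes `N⁻¹ * (B + K)` strictly less than one and `N` nonzero.
  let N : ℝ≥0 := B + K + 1
  have hN : (N : ℝ) ≠ 0 := by positivity
  -- Time is kept as a coordinate, so that inverting `H` once gives an inverse smooth in time and
  -- space jointly. Running time at rate `N` restores the initial velocity `X`, as `N⁻¹ sin(N t)`
  -- has derivative one at zero.
  let H : ℝ × E → ℝ × E := fun p => (p.1, p.2 + (N : ℝ)⁻¹ • Real.sin p.1 • X p.2)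
  have hH : ContDiff ℝ ∞ H := contDiff_fst.prodMk (contDiff_snd.add (contDiff_const.smul
    ((Real.contDiff_sin.comp contDiff_fst).smul (hX.comp contDiff_snd))))
  have hl : LipschitzWith (N⁻¹ * (B + K)) fun p => H p - p := by
    refine LipschitzWith.of_dist_le_mul fun p q => ?_
    have h := (lipschitzWith_sin_smul hK hB).dist_le_mul p q
    have h1 : ∀ p : ℝ × E, H p - p = (0, (N : ℝ)⁻¹ • Real.sin p.1 • X p.2) := fun p => by
      ext <;> simp [H]
    rw [h1, h1, Prod.dist_eq, dist_self, dist_smul₀, max_eq_right (by positivity), NNReal.coe_mul,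
      mul_assoc]
    simp only [norm_inv, Real.norm_eq_abs, NNReal.abs_eq, NNReal.coe_inv]
    gcongr
  have hc1 : N⁻¹ * (B + K) < 1 := by
    rw [mul_comm, ← div_eq_mul_inv, div_lt_one (by positivity)]
    exact lt_add_one _
  obtain ⟨G, hG, hGH, hHG⟩ := exists_contDiff_inverse_of_lipschitzWith hH hc1 hl
  have hG1 : ∀ p, (G p).1 = p.1 := fun p => by
    have h := congrArg Prod.fst (hHG p)
    exact h
  have hG2 : ∀ t y, G (t, y) = (t, (G (t, y)).2) := fun t y => Prod.ext (hG1 _) rfl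
  have htime : ContDiff ℝ ∞ fun p : ℝ × E => ((N : ℝ) * p.1, p.2) :=
    (contDiff_const.mul contDiff_fst).prodMk contDiff_snd
  refine ⟨fun t y => (H (N * t, y)).2, fun t y => (G (N * t, y)).2,
    contDiff_snd.comp (hH.comp htime), contDiff_snd.comp (hG.comp htime), fun t y => ?_,
    fun t y => ?_, fun y => ?_, fun t y hy => ?_, fun y => ?_⟩
  · exact congrArg Prod.snd (hGH (N * t, y))
  · have h := congrArg Prod.snd (hHG (N * t, y))
    rwa [hG2] at h
  · simp [H]
  · simp [H, image_eq_zero_of_notMem_tsupport hy]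
  · have h1 : HasDerivAt (fun t : ℝ => (N : ℝ)⁻¹ * Real.sin (N * t)) 1 0 := by
      have h2 : HasDerivAt (fun t : ℝ => (N : ℝ) * t) N 0 := by
        simpa using (hasDerivAt_id (0 : ℝ)).const_mul (N : ℝ)
      refine (h2.sin.const_mul (N : ℝ)⁻¹).congr_deriv ?_
      simp [hN]
    have h3 := (h1.smul_const (X y)).const_add y
    rw [one_smul] at h3
    refine h3.congr_of_eventuallyEq (Filter.Eventually.of_forall fun t => ?_)
    simp only [H, smul_smul]

end EuclideanIsotopy

/-! ### Flows supported in one chart. -/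

section ChartFlow

variable {d : ℕ} {M : Type*} [TopologicalSpace M] [ChartedSpace (Model d) M]

lemma SmoothFlow.hasVelocity_zero_of {Φ : SmoothFlow d M} {v : VField d M}
    (h : ∀ x, HasMFDerivAt 𝓘(ℝ, ℝ) (𝓡 (d + 1)) (fun s => Φ.φ s x) 0
      ((1 : ℝ →L[ℝ] ℝ).smulRight (v x : Model d) : ℝ →L[ℝ] Model d)) : Φ.HasVelocity 0 v := by
  intro x
  have h1 : ∀ z, z = x → ((1 : ℝ →L[ℝ] ℝ).smulRight (v x : Model d) : ℝ →L[ℝ] Model d) =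
      (1 : ℝ →L[ℝ] ℝ).smulRight (v z : Model d) := by
    rintro _ rfl
    rfl
  exact (h x).congr_mfderiv (h1 _ (Φ.zero x))

lemma SmoothFlow.HasVelocity.hasMFDerivAt_zero {Φ : SmoothFlow d M} {v : VField d M}
    (hv : Φ.HasVelocity 0 v) (x : M) :
    HasMFDerivAt 𝓘(ℝ, ℝ) (𝓡 (d + 1)) (fun s => Φ.φ s x) 0
      ((1 : ℝ →L[ℝ] ℝ).smulRight (v x : Model d) : ℝ →L[ℝ] Model d) := by
  have h1 : ∀ z, z = x → ((1 : ℝ →L[ℝ] ℝ).smulRight (v z : Model d) : ℝ →L[ℝ] Model d) =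
      (1 : ℝ →L[ℝ] ℝ).smulRight (v x : Model d) := by
    rintro _ rfl
    rfl
  exact (hv x).congr_mfderiv (h1 _ (Φ.zero x))

open Classical in
/-- A map of the model space read in a chart, extended by the identity. -/
def chartExtend (e : OpenPartialHomeomorph M (Model d)) (F : Model d → Model d) (x : M) : M :=
  if x ∈ e.source then e.symm (F (e x)) else x

lemma chartExtend_of_mem {e : OpenPartialHomeomorph M (Model d)} {F : Model d → Model d} {x : M}
    (hx : x ∈ e.source) : chartExtend e F x = e.symm (F (e x)) := if_pos hx

lemma chartExtend_of_notMem {e : OpenPartialHomeomorph M (Model d)} {F : Model d → Model d} {x : M}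
    (hx : x ∉ e.source) : chartExtend e F x = x := if_neg hx

lemma chartExtend_of_fixed {e : OpenPartialHomeomorph M (Model d)} {F : Model d → Model d} {x : M}
    (hx : x ∈ e.source → F (e x) = e x) : chartExtend e F x = x := by
  by_cases h : x ∈ e.source
  · rw [chartExtend_of_mem h, hx h, e.left_inv h]
  · exact chartExtend_of_notMem h

lemma chartExtend_comp {e : OpenPartialHomeomorph M (Model d)} {F G : Model d → Model d}
    (hF : MapsTo F e.target e.target) (h : ∀ y, G (F y) = y) (x : M) :
    chartExtend e G (chartExtend e F x) = x := by
  by_cases hx : x ∈ e.source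
  · have h1 := hF (e.map_source hx)
    rw [chartExtend_of_mem hx, chartExtend_of_mem (e.map_target h1), e.right_inv h1, h,
      e.left_inv hx]
  · rw [chartExtend_of_notMem hx, chartExtend_of_notMem hx]

variable [IsManifold (𝓡 (d + 1)) ∞ M]

/-- On the chart domain the preferred trivialization of the tangent bundle at `i` is the derivative
of the chart at `i`, which explains the restriction to charts `chartAt`. -/
lemma contDiffAt_coordField {V : VField d M}
    (hV : ContMDiff (𝓡 (d + 1)) (𝓡 (d + 1)).tangent ∞
      (fun x : M => (⟨x, V x⟩ : TangentBundle (𝓡 (d + 1)) M))) (i : M) {y : Model d}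
    (hy : y ∈ (chartAt (Model d) i).target) :
    ContDiffAt ℝ ∞ (coordField (chartAt (Model d) i) V) y := by
  set e := chartAt (Model d) i
  let T := trivializationAt (Model d) (TangentSpace (𝓡 (d + 1)) : M → Type _) i
  have hb : T.baseSet = e.source := rfl
  have h1 : ContMDiffAt (𝓡 (d + 1)) 𝓘(ℝ, Model d) ∞
      (fun x => (T ⟨x, V x⟩).2) (e.symm y) :=
    (T.contMDiffAt_section_iff (e.map_target hy)).1 (hV (e.symm y))
  have h2 : ContMDiffAt (𝓡 (d + 1)) (𝓡 (d + 1)) ∞ e.symm y :=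
    contMDiffAt_symm_of_mem_maximalAtlas (IsManifold.chart_mem_maximalAtlas i) hy
  have h3 : ContMDiffAt (𝓡 (d + 1)) 𝓘(ℝ, Model d) ∞
      (fun y => (T ⟨e.symm y, V (e.symm y)⟩).2) y :=
    ContMDiffAt.comp y (g := fun x => (T ⟨x, V x⟩).2) h1 h2
  refine h3.contDiffAt.congr_of_eventuallyEq ?_
  filter_upwards [e.open_target.mem_nhds hy] with z hz
  have h4 := TangentBundle.continuousLinearMapAt_trivializationAt (I := 𝓡 (d + 1)) (x₀ := i)
    (e.map_target hz)
  have h5 := T.continuousLinearMapAt_apply_of_mem (R := ℝ) (e.map_target hz) (V (e.symm z))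
  rw [← h5]
  exact (congrArg (fun L : Model d →L[ℝ] Model d => L (V (e.symm z))) h4).symm

variable [T2Space M]

/-- In the chart this is a composition of smooth maps. The set `e.symm '' C` is compact, hence
closed, so near a point outside the chart the map is the identity. -/
lemma contMDiff_chartExtend {e : OpenPartialHomeomorph M (Model d)}
    (he : e ∈ IsManifold.maximalAtlas (𝓡 (d + 1)) ∞ M) {C : Set (Model d)} (hC : IsCompact C)
    (hCe : C ⊆ e.target) {F : ℝ → Model d → Model d}
    (hF : ContDiff ℝ ∞ fun p : ℝ × Model d => F p.1 p.2) (hid : ∀ t, ∀ y ∉ C, F t y = y)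
    (hmaps : ∀ t, MapsTo (F t) e.target e.target) :
    ContMDiff (𝓘(ℝ, ℝ).prod (𝓡 (d + 1))) (𝓡 (d + 1)) ∞
      fun p : ℝ × M => chartExtend e (F p.1) p.2 := by
  rintro ⟨t, x⟩
  by_cases hx : x ∈ e.source
  · have hF' : ContMDiff (𝓘(ℝ, ℝ).prod 𝓘(ℝ, Model d)) 𝓘(ℝ, Model d) ∞
        (fun p : ℝ × Model d => F p.1 p.2) := by
      rw [← modelWithCornersSelf_prod, chartedSpaceSelf_prod]
      exact hF.contMDiff
    have h1 : ContMDiffAt (𝓘(ℝ, ℝ).prod (𝓡 (d + 1))) (𝓘(ℝ, ℝ).prod (𝓡 (d + 1))) ∞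
        (fun p : ℝ × M => (p.1, e p.2)) (t, x) :=
      contMDiffAt_fst.prodMk
        (ContMDiffAt.comp (t, x) (contMDiffAt_of_mem_maximalAtlas he hx) contMDiffAt_snd)
    have h2 : ContMDiffAt (𝓘(ℝ, ℝ).prod (𝓡 (d + 1))) (𝓡 (d + 1)) ∞
        (fun p : ℝ × M => F p.1 (e p.2)) (t, x) :=
      ContMDiffAt.comp (t, x) (g := fun p : ℝ × Model d => F p.1 p.2) hF'.contMDiffAt h1
    have h3 : ContMDiffAt (𝓘(ℝ, ℝ).prod (𝓡 (d + 1))) (𝓡 (d + 1)) ∞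
        (fun p : ℝ × M => e.symm (F p.1 (e p.2))) (t, x) :=
      ContMDiffAt.comp (t, x) (g := e.symm) (contMDiffAt_symm_of_mem_maximalAtlas he
        (hmaps t (e.map_source hx))) h2
    refine h3.congr_of_eventuallyEq ?_
    filter_upwards [continuous_snd.continuousAt.eventually (e.open_source.mem_nhds hx)] with p hp
    exact chartExtend_of_mem hp
  · have hK : IsClosed (e.symm '' C) :=
      (hC.image_of_continuousOn (e.continuousOn_symm.mono hCe)).isClosed
    have hxK : x ∉ e.symm '' C := by
      rintro ⟨y, hy, rfl⟩
      exact hx (e.map_target (hCe hy))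
    refine ContMDiffAt.congr_of_eventuallyEq (f := fun p : ℝ × M => p.2) contMDiffAt_snd ?_
    filter_upwards [continuous_snd.continuousAt.eventually (hK.isOpen_compl.mem_nhds hxK)] with p hp
    exact chartExtend_of_fixed fun h => hid _ _ fun hC' => hp ⟨_, hC', e.left_inv h⟩

/-- A smooth vector field with compact support in the domain of a chart is the initial velocity of
a flow. -/
lemma exists_flow_of_chart {V : VField d M}
    (hV : ContMDiff (𝓡 (d + 1)) (𝓡 (d + 1)).tangent ∞
      (fun x : M => (⟨x, V x⟩ : TangentBundle (𝓡 (d + 1)) M))) (i : M) {K : Set M}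
    (hK : IsCompact K) (hKi : K ⊆ (chartAt (Model d) i).source) (hVK : ∀ x ∉ K, V x = 0) :
    ∃ Φ : SmoothFlow d M, Φ.HasVelocity 0 V := by
  classical
  set e := chartAt (Model d) i
  have he : e ∈ IsManifold.maximalAtlas (𝓡 (d + 1)) ∞ M := IsManifold.chart_mem_maximalAtlas i
  let C : Set (Model d) := e '' K
  have hC : IsCompact C := hK.image_of_continuousOn (e.continuousOn.mono hKi)
  have hCe : C ⊆ e.target := by
    rintro _ ⟨x, hx, rfl⟩
    exact e.map_source (hKi hx)
  -- Extension by zero is smooth because the support lies in the compact set `C` inside the target.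
  let X : Model d → Model d := fun y => if y ∈ e.target then coordField e V y else 0
  have hX1 : ∀ y ∈ e.target, X y = coordField e V y := fun y hy => if_pos hy
  have hX0 : ∀ y ∉ C, X y = 0 := by
    intro y hy
    by_cases hye : y ∈ e.target
    · rw [hX1 y hye, coordField]
      rw [hVK (e.symm y) fun h => hy ⟨_, h, e.right_inv hye⟩]
      exact map_zero _
    · exact if_neg hye
  have hXs : ContDiff ℝ ∞ X := contDiff_iff_contDiffAt.2 fun y => by
    by_cases hye : y ∈ e.target
    · refine (contDiffAt_coordField hV i hye).congr_of_eventuallyEq ?_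
      filter_upwards [e.open_target.mem_nhds hye] with z hz
      exact hX1 z hz
    · refine (contDiffAt_const (c := (0 : Model d))).congr_of_eventuallyEq ?_
      filter_upwards [hC.isClosed.isOpen_compl.mem_nhds fun h => hye (hCe h)] with z hz
      exact hX0 z hz
  have hXc : HasCompactSupport X := HasCompactSupport.intro hC hX0
  have hXt : tsupport X ⊆ C := closure_minimal
    (fun y hy => by_contra fun h => hy (hX0 y h)) hC.isClosed
  obtain ⟨F, G, hF, hG, hGF, hFG, hF0, hFid, hFd⟩ := exists_isotopy_of_hasCompactSupport hXs hXc
  have hFid' : ∀ t, ∀ y ∉ C, F t y = y := fun t y hy => hFid t y fun h => hy (hXt h)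
  have hGid' : ∀ t, ∀ y ∉ C, G t y = y := fun t y hy => by
    have h := hGF t y
    rwa [hFid' t y hy] at h
  -- If `P t y` lies outside `C`, then `Q` fixes it, so `P t y = y`; otherwise it lies in `C`,
  -- inside the target.
  have hmaps : ∀ {P Q : ℝ → Model d → Model d}, (∀ t y, Q t (P t y) = y) →
      (∀ t, ∀ y ∉ C, Q t y = y) → ∀ t, MapsTo (P t) e.target e.target := by
    intro P Q hQP hQ t y hy
    by_cases h : P t y ∈ C
    · exact hCe h
    · have h1 := hQP t y
      rw [hQ t _ h] at h1
      rwa [h1]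
  have hmF := hmaps hGF hGid'
  have hmG := hmaps hFG hFid'
  let Φ : SmoothFlow d M :=
    { φ := fun t => chartExtend e (F t)
      ψ := fun t => chartExtend e (G t)
      contMDiff_φ := contMDiff_chartExtend he hC hCe hF hFid' hmF
      contMDiff_ψ := contMDiff_chartExtend he hC hCe hG hGid' hmG
      left_inv := fun t x => chartExtend_comp (hmF t) (hGF t) x
      right_inv := fun t x => chartExtend_comp (hmG t) (hFG t) x
      zero := fun x => chartExtend_of_fixed fun _ => hF0 _
      compact_support := fun R => ⟨K, hK, fun t _ x hx => chartExtend_of_fixed fun h =>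
        hFid' t _ fun hC' => by
          obtain ⟨z, hz, hzx⟩ := hC'
          exact hx (e.injOn (hKi hz) h hzx ▸ hz)⟩ }
  refine ⟨Φ, SmoothFlow.hasVelocity_zero_of fun x => ?_⟩
  by_cases hx : x ∈ e.source
  · have hy := e.map_source hx
    have h1 : HasMFDerivAt 𝓘(ℝ, ℝ) (𝓡 (d + 1)) (fun s => F s (e x)) 0
        ((1 : ℝ →L[ℝ] ℝ).smulRight (X (e x)) : ℝ →L[ℝ] Model d) :=
      (hFd (e x)).hasFDerivAt.hasMFDerivAt
    have h2 : HasMFDerivAt (𝓡 (d + 1)) (𝓡 (d + 1)) e.symm (F 0 (e x))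
        (mfderiv (𝓡 (d + 1)) (𝓡 (d + 1)) e.symm (F 0 (e x))) :=
      (mdifferentiableAt_chart_symm he (by rwa [hF0])).hasMFDerivAt
    have h3 := h2.comp (0 : ℝ) h1
    have h4 : (e.symm ∘ fun s => F s (e x)) = fun s => Φ.φ s x :=
      funext fun s => (chartExtend_of_mem hx).symm
    rw [h4] at h3
    refine h3.congr_mfderiv ?_
    refine ContinuousLinearMap.ext fun r => ?_
    have h5 : (mfderiv (𝓡 (d + 1)) (𝓡 (d + 1)) e.symm (F 0 (e x)) : Model d →L[ℝ] Model d) =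
        mfderiv (𝓡 (d + 1)) (𝓡 (d + 1)) e.symm (e x) := by rw [hF0]
    have h6 : ∀ z (hz : z = x), (V z : Model d) = V x := by
      rintro _ rfl
      rfl
    have h7 : (mfderiv (𝓡 (d + 1)) (𝓡 (d + 1)) e.symm (e x) : Model d →L[ℝ] Model d) (X (e x)) =
        V x := by
      rw [hX1 _ hy]
      exact (mfderiv_symm_mfderiv_chart he hy _).trans (h6 _ (e.left_inv hx))
    have h8 : ∀ (L L' : Model d →L[ℝ] Model d) (a b : Model d) (r : ℝ), L = L' → L' a = b →
        L (r • a) = r • b := by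
      rintro L _ a _ r rfl rfl
      exact map_smul L r a
    exact h8 _ _ _ _ r h5 h7
  · have h1 : V x = 0 := hVK x fun h => hx (hKi h)
    have h2 : (fun s => Φ.φ s x) = fun _ => x := funext fun s => chartExtend_of_notMem hx
    rw [h2]
    refine (hasMFDerivAt_const x (0 : ℝ)).congr_mfderiv ?_
    refine ContinuousLinearMap.ext fun r => ?_
    have h3 : ∀ r : ℝ, (0 : Model d) = r • (V x : Model d) := by
      intro r
      rw [h1]
      exact (smul_zero r).symm
    exact h3 r

end ChartFlow

/-! ### Composition of flows, and arbitrary compactly supported initial velocities. -/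

section FlowOperations

variable {d : ℕ} {M : Type*} [TopologicalSpace M] [ChartedSpace (Model d) M]

/-- The flow that stays at the identity. -/
def SmoothFlow.refl : SmoothFlow d M where
  φ _ x := x
  ψ _ x := x
  contMDiff_φ := contMDiff_snd
  contMDiff_ψ := contMDiff_snd
  left_inv _ _ := rfl
  right_inv _ _ := rfl
  zero _ := rfl
  compact_support _ := ⟨∅, isCompact_empty, fun _ _ _ _ => rfl⟩

/-- The composition of two flows at equal times. -/
def SmoothFlow.comp (Φ Ψ : SmoothFlow d M) : SmoothFlow d M where
  φ t x := Φ.φ t (Ψ.φ t x)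
  ψ t x := Ψ.ψ t (Φ.ψ t x)
  contMDiff_φ := ContMDiff.comp (g := fun p : ℝ × M => Φ.φ p.1 p.2) Φ.contMDiff_φ
    (contMDiff_fst.prodMk Ψ.contMDiff_φ)
  contMDiff_ψ := ContMDiff.comp (g := fun p : ℝ × M => Ψ.ψ p.1 p.2) Ψ.contMDiff_ψ
    (contMDiff_fst.prodMk Φ.contMDiff_ψ)
  left_inv t x := by rw [Φ.left_inv, Ψ.left_inv]
  right_inv t x := by rw [Ψ.right_inv, Φ.right_inv]
  zero x := by rw [Ψ.zero, Φ.zero]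
  compact_support R := by
    obtain ⟨K, hK, h⟩ := Φ.compact_support R
    obtain ⟨K', hK', h'⟩ := Ψ.compact_support R
    refine ⟨K ∪ K', hK.union hK', fun t ht x hx => ?_⟩
    rw [h' t ht x fun hx' => hx (Or.inr hx'), h t ht x fun hx' => hx (Or.inl hx')]

/-- The flow at `c` times the speed. -/
def SmoothFlow.rescale (Φ : SmoothFlow d M) (c : ℝ) : SmoothFlow d M where
  φ t x := Φ.φ (c * t) x
  ψ t x := Φ.ψ (c * t) x
  contMDiff_φ := ContMDiff.comp (g := fun p : ℝ × M => Φ.φ p.1 p.2) Φ.contMDiff_φ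
    (((contDiff_const.mul contDiff_id).contMDiff.comp contMDiff_fst).prodMk contMDiff_snd)
  contMDiff_ψ := ContMDiff.comp (g := fun p : ℝ × M => Φ.ψ p.1 p.2) Φ.contMDiff_ψ
    (((contDiff_const.mul contDiff_id).contMDiff.comp contMDiff_fst).prodMk contMDiff_snd)
  left_inv _ := Φ.left_inv _
  right_inv _ := Φ.right_inv _
  zero x := by rw [mul_zero, Φ.zero]
  compact_support R := by
    obtain ⟨K, hK, h⟩ := Φ.compact_support (|c| * R)
    refine ⟨K, hK, fun t ht => h _ ?_⟩
    rw [abs_mul]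
    exact mul_le_mul_of_nonneg_left ht (abs_nonneg c)

lemma SmoothFlow.hasVelocity_refl : (SmoothFlow.refl : SmoothFlow d M).HasVelocity 0 0 := by
  refine SmoothFlow.hasVelocity_zero_of fun x => ?_
  refine (hasMFDerivAt_const x (0 : ℝ)).congr_mfderiv ?_
  refine ContinuousLinearMap.ext fun r => ?_
  have h : ∀ r : ℝ, (0 : Model d) = r • (0 : Model d) := fun r => (smul_zero r).symm
  exact h r

/-- The joint derivative of `φ` at time zero sends `(1, 0)` to `v` and `(0, ζ)` to `ζ`, because
`φ_0` is the identity; hence initial velocities add under composition. -/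
lemma SmoothFlow.HasVelocity.comp {Φ Ψ : SmoothFlow d M} {v w : VField d M}
    (hv : Φ.HasVelocity 0 v) (hw : Ψ.HasVelocity 0 w) :
    (Φ.comp Ψ).HasVelocity 0 fun x => v x + w x := by
  refine SmoothFlow.hasVelocity_zero_of fun x => ?_
  have hP : MDifferentiableAt (𝓘(ℝ, ℝ).prod (𝓡 (d + 1))) (𝓡 (d + 1))
      (fun p : ℝ × M => Φ.φ p.1 p.2) (0, Ψ.φ 0 x) :=
    Φ.contMDiff_φ.contMDiffAt.mdifferentiableAt (by simp)
  obtain ⟨L, hL⟩ : ∃ L : ℝ × Model d →L[ℝ] Model d, HasMFDerivAt (𝓘(ℝ, ℝ).prod (𝓡 (d + 1)))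
      (𝓡 (d + 1)) (fun p : ℝ × M => Φ.φ p.1 p.2) (0, Ψ.φ 0 x) L := ⟨_, hP.hasMFDerivAt⟩
  have h1 : L (1, 0) = v x := by
    have h2 : HasMFDerivAt 𝓘(ℝ, ℝ) (𝓘(ℝ, ℝ).prod (𝓡 (d + 1))) (fun s : ℝ => (s, Ψ.φ 0 x)) 0
        ((ContinuousLinearMap.id ℝ ℝ).prod (0 : ℝ →L[ℝ] Model d)) :=
      (hasMFDerivAt_id (0 : ℝ)).prodMk (hasMFDerivAt_const (Ψ.φ 0 x) (0 : ℝ))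
    have h3 := hL.comp (0 : ℝ) h2
    have h4 := hasMFDerivAt_unique h3 (hv.hasMFDerivAt_zero (Ψ.φ 0 x))
    have h5 := congrArg (fun T : ℝ →L[ℝ] Model d => T 1) h4
    have h6 : L (1, 0) = (1 : ℝ) • (v (Ψ.φ 0 x) : Model d) := h5
    have h7 : ∀ z, z = x → (v z : Model d) = v x := by
      rintro _ rfl
      rfl
    rw [h6, one_smul]
    exact h7 _ (Ψ.zero x)
  have h2 : ∀ ζ, L (0, ζ) = ζ := by
    intro ζ
    have h2 : HasMFDerivAt (𝓡 (d + 1)) (𝓘(ℝ, ℝ).prod (𝓡 (d + 1))) (fun z : M => ((0 : ℝ), z))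
        (Ψ.φ 0 x) ((0 : Model d →L[ℝ] ℝ).prod (ContinuousLinearMap.id ℝ (Model d))) :=
      (hasMFDerivAt_const (0 : ℝ) (Ψ.φ 0 x)).prodMk (hasMFDerivAt_id (Ψ.φ 0 x))
    have h3 := hL.comp (Ψ.φ 0 x) h2
    have h4 : HasMFDerivAt (𝓡 (d + 1)) (𝓡 (d + 1))
        ((fun p : ℝ × M => Φ.φ p.1 p.2) ∘ fun z : M => ((0 : ℝ), z)) (Ψ.φ 0 x)
        (ContinuousLinearMap.id ℝ (Model d)) := by
      refine (hasMFDerivAt_id (Ψ.φ 0 x)).congr_of_eventuallyEq ?_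
      exact Filter.Eventually.of_forall fun z => Φ.zero z
    exact congrArg (fun T : Model d →L[ℝ] Model d => T ζ) (hasMFDerivAt_unique h3 h4)
  have h3 : HasMFDerivAt 𝓘(ℝ, ℝ) (𝓘(ℝ, ℝ).prod (𝓡 (d + 1))) (fun s : ℝ => (s, Ψ.φ s x)) 0
      ((ContinuousLinearMap.id ℝ ℝ).prod
        ((1 : ℝ →L[ℝ] ℝ).smulRight (w x : Model d) : ℝ →L[ℝ] Model d)) :=
    (hasMFDerivAt_id (0 : ℝ)).prodMk (hw.hasMFDerivAt_zero x)
  refine (hL.comp (0 : ℝ) h3).congr_mfderiv ?_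
  refine ContinuousLinearMap.ext fun r => ?_
  have h4 : ∀ (a b : Model d) (r : ℝ), L (1, 0) = a → L (r, r • b) = r • (a + b) := by
    rintro _ b r rfl
    have h5 : ((r, r • b) : ℝ × Model d) = r • ((1, 0) : ℝ × Model d) + (0, r • b) := by
      ext <;> simp
    rw [h5, map_add, map_smul, h2, smul_add]
  exact h4 _ _ r h1

variable [IsManifold (𝓡 (d + 1)) ∞ M] [T2Space M] [SigmaCompactSpace M]

/-- Compactly supported smooth vector fields are initial velocities of flows. -/
theorem exists_flow_hasVelocity {V : VField d M}
    (hV : ContMDiff (𝓡 (d + 1)) (𝓡 (d + 1)).tangent ∞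
      (fun x : M => (⟨x, V x⟩ : TangentBundle (𝓡 (d + 1)) M))) {K : Set M}
    (hK : IsCompact K) (hVK : ∀ x ∉ K, V x = 0) :
    ∃ Φ : SmoothFlow d M, Φ.HasVelocity 0 V := by
  classical
  -- The partition of unity cuts `V` into fields supported in single charts. Only finitely many
  -- pieces meet `K`, and composing their flows adds up the pieces.
  have key : ∀ s : Finset M, ∃ Φ : SmoothFlow d M,
      Φ.HasVelocity 0 fun x => (∑ i ∈ s, chartPartition d M i x) • V x := by
    intro s
    induction s using Finset.induction_on with
    | empty =>
      refine ⟨SmoothFlow.refl, ?_⟩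
      have h : (fun x => (∑ i ∈ (∅ : Finset M), chartPartition d M i x) • V x) = 0 :=
        funext fun x => by rw [Finset.sum_empty, zero_smul]; rfl
      rw [h]
      exact SmoothFlow.hasVelocity_refl
    | insert i s hi ih =>
      obtain ⟨Φ, hΦ⟩ := ih
      obtain ⟨Ψ, hΨ⟩ := exists_flow_of_chart (V := fun x => chartPartition d M i x • V x)
        (ContMDiff.smul_section (chartPartition d M i).contMDiff hV) i
        (K := K ∩ tsupport (chartPartition d M i)) (hK.inter_right (isClosed_tsupport _))
        (inter_subset_right.trans (chartPartition_isSubordinate d M i)) (fun x hx => by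
          by_cases hxK : x ∈ K
          · rw [image_eq_zero_of_notMem_tsupport fun h => hx ⟨hxK, h⟩, zero_smul]
          · rw [hVK x hxK, smul_zero])
      refine ⟨Ψ.comp Φ, ?_⟩
      have h : (fun x => (∑ j ∈ insert i s, chartPartition d M j x) • V x) =
          fun x => chartPartition d M i x • V x + (∑ j ∈ s, chartPartition d M j x) • V x :=
        funext fun x => by rw [Finset.sum_insert hi, add_smul]
      rw [h]
      exact hΨ.comp hΦ
  have hfin := (chartPartition d M).locallyFinite.finite_nonempty_inter_compact hK
  obtain ⟨Φ, hΦ⟩ := key hfin.toFinset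
  refine ⟨Φ, ?_⟩
  have h : (fun x => (∑ i ∈ hfin.toFinset, chartPartition d M i x) • V x) = V := by
    funext x
    by_cases hx : x ∈ K
    · have h1 := (chartPartition d M).sum_eq_one (mem_univ x)
      rw [finsum_eq_sum_of_support_subset (s := hfin.toFinset)] at h1
      · rw [h1, one_smul]
      · intro i hi
        exact hfin.mem_toFinset.2 ⟨x, hi, hx⟩
    · rw [hVK x hx, smul_zero]
  rwa [h] at hΦ

end FlowOperations

/-! ### Curves in the base space with prescribed tangent vector. -/

section Curves

variable {d : ℕ} {M : Type*} [TopologicalSpace M] [ChartedSpace (Model d) M]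

lemma Hypersurface.ext_sets {S S' : Hypersurface d M} (h₁ : S.plus = S'.plus)
    (h₂ : S.carrier = S'.carrier) (h₃ : S.minus = S'.minus) : S = S' := by
  cases S
  cases S'
  cases h₁
  cases h₂
  cases h₃
  rfl

variable [IsManifold (𝓡 (d + 1)) ∞ M]

/-- A diffeomorphism of a flow, as a homeomorphism. -/
def SmoothFlow.homeomorph (Φ : SmoothFlow d M) (t : ℝ) : M ≃ₜ M where
  toFun := Φ.φ t
  invFun := Φ.ψ t
  left_inv := Φ.left_inv t
  right_inv := Φ.right_inv t
  continuous_toFun := Φ.continuous_φ.comp (continuous_const.prodMk continuous_id)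
  continuous_invFun := Φ.continuous_ψ.comp (continuous_const.prodMk continuous_id)

/-- The chart `e`, carried along by a flow. -/
def SmoothFlow.transportChart (Φ : SmoothFlow d M) (t : ℝ)
    (e : OpenPartialHomeomorph M (Model d)) : OpenPartialHomeomorph M (Model d) :=
  (Φ.homeomorph t).symm.transOpenPartialHomeomorph e

lemma SmoothFlow.transportChart_mem (Φ : SmoothFlow d M) (t : ℝ)
    {e : OpenPartialHomeomorph M (Model d)}
    (he : e ∈ IsManifold.maximalAtlas (𝓡 (d + 1)) ∞ M) :
    Φ.transportChart t e ∈ IsManifold.maximalAtlas (𝓡 (d + 1)) ∞ M := by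
  have hφ : ContMDiff (𝓡 (d + 1)) (𝓡 (d + 1)) ∞ (Φ.φ t) :=
    ContMDiff.comp (g := fun p : ℝ × M => Φ.φ p.1 p.2) Φ.contMDiff_φ
      (contMDiff_const.prodMk contMDiff_id)
  have hψ : ContMDiff (𝓡 (d + 1)) (𝓡 (d + 1)) ∞ (Φ.ψ t) :=
    ContMDiff.comp (g := fun p : ℝ × M => Φ.ψ p.1 p.2) Φ.contMDiff_ψ
      (contMDiff_const.prodMk contMDiff_id)
  refine OpenPartialHomeomorph.mem_maximalAtlas_of_contMDiffOn _ (fun x hx => ?_) fun y hy => ?_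
  · exact (ContMDiffAt.comp x (g := e) (contMDiffAt_of_mem_maximalAtlas he hx)
      hψ.contMDiffAt).contMDiffWithinAt
  · exact (ContMDiffAt.comp y (g := Φ.φ t) hφ.contMDiffAt
      (contMDiffAt_symm_of_mem_maximalAtlas he hy)).contMDiffWithinAt

/-- The image of a hypersurface under a flow. -/
def SmoothFlow.image (Φ : SmoothFlow d M) (t : ℝ) (S : Hypersurface d M) : Hypersurface d M where
  plus := Φ.ψ t ⁻¹' S.plus
  carrier := Φ.ψ t ⁻¹' S.carrier
  minus := Φ.ψ t ⁻¹' S.minus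
  isOpen_plus := S.isOpen_plus.preimage (Φ.homeomorph t).symm.continuous
  isOpen_minus := S.isOpen_minus.preimage (Φ.homeomorph t).symm.continuous
  disjoint_plus_minus := S.disjoint_plus_minus.preimage _
  carrier_eq := by rw [S.carrier_eq, preimage_compl, preimage_union]
  exists_slice p hp := by
    obtain ⟨e, he, hpe, h⟩ := S.exists_slice _ hp
    exact ⟨Φ.transportChart t e, Φ.transportChart_mem t he, hpe, fun x hx => h _ hx⟩

lemma SmoothFlow.mapsHypersurface_image (Φ : SmoothFlow d M) (t : ℝ) (S : Hypersurface d M) :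
    MapsHypersurface (Φ.φ t) S (Φ.image t S) :=
  ⟨Φ.image_eq_preimage t _, Φ.image_eq_preimage t _, Φ.image_eq_preimage t _⟩

lemma SmoothFlow.image_zero (Φ : SmoothFlow d M) (S : Hypersurface d M) : Φ.image 0 S = S := by
  have h : Φ.ψ 0 = id := funext Φ.ψ_zero
  exact Hypersurface.ext_sets (congrArg (· ⁻¹' S.plus) h) (congrArg (· ⁻¹' S.carrier) h)
    (congrArg (· ⁻¹' S.minus) h)

lemma MapsHypersurface.comp {f g : M → M} {S S' S'' : Hypersurface d M}
    (hg : MapsHypersurface g S' S'') (hf : MapsHypersurface f S S') :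
    MapsHypersurface (fun x => g (f x)) S S'' := by
  refine ⟨?_, ?_, ?_⟩
  · rw [← hg.1, ← hf.1, image_image]
  · rw [← hg.2.1, ← hf.2.1, image_image]
  · rw [← hg.2.2, ← hf.2.2, image_image]

/-- The curve in the base space that a flow traces out. -/
def SmoothFlow.curve (Φ : SmoothFlow d M) {S₀ : Hypersurface d M} (Γ : BaseSpace S₀) (t : ℝ) :
    BaseSpace S₀ :=
  ⟨Φ.image t Γ.1, by
    obtain ⟨Ψ, hΨ⟩ := Γ.2
    -- Points of the base space are images under time-one maps; rescaling the speed by `t` exhibits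
    -- `φ_t` as one.
    have h : (Φ.rescale t).φ 1 = Φ.φ t := by
      change Φ.φ (t * 1) = Φ.φ t
      rw [mul_one]
    have h1 : MapsHypersurface ((Φ.rescale t).φ 1) Γ.1 (Φ.image t Γ.1) := by
      rw [h]
      exact Φ.mapsHypersurface_image t Γ.1
    exact ⟨(Φ.rescale t).comp Ψ, h1.comp hΨ⟩⟩

lemma SmoothFlow.curve_zero (Φ : SmoothFlow d M) {S₀ : Hypersurface d M} (Γ : BaseSpace S₀) :
    Φ.curve Γ 0 = Γ := Subtype.ext (Φ.image_zero Γ.1)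

variable [T2Space M] [SigmaCompactSpace M] [MeasurableSpace M] [BorelSpace M]

/-- Take as velocity the smooth extension of the plus side of `u`: it coincides with `u.plus` on
`Γ`, and the anchor is formed from `u.plus`. -/
theorem exists_isCurveAlong (μ : KForm d M (d + 1)) {S₀ : Hypersurface d M} (Γ : BaseSpace S₀)
    (u : DVect Γ.1) :
    ∃ (Φ : SmoothFlow d M) (γ : ℝ → BaseSpace S₀), IsCurveAlong μ u Φ γ := by
  obtain ⟨V, W, hV, -, hVc, -, hVW⟩ := u.2.1
  obtain ⟨K, hK, hVK⟩ := hVc 0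
  obtain ⟨Φ, hΦ⟩ := exists_flow_hasVelocity (hV.apply 0) hK (hVK 0 (by simp))
  refine ⟨Φ, Φ.curve Γ, fun t => ?_, Φ.curve_zero Γ, V 0, hΦ, fun x hx z _ => ?_⟩
  · rw [Φ.curve_zero Γ]
    exact Φ.mapsHypersurface_image t Γ.1
  · simp only [anchor, contract]
    rw [(hVW 0).1.1 x (Or.inr hx)]

end Curves

end

end DiscontinuousFlow

open DiscontinuousFlow in
theorem mainTheorem2 (d : ℕ) {M : Type*} [TopologicalSpace M] [T2Space M] [SigmaCompactSpace M]
    [MeasurableSpace M] [BorelSpace M]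
    [ChartedSpace (Model d) M] [IsManifold (𝓡 (d + 1)) ∞ M]
    [Bundle.RiemannianBundle (fun x : M => TangentSpace (𝓡 (d + 1)) x)]
    [IsContMDiffRiemannianBundle (𝓡 (d + 1)) ∞ (Model d)
      (fun x : M => TangentSpace (𝓡 (d + 1)) x)]
    (μ : KForm d M (d + 1)) (hμ : IsRiemannianVolumeForm μ)
    (S₀ : Hypersurface d M)
    (F₁ F₂ : DualAlgebroid S₀ → ℝ) (dF₁ dF₂ : ∀ p : DualAlgebroid S₀, Cotangent p)
    (hF₁ : IsDifferential μ F₁ dF₁) (hF₂ : IsDifferential μ F₂ dF₂)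
    (Γ : BaseSpace S₀) (m : DOmega Γ.1)
    (v₁ v₂ : DVect Γ.1) (n₁ n₂ : SurfaceFun Γ.1)
    (h₁ : dF₁ ⟨Γ, m⟩ = (v₁, n₁)) (h₂ : dF₂ ⟨Γ, m⟩ = (v₂, n₂)) :
    HasPoissonBracket μ F₁ F₂ dF₁ dF₂ ⟨Γ, m⟩
      (integralM μ Γ.1 (formApply (regBracket v₁.1 v₂.1) m.1)
        + surfaceIntegral μ Γ.1
            (fun x => (n₂.1 x - jump (formApply v₂.1 m.1) x) • contract v₁.1.plus μ x)
        - surfaceIntegral μ Γ.1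
            (fun x => (n₁.1 x - jump (formApply v₁.1 m.1) x) • contract v₂.1.plus μ x)) := by
  have h := hasPoissonBracket_of_exists_curve hμ.1 hF₁ hF₂ ⟨Γ, m⟩ fun u => exists_isCurveAlong μ Γ u
  rw [h₁, h₂] at h
  exact h
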